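/- **Setting.** Fix an integer $d\ge 1$. At each round $t=1,\dots,T$ a learner sees a context $x_t\in[0,1]^d$, plays an action $\hat y_t\in[0,1]$, incurs the loss $\ell_t(\hat y_t)$, and then observes $\ell_t(y)$ for all $y\ge\hat y_t$ (one-sided full information feedback). The sequence of contexts and of $1$-Lipschitz losses $\ell_t:[0,1]\to[0,1]$ is fixed in advance. Let $\mathcal F$ be the set of all functions $f:[0,1]^d\to[0,1]$ that are $1$-Lipschitz for the sup norm on $[0,1]^d$. The regret is $$\mathrm{Reg}_T(\mathcal F)=\mathbb E\Big[\sum_{t=1}^T\ell_t(\hat y_t)\Big]-\inf_{f\in\mathcal F}\sum_{t=1}^T\ell_t(f(x_t)),$$ the expectation being over the learner's randomization. **The algorithm HierExp4$^\star$.** Its inputs are a depth $M\ge1$, an exploration parameter $\gamma\in(0,1)$, learning rates $\eta_m>0$ and penalizations $\alpha_m>0$. Let $\mathcal X_m(\sigma_1,\dots,\sigma_m)$, with $\sigma_k\in\{1,\dots,2^d\}$, be the dyadic cubes of width $2^{-m}$ that partition $[0,1]^d$ (sides half-open on the right, and closed at $1$); the cubes $\mathcal X_{m+1}(\sigma_1,\dots,\sigma_m,\cdot)$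 partition $\mathcal X_m(\sigma_1,\dots,\sigma_m)$. The covering tree has nodes $v=(\sigma_1,c_1,\dots,\sigma_m,c_m)$ at depths $m=0,\dots,M$ (leaves at depth $M$; the root is the empty tuple), and nodes $w=(\sigma_1,c_1,\dots,\sigma_m,c_m,\sigma_{m+1})$ at depths $m+\frac12$, $m=0,\dots,M-1$, where $c_k\in\{-1,0,1\}$. The children of $v$ are the $(v,\sigma_{m+1})$ and the children of $w$ are the three nodes $(w,c)$, $c\in\{-1,0,1\}$. A node is active at round $t$ if $x_t$ lies in the cube given by its $\sigma$'s. The actions are $k/2^M$ with $k\in\{1,\dots,2^M\}$. At round $t$: 1. An active leaf $(\sigma_1,c_1,\dots,\sigma_M,c_M)$ has $p_t(v,\cdot)$ equal to the unit mass at the $k$ with $k/2^M=\min\{\max\{\frac12+\sum_{m=1}^M2^{-m}c_m,\,2^{-M}\},1\}$. Each active node $w$ at depth $m+\frac12$ has $p_t(w,i)=\sum_{c}q_t(w,c)\,p_t((w,c),i)$, where $$q_t(w,c)\propto\exp\Big(-\eta_m\sum_{s<t,\ w\text{ active at }s}\tilde\ell_s(w,c)\Big),$$ so that $q_1$ is uniform.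 Each active non-leaf node $v$ at depth $m$ copies the distribution of its unique active child. 2. The index $I_t$ is drawn from $p_t^*(i)=(1-\gamma)\,p_t(\mathrm{root},i)+\gamma\,\mathbf 1\{i=1\}$, and $\hat y_t=I_t2^{-M}$ is played. 3. For each active node $w$ at depth $m+\frac12$, let $\mathcal K_t(w)=\{i:\exists c,\ p_t((w,c),i)>0\}$, $j_t(w)=\max\mathcal K_t(w)$ and $P^*_t(i)=\sum_{k\le i}p^*_t(k)$. For $i\in\mathcal K_t(w)$ and $c\in\{-1,0,1\}$ put $$\hat\ell_t(w,i)=\frac{\ell_t(i2^{-M})-\ell_t(j_t(w)2^{-M})+2^{1-m}}{P^*_t(i)}\mathbf 1\{I_t\le i\}-\frac{\alpha_m}{P_t^*(i)}+\frac{\alpha_m}{\gamma},\qquad \tilde\ell_t(w,c)=\sum_{i\in\mathcal K_t(w)}p_t((w,c),i)\,\hat\ell_t(w,i).$$ **Tuning.** For $T\ge3$ let $\gamma=T^{-1/2}(\ln T)^{-1}$ if $d=1$ and $\gamma=T^{-1/(d+2/3)}$ if $d\ge2$; let $M=\lceil\log_2(1/\gamma)\rceil$, $\eta_m=c_T\,2^{m(d/4+1)}\gamma^{1/2}T^{-1/4}$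 and $\alpha_m=\sum_{j=m+1}^M2^{4-2j}\eta_j$, where $c_T=2^{-5/4}2^{-1/2}$ if $d=1$, $c_T=2^{-5/4}M^{-1/2}$ if $2\le d\le4$, and $c_T=2^{d/4-3}$ if $d\ge5$. **Theorem.** There are constants depending only on $d$ such that, for all $T\ge3$, all contexts $x_1,\dots,x_T\in[0,1]^d$ and all $1$-Lipschitz losses $\ell_1,\dots,\ell_T:[0,1]\to[0,1]$, the algorithm HierExp4$^\star$ with this tuning satisfies $$\mathrm{Reg}_T(\mathcal F)=\begin{cases}\mathcal O\big(\sqrt{T\ln T}\big)&\text{if }d=1,\\ \mathcal O\big(T^{\frac{d-1/3}{d+2/3}}(\ln T)^{3/2}\big)&\text{if }d\ge2.\end{cases}$$ Moreover, its running time at every round is $\mathcal O(T^a)$ with $a=(1+\log_23)/(d+2/3)$. That is, for each $d$ there is one program (independent of $T$, of the contexts and of the losses) for a random access machine with real-number memory and unit-cost operations ($+,-$ and comparison on natural numbers, $+,-,\times,/,\exp$ and comparison on reals, memory access, query of the current loss at an allowed point), which is given $M,\gamma,(\eta_m),(\alpha_m)$ at the start and $x_t$ and a fresh uniform random number in $[0,1)$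 at each round, whose actions have exactly the joint law of $I_1,\dots,I_T$, and which executes, in each of the $T$ rounds and for all values of the random numbers, at most $C\,T^a$ operations. -/

import Mathlib

open scoped BigOperators

namespace HierExp4Star

/-! ### Contexts, dyadic cubes and the covering tree -/

/-- Contexts: points of the unit cube, with the sup distance. -/
abbrev Ctx (d : ℕ) : Type := Fin d → unitInterval

/-- The index of one of the `2 ^ d` halvings of a cube: for each coordinate, lower or upper half. -/
abbrev Subcube (d : ℕ) : Type := Fin d → Bool

/-- Lower corner of the dyadic cube with index `σ₁, …, σₘ`. -/
noncomputable def corner {d : ℕ} : List (Subcube d) → Fin d → ℝ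
  | [], _ => 0
  | s :: σ, j => (if s j then 1 / 2 else 0) + corner σ j / 2

/-- The dyadic cube of width `2 ^ (-m)` with index `σ₁, …, σₘ`; each side is half-open on the right,
except that it contains its right end when this is the boundary point `1`. -/
def cube {d : ℕ} (σ : List (Subcube d)) : Set (Ctx d) :=
  {x | ∀ j, corner σ j ≤ (x j : ℝ) ∧
    ((x j : ℝ) < corner σ j + (1 / 2 : ℝ) ^ σ.length ∨
      ((x j : ℝ) = 1 ∧ corner σ j + (1 / 2 : ℝ) ^ σ.length = 1))}

/-- Nodes `(σ₁, c₁, …, σₘ, cₘ)` at integer depth `m`, with `cₖ ∈ {-1, 0, 1}`. -/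
abbrev BinNode (d : ℕ) : Type := List (Subcube d × SignType)

/-- Nodes `(σ₁, c₁, …, σₘ, cₘ, σₘ₊₁)` at depth `m + 1 / 2`. -/
abbrev ExpNode (d : ℕ) : Type := BinNode d × Subcube d

/-- The cube labelling a node at depth `m + 1 / 2`. The node is activated by the contexts in it. -/
def cubeOf {d : ℕ} (w : ExpNode d) : Set (Ctx d) := cube (w.1.map Prod.fst ++ [w.2])

/-- The child of a node at depth `m + 1 / 2` obtained by appending the coefficient `c`. -/
def child {d : ℕ} (w : ExpNode d) (c : SignType) : BinNode d := w.1 ++ [(w.2, c)]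

/-- `∑ₖ 2 ^ (-k) cₖ`. -/
noncomputable def offset {d : ℕ} : BinNode d → ℝ
  | [] => 0
  | a :: v => (SignType.cast a.2 : ℝ) / 2 + offset v / 2

/-- The value labelling a node at integer depth. -/
noncomputable def label {d : ℕ} (v : BinNode d) : ℝ := 1 / 2 + offset v

/-! ### The algorithm -/

/-- Inputs of the algorithm: depth of the tree, exploration parameter, learning rates and
penalization parameters (one of each per depth). -/
structure Params where
  M : ℕ
  γ : ℝ
  η : ℕ → ℝ
  α : ℕ → ℝ

/-- The action `k / 2 ^ M` as a point of `[0, 1]`. -/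
noncomputable def grid (M k : ℕ) : unitInterval :=
  Set.projIcc (0 : ℝ) 1 zero_le_one ((k : ℝ) / 2 ^ M)

open Classical in
/-- The distribution over actions `k ∈ {1, …, 2 ^ M}` put out by an activated node at integer depth,
`r` levels above the leaves, when the context is `x` and `q` are the distributions over children.
A leaf plays its label clipped to `[2 ^ (-M), 1]`; any other node copies its activated child `(v, s)`
(the sum over `s` has a single nonzero term), which in turn mixes its three children. -/
noncomputable def actionLaw {d : ℕ} (M : ℕ) (q : ExpNode d → SignType → ℝ) (x : Ctx d) :
    ℕ → BinNode d → ℕ → ℝ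
  | 0, v, k => if (k : ℝ) / 2 ^ M = min (max (label v) (1 / 2 ^ M)) 1 then 1 else 0
  | r + 1, v, k => ∑ s : Subcube d,
      if x ∈ cubeOf (v, s) then
        ∑ c : SignType, q (v, s) c * actionLaw M q x r (child (v, s) c) k
      else 0

/-- Cumulative estimated losses of the children of each node at half-integer depth; this is the
state of the algorithm. -/
abbrev State (d : ℕ) : Type := ExpNode d → SignType → ℝ

/-- Exponential weights over the children of a node at depth `m + 1 / 2`. -/
noncomputable def weights {d : ℕ} (P : Params) (L : State d) (w : ExpNode d) (c : SignType) : ℝ :=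
  Real.exp (-(P.η w.1.length * L w c)) /
    ∑ c' : SignType, Real.exp (-(P.η w.1.length * L w c'))

/-- `p_t(v, k)` for a node `v` at integer depth. -/
noncomputable def nodeLaw {d : ℕ} (P : Params) (L : State d) (x : Ctx d) (v : BinNode d) (k : ℕ) :
    ℝ :=
  actionLaw P.M (weights P L) x (P.M - v.length) v k

/-- `p*_t(k)`: the distribution from which the action is drawn. -/
noncomputable def drawLaw {d : ℕ} (P : Params) (L : State d) (x : Ctx d) (k : ℕ) : ℝ :=
  (1 - P.γ) * nodeLaw P L x [] k + P.γ * (if k = 1 then 1 else 0)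

/-- `∑_{k ≤ i} p*_t(k)`. -/
noncomputable def drawCdf {d : ℕ} (P : Params) (L : State d) (x : Ctx d) (i : ℕ) : ℝ :=
  ∑ k ∈ Finset.Icc 1 i, drawLaw P L x k

open Classical in
/-- The actions to which some child of `w` gives positive probability. -/
noncomputable def support {d : ℕ} (P : Params) (L : State d) (x : Ctx d) (w : ExpNode d) :
    Finset ℕ :=
  (Finset.Icc 1 (2 ^ P.M)).filter fun k => ∃ c : SignType, 0 < nodeLaw P L x (child w c) k

/-- The penalized loss estimate of action `i` at the node `w`, when `I` is the action drawn. -/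
noncomputable def lossEst {d : ℕ} (P : Params) (L : State d) (x : Ctx d)
    (ℓ : unitInterval → unitInterval) (I : ℕ) (w : ExpNode d) (i : ℕ) : ℝ :=
  ((ℓ (grid P.M i) : ℝ) - (ℓ (grid P.M ((support P L x w).sup id)) : ℝ)
      + (2 : ℝ) ^ (1 - (w.1.length : ℤ))) / drawCdf P L x i * (if I ≤ i then 1 else 0)
    - P.α w.1.length / drawCdf P L x i + P.α w.1.length / P.γ

/-- The estimated loss of the child `c` of `w`. -/
noncomputable def expertLoss {d : ℕ} (P : Params) (L : State d) (x : Ctx d)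
    (ℓ : unitInterval → unitInterval) (I : ℕ) (w : ExpNode d) (c : SignType) : ℝ :=
  ∑ i ∈ support P L x w, nodeLaw P L x (child w c) i * lossEst P L x ℓ I w i

open Classical in
/-- Update of the cumulative losses at the end of a round: only activated nodes change. -/
noncomputable def updateState {d : ℕ} (P : Params) (L : State d) (x : Ctx d)
    (ℓ : unitInterval → unitInterval) (I : ℕ) : State d := fun w c =>
  L w c + if w.1.length < P.M ∧ x ∈ cubeOf w then expertLoss P L x ℓ I w c else 0

/-- The state before round `t` (rounds are numbered from `0`) when the actions `h 0, h 1, …` have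
been drawn. -/
noncomputable def stateAt {d : ℕ} (P : Params) (x : ℕ → Ctx d)
    (ℓ : ℕ → unitInterval → unitInterval) (h : ℕ → ℕ) : ℕ → State d
  | 0 => fun _ _ => 0
  | t + 1 => updateState P (stateAt P x ℓ h t) (x t) (ℓ t) (h t)

/-- Extension by zero of a finite sequence. -/
def pad {β : Type*} [Zero β] {T : ℕ} (h : Fin T → β) : ℕ → β :=
  fun t => if ht : t < T then h ⟨t, ht⟩ else 0

/-- Probability that the algorithm draws the actions `h 0, …, h (T - 1)` in the first `T` rounds. -/
noncomputable def pathProb {d : ℕ} (P : Params) (T : ℕ) (x : ℕ → Ctx d)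
    (ℓ : ℕ → unitInterval → unitInterval) (h : Fin T → ℕ) : ℝ :=
  ∏ t : Fin T, drawLaw P (stateAt P x ℓ (pad h) t) (x t) (h t)

/-- Expected cumulative loss of the algorithm over `T` rounds. -/
noncomputable def expectedLoss {d : ℕ} (P : Params) (T : ℕ) (x : ℕ → Ctx d)
    (ℓ : ℕ → unitInterval → unitInterval) : ℝ :=
  ∑ h ∈ Fintype.piFinset (fun _ : Fin T => Finset.Icc 1 (2 ^ P.M)),
    pathProb P T x ℓ h * ∑ t : Fin T, (ℓ t (grid P.M (h t)) : ℝ)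

/-- Regret against all `1`-Lipschitz policies `[0, 1]^d → [0, 1]`. -/
noncomputable def regret {d : ℕ} (P : Params) (T : ℕ) (x : ℕ → Ctx d)
    (ℓ : ℕ → unitInterval → unitInterval) : ℝ :=
  expectedLoss P T x ℓ -
    ⨅ f : {f : Ctx d → unitInterval // LipschitzWith 1 f},
      ∑ t ∈ Finset.range T, (ℓ t (f.1 (x t)) : ℝ)

/-! ### The tuning -/

/-- Exploration parameter. -/
noncomputable def tunedGamma (d T : ℕ) : ℝ :=
  if d = 1 then (T : ℝ) ^ (-(1 / 2) : ℝ) * (Real.log T)⁻¹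
  else (T : ℝ) ^ (-(1 / ((d : ℝ) + 2 / 3)))

/-- Depth of the tree. -/
noncomputable def tunedDepth (d T : ℕ) : ℕ := ⌈Real.logb 2 (1 / tunedGamma d T)⌉₊

/-- The factor `c_T`. -/
noncomputable def tunedC (d T : ℕ) : ℝ :=
  if d = 1 then (2 : ℝ) ^ (-(5 / 4) : ℝ) * (2 : ℝ) ^ (-(1 / 2) : ℝ)
  else if d ≤ 4 then (2 : ℝ) ^ (-(5 / 4) : ℝ) * (tunedDepth d T : ℝ) ^ (-(1 / 2) : ℝ)
  else (2 : ℝ) ^ ((d : ℝ) / 4 - 3)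

/-- Learning rates. -/
noncomputable def tunedEta (d T m : ℕ) : ℝ :=
  tunedC d T * (2 : ℝ) ^ ((m : ℝ) * ((d : ℝ) / 4 + 1)) * tunedGamma d T ^ (1 / 2 : ℝ) *
    (T : ℝ) ^ (-(1 / 4) : ℝ)

/-- Penalization parameters. -/
noncomputable def tunedAlpha (d T m : ℕ) : ℝ :=
  ∑ j ∈ Finset.Icc (m + 1) (tunedDepth d T), (2 : ℝ) ^ (4 - 2 * (j : ℤ)) * tunedEta d T j

/-- All parameters. -/
noncomputable def tuned (d T : ℕ) : Params where
  M := tunedDepth d T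
  γ := tunedGamma d T
  η := tunedEta d T
  α := tunedAlpha d T

/-! ### A real random access machine with unit-cost operations

Memory consists of arrays of natural numbers and arrays of real numbers, all named by numerals that
occur in the program and indexed dynamically. One unit of time is charged for every operation:
constant, memory access, arithmetic operation (`+`, `-` on naturals; `+`, `-`, `*`, `/`, `exp` on
reals), conversion of a natural number to a real one, comparison, assignment, query of the loss
function, loop step. -/

/-- Memory contents: `nat a i` and `real a i` are the `i`-th entries of the `a`-th arrays. -/
structure Mem where
  nat : ℕ → ℕ → ℕ
  real : ℕ → ℕ → ℝ

/-- Assignment to a cell holding a natural number. -/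
def Mem.setNat (μ : Mem) (a i n : ℕ) : Mem where
  nat := fun b j => if b = a ∧ j = i then n else μ.nat b j
  real := μ.real

/-- Assignment to a cell holding a real number. -/
def Mem.setReal (μ : Mem) (a i : ℕ) (r : ℝ) : Mem where
  nat := μ.nat
  real := fun b j => if b = a ∧ j = i then r else μ.real b j

/-- Expressions for natural numbers; `sub` is truncated subtraction. -/
inductive NatExpr : Type
  | const (n : ℕ)
  | get (a : ℕ) (i : NatExpr)
  | add (e f : NatExpr)
  | sub (e f : NatExpr)

def NatExpr.eval (μ : Mem) : NatExpr → ℕ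
  | .const n => n
  | .get a i => μ.nat a (i.eval μ)
  | .add e f => e.eval μ + f.eval μ
  | .sub e f => e.eval μ - f.eval μ

def NatExpr.cost : NatExpr → ℕ
  | .const _ => 1
  | .get _ i => i.cost + 1
  | .add e f => e.cost + f.cost + 1
  | .sub e f => e.cost + f.cost + 1

/-- Expressions for real numbers; `query y` asks for the value of the current loss at `y`. -/
inductive RealExpr : Type
  | const (r : ℚ)
  | ofNat (e : NatExpr)
  | get (a : ℕ) (i : NatExpr)
  | add (e f : RealExpr)
  | sub (e f : RealExpr)
  | mul (e f : RealExpr)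
  | div (e f : RealExpr)
  | exp (e : RealExpr)
  | query (y : RealExpr)

/-- Value of an expression, where `o` answers the queries. -/
noncomputable def RealExpr.eval (o : ℝ → ℝ) (μ : Mem) : RealExpr → ℝ
  | .const r => (r : ℝ)
  | .ofNat e => (e.eval μ : ℝ)
  | .get a i => μ.real a (i.eval μ)
  | .add e f => e.eval o μ + f.eval o μ
  | .sub e f => e.eval o μ - f.eval o μ
  | .mul e f => e.eval o μ * f.eval o μ
  | .div e f => e.eval o μ / f.eval o μ
  | .exp e => Real.exp (e.eval o μ)
  | .query y => o (y.eval o μ)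

def RealExpr.cost : RealExpr → ℕ
  | .const _ => 1
  | .ofNat e => e.cost + 1
  | .get _ i => i.cost + 1
  | .add e f => e.cost + f.cost + 1
  | .sub e f => e.cost + f.cost + 1
  | .mul e f => e.cost + f.cost + 1
  | .div e f => e.cost + f.cost + 1
  | .exp e => e.cost + 1
  | .query y => y.cost + 1

/-- Comparisons `e < f`. -/
inductive Test : Type
  | natLt (e f : NatExpr)
  | realLt (e f : RealExpr)

def Test.Holds (o : ℝ → ℝ) (μ : Mem) : Test → Prop
  | .natLt e f => e.eval μ < f.eval μ
  | .realLt e f => e.eval o μ < f.eval o μ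

def Test.cost : Test → ℕ
  | .natLt e f => e.cost + f.cost + 1
  | .realLt e f => e.cost + f.cost + 1

/-- Programs. In `loop a n p` the bound `n` is evaluated on entry to a number `N`, and `p` is run `N`
times, with entry `0` of the natural array `a` set to `0, 1, …, N - 1` in turn. -/
inductive Prog : Type
  | skip
  | setNat (a : ℕ) (i e : NatExpr)
  | setReal (a : ℕ) (i : NatExpr) (e : RealExpr)
  | seq (p q : Prog)
  | ite (b : Test) (p q : Prog)
  | loop (a : ℕ) (n : NatExpr) (p : Prog)

/-- Run `f 0, …, f (n - 1)` in turn, adding up the times and one unit per step. -/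
def iter (f : ℕ → Mem → Mem × ℕ) : ℕ → Mem → Mem × ℕ
  | 0, μ => (μ, 0)
  | n + 1, μ => ((f n (iter f n μ).1).1, (iter f n μ).2 + (f n (iter f n μ).1).2 + 1)

open Classical in
/-- Final memory and running time of a program, where `o` answers the queries. -/
noncomputable def Prog.exec (o : ℝ → ℝ) : Prog → Mem → Mem × ℕ
  | .skip, μ => (μ, 1)
  | .setNat a i e, μ => (μ.setNat a (i.eval μ) (e.eval μ), i.cost + e.cost + 1)
  | .setReal a i e, μ => (μ.setReal a (i.eval μ) (e.eval o μ), i.cost + e.cost + 1)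
  | .seq p q, μ => ((q.exec o (p.exec o μ).1).1, (p.exec o μ).2 + (q.exec o (p.exec o μ).1).2)
  | .ite b p q, μ =>
      if b.Holds o μ then ((p.exec o μ).1, b.cost + (p.exec o μ).2)
      else ((q.exec o μ).1, b.cost + (q.exec o μ).2)
  | .loop a n p, μ =>
      ((iter (fun k ν => p.exec o (ν.setNat a 0 k)) (n.eval μ) μ).1,
        n.cost + 1 + (iter (fun k ν => p.exec o (ν.setNat a 0 k)) (n.eval μ) μ).2)

/-! ### Learners on this machine, with one-sided full information feedback -/

/-- A learner: a program choosing the action and a program processing the feedback. -/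
structure Learner where
  select : Prog
  update : Prog

/-- Initial memory: the parameters, and zeros everywhere else. -/
def initMem (P : Params) : Mem where
  nat := fun a i => if a = 0 ∧ i = 0 then P.M else 0
  real := fun a i =>
    if a = 0 ∧ i = 0 then P.γ
    else if a = 1 ∧ i ≤ P.M then P.η i
    else if a = 2 ∧ i ≤ P.M then P.α i
    else 0

/-- At the start of a round the context is written to the real array `3`, and a fresh random number
to entry `0` of the real array `4`. -/
noncomputable def receive {d : ℕ} (x : Ctx d) (u : ℝ) (μ : Mem) : Mem where
  nat := μ.nat
  real := fun a i =>
    if a = 3 then (if hi : i < d then (x ⟨i, hi⟩ : ℝ) else μ.real a i)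
    else if a = 4 ∧ i = 0 then u
    else μ.real a i

/-- Before an action is played, queries give no information. -/
def blind : ℝ → ℝ := fun _ => 0

/-- After `k / 2 ^ M` is played, the loss can be queried at all points of `[k / 2 ^ M, 1]`; other
queries give no information. -/
noncomputable def oneSided (M k : ℕ) (ℓ : unitInterval → unitInterval) : ℝ → ℝ := fun y =>
  if (k : ℝ) / 2 ^ M ≤ y ∧ y ≤ 1 then (ℓ (Set.projIcc (0 : ℝ) 1 zero_le_one y) : ℝ) else 0

/-- Memory and time used once the action has been selected. -/
noncomputable def Learner.afterSelect {d : ℕ} (A : Learner) (x : Ctx d) (u : ℝ) (μ : Mem) :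
    Mem × ℕ :=
  A.select.exec blind (receive x u μ)

/-- The index of the action played in a round started from the memory `μ`: entry `0` of the natural
array `1` after selection. -/
noncomputable def Learner.choice {d : ℕ} (A : Learner) (x : Ctx d) (u : ℝ) (μ : Mem) : ℕ :=
  (A.afterSelect x u μ).1.nat 1 0

/-- Memory and time used by the processing of the feedback. -/
noncomputable def Learner.afterUpdate {d : ℕ} (A : Learner) (M : ℕ) (x : Ctx d)
    (ℓ : unitInterval → unitInterval) (u : ℝ) (μ : Mem) : Mem × ℕ :=
  A.update.exec (oneSided M (A.choice x u μ) ℓ) (A.afterSelect x u μ).1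

/-- Memory before round `t`, when the random numbers are `u 0, u 1, …`. -/
noncomputable def Learner.memAt {d : ℕ} (A : Learner) (P : Params) (x : ℕ → Ctx d)
    (ℓ : ℕ → unitInterval → unitInterval) (u : ℕ → ℝ) : ℕ → Mem
  | 0 => initMem P
  | t + 1 => (A.afterUpdate P.M (x t) (ℓ t) (u t) (A.memAt P x ℓ u t)).1

/-- The index of the action played in round `t`. -/
noncomputable def Learner.playAt {d : ℕ} (A : Learner) (P : Params) (x : ℕ → Ctx d)
    (ℓ : ℕ → unitInterval → unitInterval) (u : ℕ → ℝ) (t : ℕ) : ℕ :=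
  A.choice (x t) (u t) (A.memAt P x ℓ u t)

/-- The total running time of round `t`. -/
noncomputable def Learner.timeAt {d : ℕ} (A : Learner) (P : Params) (x : ℕ → Ctx d)
    (ℓ : ℕ → unitInterval → unitInterval) (u : ℕ → ℝ) (t : ℕ) : ℕ :=
  (A.afterSelect (x t) (u t) (A.memAt P x ℓ u t)).2 +
    (A.afterUpdate P.M (x t) (ℓ t) (u t) (A.memAt P x ℓ u t)).2

/-- When the random numbers are independent and uniform on `[0, 1)`, the actions played by the
learner in the first `T` rounds have exactly the joint law of those of the algorithm. -/
def Learner.Implements {d : ℕ} (A : Learner) (P : Params) (T : ℕ) (x : ℕ → Ctx d)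
    (ℓ : ℕ → unitInterval → unitInterval) : Prop :=
  ∀ h : Fin T → ℕ,
    MeasureTheory.volume {u : Fin T → ℝ | (∀ t, u t ∈ Set.Ico (0 : ℝ) 1) ∧
        ∀ t : Fin T, A.playAt P x ℓ (pad u) t = h t} =
      ENNReal.ofReal (pathProb P T x ℓ h)

end HierExp4Star

/-! Regret. Fix a 1-Lipschitz policy `f` and follow, down the tree, the coefficients `track f`. The
active label at depth m then stays within 2^(-m) of `f x` (`abs_sub_label_compPath_le`), so the
comparator leaf costs at most 2·2^(-M) more than `f` per round (`meanLoss_leaf_le`). It remains to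
compare the root with that leaf, one node at a time.

At a node of depth m + 1/2 all supported actions lie within 2^(1-m) of each other (`dist_support`).
Shifting by the loss of the largest supported action therefore gives nonnegative losses of size at
most 2^(2-m). The shift is observable whenever the action itself is, since feedback covers
everything above the draw. Nonnegativity gives the second order bound for exponential weights
(`potential_step`), with a cost of log 3/η_m per comparator node, and there are at most 2^(d(m+1))
of those at that depth (`sum_surplus_compPath_le`).

The second moment of an importance weighted estimate is of order 2^(-2m) times the mean of 1/P*,
which may be as large as 1/γ. The penalization handles it. In expectation a child is charged its
loss minus α_m times its mean of 1/P*, up to a constant common to the three children, while the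
variance term of the mixture is at most 2^(4-2m) η_m times the mixture's mean of 1/P*, plus η_m
(α_m/γ)^2. Because α_(m-1) = α_m + 2^(4-2m) η_m, the penalized losses telescope along the comparator
path (`le_drawMean_surplus`, `drawMean_loss_le_surplus`). The term left at the leaf has the
favourable sign. Only the root's mean of 1/P* is paid for, and there it is a Riemann sum of dP/P,
hence at most log(1/γ)/(1-γ) (`meanInv_root_le`).

These inequalities hold in conditional mean at each round, and `sum_pathProb_mul_nonneg` integrates
them over the draws. The outcome is `regret_le`; after tuning its sums over depths are geometric.
Their behaviour depends on whether the ratios 2^(d/4-1) and 2^(3d/4-1) exceed 1, which separates d =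
1, 2 ≤ d ≤ 4 and d ≥ 5 (`rateSums_of_lt_one`, `rateSums_of_le_one`, `rateSums_of_one_lt`).

Running time. For a given context the active nodes form a complete ternary tree with (3^M - 1)/2
internal nodes, enumerated in heap order by `treeNode`. The program stores only the cumulative
losses between rounds, at addresses given by an injective `code` of the full tree. For each of the
2^M actions in turn it computes the probabilities at all active nodes from the leaves upwards
(`columnProg_spec`), so that a round takes of order 2^M·3^M = (2^M)^(1 + log_2 3) operations, with
2^M of order 1/γ.

Exactness of the law. The action is drawn by inverting the cumulative distribution function, so the
random numbers that produce a given sequence of actions form a box whose side lengths are the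
conditional probabilities (`treeLearner_implements`). -/

namespace HierExp4Star

/-! ### Binary expansions and dyadic cubes -/

/-- The relative position of `y` in its dyadic interval of width `2 ^ (-m)`. -/
noncomputable def resid (y : ℝ) : ℕ → ℝ
  | 0 => y
  | m + 1 => if 1 / 2 ≤ resid y m then 2 * resid y m - 1 else 2 * resid y m

/-- The halving at depth `m` that contains `x`. -/
noncomputable def bits {d : ℕ} (x : Ctx d) (m : ℕ) : Subcube d :=
  fun j => decide ((1 : ℝ) / 2 ≤ resid (x j) m)

/-- Index of the dyadic cube of width `2 ^ (-m)` that contains `x`. -/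
noncomputable def addr {d : ℕ} (x : Ctx d) : ℕ → List (Subcube d)
  | 0 => []
  | m + 1 => addr x m ++ [bits x m]

@[simp] lemma length_addr {d : ℕ} (x : Ctx d) (m : ℕ) : (addr x m).length = m := by
  induction m with
  | zero => rfl
  | succ m ih => simp [addr, ih]

lemma corner_append {d : ℕ} (σ : List (Subcube d)) (s : Subcube d) (j : Fin d) :
    corner (σ ++ [s]) j = corner σ j + if s j then (1 / 2 : ℝ) ^ (σ.length + 1) else 0 := by
  induction σ with
  | nil => simp [corner]
  | cons a σ ih =>
    simp only [List.cons_append, corner, ih, List.length_cons]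
    split_ifs <;> ring

/-- Doubling and removing the leading bit preserves [0, 1), and 1 is a fixed point reached from no
other start. This matches the cubes being closed on the right only at the boundary point 1. -/
lemma resid_mem {y : ℝ} (h0 : 0 ≤ y) (h1 : y ≤ 1) (m : ℕ) :
    0 ≤ resid y m ∧ (resid y m < 1 ∨ (resid y m = 1 ∧ y = 1)) := by
  induction m with
  | zero =>
    refine ⟨h0, ?_⟩
    rcases h1.lt_or_eq with h | h
    · exact Or.inl h
    · exact Or.inr ⟨h, h⟩
  | succ m ih =>
    obtain ⟨ha, hb⟩ := ih
    simp only [resid]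
    split_ifs with h
    · refine ⟨by linarith, ?_⟩
      rcases hb with hb | ⟨hb, hy⟩
      · left; linarith
      · right; exact ⟨by linarith, hy⟩
    · exact ⟨by linarith, Or.inl (by linarith)⟩

lemma corner_addr {d : ℕ} (x : Ctx d) (m : ℕ) (j : Fin d) :
    (x j : ℝ) = corner (addr x m) j + (1 / 2 : ℝ) ^ m * resid (x j) m := by
  induction m with
  | zero => simp [addr, corner, resid]
  | succ m ih =>
    rw [addr, corner_append]
    simp only [bits, resid, length_addr, decide_eq_true_eq]
    refine ih.trans ?_
    split_ifs <;> ring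

lemma mem_cube_addr {d : ℕ} (x : Ctx d) (m : ℕ) : x ∈ cube (addr x m) := by
  intro j
  have h := corner_addr x m j
  have hp : (0 : ℝ) < (1 / 2 : ℝ) ^ m := by positivity
  obtain ⟨h0, h1⟩ := resid_mem (x j).2.1 (x j).2.2 m
  have h0' := mul_nonneg hp.le h0
  rw [length_addr]
  refine ⟨by linarith, ?_⟩
  rcases h1 with h1 | ⟨h1, hx⟩
  · left
    have := mul_lt_mul_of_pos_left h1 hp
    linarith
  · right
    rw [h1] at h
    exact ⟨hx, by linarith⟩

lemma cube_append_subset {d : ℕ} {σ : List (Subcube d)} {s : Subcube d} {x : Ctx d}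
    (h : x ∈ cube (σ ++ [s])) : x ∈ cube σ := by
  intro j
  have hp : (0 : ℝ) < (1 / 2 : ℝ) ^ σ.length := by positivity
  have h := h j
  rw [corner_append, List.length_append, List.length_singleton, pow_succ] at h
  obtain ⟨h0, h1⟩ := h
  split_ifs at h0 h1 with hs
  · refine ⟨by linarith, ?_⟩
    rcases h1 with h1 | ⟨h1, h2⟩
    · left; linarith
    · right; exact ⟨h1, by linarith⟩
  · refine ⟨by linarith, Or.inl ?_⟩
    rcases h1 with h1 | ⟨h1, h2⟩ <;> linarith

lemma resid_one (m : ℕ) : resid 1 m = 1 := by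
  induction m with
  | zero => rfl
  | succ m ih => norm_num [resid, ih]

/-- Uniqueness of the halving: within a dyadic cube the relative position of the context decides
each coordinate of the next index. -/
lemma mem_cube_append {d : ℕ} {m : ℕ} {s : Subcube d} {x : Ctx d}
    (h : x ∈ cube (addr x m ++ [s])) : s = bits x m := by
  funext j
  have hp : (0 : ℝ) < (1 / 2 : ℝ) ^ m := by positivity
  have h := h j
  rw [corner_append, List.length_append, List.length_singleton, length_addr, pow_succ] at h
  have hx := corner_addr x m j
  obtain ⟨h0, h1⟩ := h
  have hb : s j = true ↔ (1 : ℝ) / 2 ≤ resid (x j) m := by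
    constructor
    · intro hs
      rw [if_pos hs] at h0
      by_contra hc
      push Not at hc
      have := mul_lt_mul_of_pos_left hc hp
      linarith
    · intro hc
      by_contra hs
      rw [if_neg hs] at h0 h1
      have := mul_le_mul_of_nonneg_left hc hp.le
      rcases h1 with h1 | ⟨h1, h2⟩
      · linarith
      -- A lower half closed at 1 would give the boundary point relative position 1/2, whereas
      -- `resid 1 m` is always 1.
      · have hr : (1 / 2 : ℝ) ^ m * resid (x j) m = (1 / 2 : ℝ) ^ m * (1 / 2) := by linarith
        have hr' := mul_left_cancel₀ hp.ne' hr
        rw [h1, resid_one] at hr'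
        norm_num at hr'
  rw [Bool.eq_iff_iff, hb]
  simp [bits]

/-- The cubes of each width partition the unit cube. From here on, activity of a node is an equality
of index lists and no geometry is needed. -/
lemma mem_cube_iff {d : ℕ} (σ : List (Subcube d)) (x : Ctx d) :
    x ∈ cube σ ↔ σ = addr x σ.length := by
  constructor
  · induction σ using List.reverseRecOn with
    | nil => intro _; rfl
    | append_singleton σ s ih =>
      intro h
      have h1 := ih (cube_append_subset h)
      rw [List.length_append, List.length_singleton, addr, ← h1]
      congr 2
      rw [h1] at h
      exact mem_cube_append h
  · intro h
    rw [h]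
    exact mem_cube_addr x _

/-- The nodes whose cube contains `x`. -/
def Active {d : ℕ} (x : Ctx d) (v : BinNode d) : Prop := v.map Prod.fst = addr x v.length

lemma active_nil {d : ℕ} (x : Ctx d) : Active x [] := rfl

lemma mem_cubeOf_iff {d : ℕ} (x : Ctx d) (w : ExpNode d) :
    x ∈ cubeOf w ↔ Active x w.1 ∧ w.2 = bits x w.1.length := by
  rw [cubeOf, mem_cube_iff]
  simp only [List.length_append, List.length_map, List.length_singleton, addr, Active]
  constructor
  · intro h
    have := List.append_inj h (by simp)
    simpa using this
  · rintro ⟨h1, h2⟩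
    rw [h1, h2]

@[simp] lemma length_child {d : ℕ} (w : ExpNode d) (c : SignType) :
    (child w c).length = w.1.length + 1 := by simp [child]

lemma active_child {d : ℕ} {x : Ctx d} {w : ExpNode d} (h : x ∈ cubeOf w) (c : SignType) :
    Active x (child w c) := by
  rw [mem_cubeOf_iff] at h
  rw [Active, length_child, addr, ← h.2, ← h.1, child, List.map_append, List.map_singleton]

/-- The child of an active node that is activated by `x`. -/
noncomputable def activeExp {d : ℕ} (x : Ctx d) (v : BinNode d) : ExpNode d :=
  (v, bits x v.length)

lemma mem_cubeOf_activeExp {d : ℕ} {x : Ctx d} {v : BinNode d} (h : Active x v) :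
    x ∈ cubeOf (activeExp x v) := (mem_cubeOf_iff _ _).2 ⟨h, rfl⟩

lemma offset_append {d : ℕ} (v : BinNode d) (s : Subcube d) (c : SignType) :
    offset (v ++ [(s, c)]) = offset v + (SignType.cast c : ℝ) * (1 / 2) ^ (v.length + 1) := by
  induction v with
  | nil => simp [offset]; ring
  | cons a v ih =>
    simp only [List.cons_append, offset, ih, List.length_cons]
    ring

lemma label_child {d : ℕ} (w : ExpNode d) (c : SignType) :
    label (child w c) = label w.1 + (SignType.cast c : ℝ) * (1 / 2) ^ (w.1.length + 1) := by
  rw [label, child, offset_append, label]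
  ring

lemma abs_signCast_le (c : SignType) : |(SignType.cast c : ℝ)| ≤ 1 := by
  cases c <;> simp

lemma dist_label_child {d : ℕ} (w : ExpNode d) (c : SignType) :
    |label (child w c) - label w.1| ≤ (1 / 2) ^ (w.1.length + 1) := by
  have h := abs_signCast_le c
  have hp : (0 : ℝ) ≤ (1 / 2) ^ (w.1.length + 1) := by positivity
  rw [label_child, add_sub_cancel_left, abs_mul, abs_of_nonneg hp]
  exact mul_le_of_le_one_left hp h

/-! ### Action laws -/

/-- Projection of labels to the interval spanned by the actions. -/
noncomputable def clip (M : ℕ) (y : ℝ) : ℝ := min (max y (1 / 2 ^ M)) 1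

lemma abs_clip_sub_le (M : ℕ) (y z : ℝ) : |clip M y - clip M z| ≤ |y - z| := by
  refine (abs_min_sub_min_le_max _ _ _ _).trans ?_
  rw [sub_self, abs_zero, max_eq_left (abs_nonneg _)]
  refine (abs_max_sub_max_le_max _ _ _ _).trans ?_
  rw [sub_self, abs_zero, max_eq_left (abs_nonneg _)]

lemma exists_label_eq {d : ℕ} (v : BinNode d) : ∃ z : ℤ, offset v = z / 2 ^ v.length := by
  induction v with
  | nil => exact ⟨0, by simp [offset]⟩
  | cons a v ih =>
    obtain ⟨z, hz⟩ := ih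
    refine ⟨(SignType.cast a.2 : ℤ) * 2 ^ v.length + z, ?_⟩
    have hc : (SignType.cast a.2 : ℝ) = ((SignType.cast a.2 : ℤ) : ℝ) := by
      cases a.2 <;> simp
    rw [offset, hz, hc, List.length_cons]
    push_cast
    field_simp
    ring

/-- A leaf plays one of the actions. -/
lemma exists_action {d : ℕ} {M : ℕ} (hM : 1 ≤ M) {v : BinNode d} (hv : v.length = M) :
    ∃ k : ℕ, k ∈ Finset.Icc 1 (2 ^ M) ∧ (k : ℝ) / 2 ^ M = clip M (label v) := by
  obtain ⟨z, hz⟩ := exists_label_eq v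
  rw [hv] at hz
  have hp : (0 : ℝ) < 2 ^ M := by positivity
  -- The root label 1/2 is itself a multiple of 2^(-M) because M ≥ 1, so every leaf label lies on
  -- the grid.
  have hl : label v = ((2 ^ (M - 1) + z : ℤ) : ℝ) / 2 ^ M := by
    obtain ⟨n, rfl⟩ : ∃ n, M = n + 1 := ⟨M - 1, by omega⟩
    rw [label, hz]
    push_cast
    rw [pow_succ]
    field_simp
  set y : ℤ := 2 ^ (M - 1) + z
  have hN : (1 : ℤ) ≤ 2 ^ M := by exact_mod_cast Nat.one_le_two_pow
  refine ⟨(min (max y 1) (2 ^ M)).toNat, ?_, ?_⟩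
  · rw [Finset.mem_Icc]
    have h1 : (1 : ℤ) ≤ min (max y 1) (2 ^ M) := le_min (le_max_right _ _) hN
    have h2 : min (max y 1) (2 ^ M) ≤ (2 : ℤ) ^ M := min_le_right _ _
    refine ⟨by omega, ?_⟩
    have : ((min (max y 1) (2 ^ M)).toNat : ℤ) ≤ ((2 ^ M : ℕ) : ℤ) := by
      rw [Int.toNat_of_nonneg (zero_le_one.trans h1)]
      push_cast
      exact h2
    exact_mod_cast this
  · have h1 : (1 : ℤ) ≤ min (max y 1) (2 ^ M) := le_min (le_max_right _ _) hN
    have h2 : (((min (max y 1) (2 ^ M)).toNat : ℤ) : ℝ) = ((min (max y 1) (2 ^ M) : ℤ) : ℝ) := by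
      congr 1
      exact Int.toNat_of_nonneg (zero_le_one.trans h1)
    rw [Int.cast_natCast] at h2
    rw [h2, clip, hl]
    push_cast
    rw [← min_div_div_right hp.le, ← max_div_div_right hp.le, div_self hp.ne']

section laws

variable {d : ℕ} {M : ℕ} {q : ExpNode d → SignType → ℝ} {x : Ctx d}

lemma actionLaw_succ {r : ℕ} {v : BinNode d} (hv : Active x v) (k : ℕ) :
    actionLaw M q x (r + 1) v k =
      ∑ c : SignType, q (activeExp x v) c * actionLaw M q x r (child (activeExp x v) c) k := by
  rw [actionLaw, Finset.sum_eq_single (bits x v.length)]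
  · exact if_pos (mem_cubeOf_activeExp hv)
  · intro s _ hs
    rw [if_neg]
    rw [mem_cubeOf_iff]
    exact fun h => hs h.2
  · simp

lemma actionLaw_nonneg (hq : ∀ w c, 0 ≤ q w c) (r : ℕ) (v : BinNode d) (k : ℕ) :
    0 ≤ actionLaw M q x r v k := by
  induction r generalizing v with
  | zero => rw [actionLaw]; split_ifs <;> norm_num
  | succ r ih =>
    rw [actionLaw]
    refine Finset.sum_nonneg fun s _ => ?_
    split_ifs
    · exact Finset.sum_nonneg fun c _ => mul_nonneg (hq _ _) (ih _)
    · exact le_rfl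

lemma sum_actionLaw (hM : 1 ≤ M) (hq1 : ∀ w, ∑ c, q w c = 1) (r : ℕ) (v : BinNode d)
    (hv : Active x v) (hr : v.length + r = M) :
    ∑ k ∈ Finset.Icc 1 (2 ^ M), actionLaw M q x r v k = 1 := by
  induction r generalizing v with
  | zero =>
    obtain ⟨k, hk, h⟩ := exists_action hM hr
    rw [Finset.sum_eq_single k]
    · rw [actionLaw]
      exact if_pos h
    · intro j _ hj
      rw [actionLaw, if_neg]
      intro h'
      apply hj
      rw [← clip, ← h, div_left_inj' (by positivity)] at h'
      exact_mod_cast h'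
    · exact fun h' => absurd hk h'
  | succ r ih =>
    simp_rw [actionLaw_succ hv]
    rw [Finset.sum_comm]
    simp_rw [← Finset.mul_sum]
    rw [← hq1 (activeExp x v)]
    refine Finset.sum_congr rfl fun c _ => ?_
    rw [ih, mul_one]
    · exact active_child (mem_cubeOf_activeExp hv) c
    · rw [length_child]
      change v.length + 1 + r = M
      omega

/-- A charged action is the clipped label of some leaf below `v`. The displacements 2^(-(m+1)),
2^(-(m+2)), … of the labels below depth m sum to less than 2^(-m); in the induction one half is
spent on the step to the child and the other below it. -/
lemma actionLaw_pos (r : ℕ) (v : BinNode d) (hr : v.length + r = M) (k : ℕ)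
    (h : actionLaw M q x r v k ≠ 0) :
    ∃ y : ℝ, |y - label v| ≤ (1 / 2) ^ v.length ∧ (k : ℝ) / 2 ^ M = clip M y := by
  induction r generalizing v with
  | zero =>
    rw [actionLaw] at h
    refine ⟨label v, by simp, ?_⟩
    by_contra hc
    exact h (if_neg hc)
  | succ r ih =>
    rw [actionLaw] at h
    obtain ⟨s, -, hs⟩ := Finset.exists_ne_zero_of_sum_ne_zero h
    split_ifs at hs with hx
    · obtain ⟨c, -, hc⟩ := Finset.exists_ne_zero_of_sum_ne_zero hs
      obtain ⟨y, hy, hk⟩ := ih (child (v, s) c) (by rw [length_child]; change v.length + 1 + r = M; omega)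
        (right_ne_zero_of_mul hc)
      refine ⟨y, ?_, hk⟩
      have h1 := dist_label_child (v, s) c
      rw [length_child] at hy
      calc |y - label v| = |(y - label (child (v, s) c)) + (label (child (v, s) c) - label v)| := by
            ring_nf
        _ ≤ _ := abs_add_le _ _
        _ ≤ (1 / 2) ^ (v.length + 1) + (1 / 2) ^ (v.length + 1) := add_le_add hy h1
        _ = (1 / 2) ^ v.length := by ring
    · exact absurd rfl hs

end laws

lemma actionLaw_zero_action {d M : ℕ} {q : ExpNode d → SignType → ℝ} {x : Ctx d} (r : ℕ)
    (v : BinNode d) {k : ℕ} (hk : k ∉ Finset.Icc 1 (2 ^ M)) : actionLaw M q x r v k = 0 := by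
  induction r generalizing v with
  | zero =>
    rw [actionLaw, if_neg]
    intro h
    apply hk
    have hp : (0 : ℝ) < 2 ^ M := by positivity
    have hp1 : (1 : ℝ) ≤ 2 ^ M := one_le_pow₀ (by norm_num)
    have h1 : 1 / 2 ^ M ≤ (k : ℝ) / 2 ^ M := by
      rw [h]
      refine le_min (le_max_right _ _) ?_
      rw [div_le_one hp]
      exact hp1
    have h2 : (k : ℝ) / 2 ^ M ≤ 1 := h ▸ min_le_right _ _
    rw [div_le_div_iff_of_pos_right hp] at h1
    rw [div_le_one hp] at h2
    rw [Finset.mem_Icc]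
    exact ⟨by exact_mod_cast h1, by exact_mod_cast h2⟩
  | succ r ih =>
    rw [actionLaw]
    refine Finset.sum_eq_zero fun s _ => ?_
    split_ifs
    · exact Finset.sum_eq_zero fun c _ => by rw [ih, mul_zero]
    · rfl

lemma weights_pos {d : ℕ} (P : Params) (L : State d) (w : ExpNode d) (c : SignType) :
    0 < weights P L w c :=
  div_pos (Real.exp_pos _)
    (Finset.sum_pos (fun _ _ => Real.exp_pos _) Finset.univ_nonempty)

lemma sum_weights {d : ℕ} (P : Params) (L : State d) (w : ExpNode d) :
    ∑ c, weights P L w c = 1 := by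
  simp only [weights]
  rw [← Finset.sum_div, div_self]
  exact (Finset.sum_pos (fun _ _ => Real.exp_pos _) Finset.univ_nonempty).ne'

section nodeLaw

variable {d : ℕ} (P : Params) (L : State d) (x : Ctx d)

lemma nodeLaw_nonneg (v : BinNode d) (k : ℕ) : 0 ≤ nodeLaw P L x v k :=
  actionLaw_nonneg (fun w c => (weights_pos P L w c).le) _ _ _

variable {P x}

lemma nodeLaw_eq_sum {v : BinNode d} (hv : Active x v) (hl : v.length < P.M) (k : ℕ) :
    nodeLaw P L x v k = ∑ c : SignType,
      weights P L (activeExp x v) c * nodeLaw P L x (child (activeExp x v) c) k := by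
  obtain ⟨r, hr⟩ : ∃ r, P.M - v.length = r + 1 := ⟨P.M - v.length - 1, by omega⟩
  have hr' : P.M - (v.length + 1) = r := by omega
  simp only [nodeLaw, length_child]
  rw [hr, actionLaw_succ hv]
  simp only [activeExp, hr']

lemma nodeLaw_leaf {v : BinNode d} (hl : v.length = P.M) (k : ℕ) :
    nodeLaw P L x v k = if (k : ℝ) / 2 ^ P.M = clip P.M (label v) then 1 else 0 := by
  rw [nodeLaw, hl, Nat.sub_self, actionLaw]
  rfl

lemma sum_nodeLaw (hM : 1 ≤ P.M) {v : BinNode d} (hv : Active x v) (hl : v.length ≤ P.M) :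
    ∑ k ∈ Finset.Icc 1 (2 ^ P.M), nodeLaw P L x v k = 1 :=
  sum_actionLaw hM (sum_weights P L) _ _ hv (by omega)

lemma nodeLaw_eq_zero (v : BinNode d) {k : ℕ} (hk : k ∉ Finset.Icc 1 (2 ^ P.M)) :
    nodeLaw P L x v k = 0 := actionLaw_zero_action _ _ hk

end nodeLaw

/-! ### Exponential weights -/

/-- The product (1 + y + y^2/2)(1 - y + y^2/2) equals 1 + y^4/4. No upper bound on y is needed, so
the learning rates need not be small compared with the size of the estimates. -/
lemma exp_neg_le_quadratic {y : ℝ} (hy : 0 ≤ y) : Real.exp (-y) ≤ 1 - y + y ^ 2 / 2 := by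
  have h := Real.quadratic_le_exp_of_nonneg hy
  have hp : 0 < 1 + y + y ^ 2 / 2 := by positivity
  rw [Real.exp_neg]
  calc (Real.exp y)⁻¹ ≤ (1 + y + y ^ 2 / 2)⁻¹ := inv_anti₀ hp h
    _ ≤ 1 - y + y ^ 2 / 2 := by
      rw [inv_le_iff_one_le_mul₀ hp]
      nlinarith [sq_nonneg (y ^ 2)]

/-- The potential of the exponential weights forecaster with learning rate `η`. -/
noncomputable def potential (η : ℝ) (L : SignType → ℝ) : ℝ :=
  -(Real.log (∑ c, Real.exp (-(η * L c))) / η)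

lemma potential_le {η : ℝ} (hη : 0 < η) (L : SignType → ℝ) (c : SignType) :
    potential η L ≤ L c := by
  have h : Real.exp (-(η * L c)) ≤ ∑ c, Real.exp (-(η * L c)) :=
    Finset.single_le_sum (f := fun c => Real.exp (-(η * L c)))
      (fun _ _ => (Real.exp_pos _).le) (Finset.mem_univ c)
  have h2 := Real.log_le_log (Real.exp_pos _) h
  rw [Real.log_exp] at h2
  rw [potential, neg_le, le_div_iff₀ hη]
  linarith

lemma potential_zero (η : ℝ) : potential η (fun _ => 0) = -(Real.log 3 / η) := by
  have : Fintype.card SignType = 3 := rfl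
  simp [potential, this]

/-- The ratio of successive normalizations is at most 1 - ηA ≤ exp(-ηA), where A is the weighted
mean of g - η g^2/2. The second order term is kept under the current weights, so that later it can
be averaged like the loss itself. -/
lemma potential_step {η : ℝ} (hη : 0 < η) (L g : SignType → ℝ) (hg : ∀ c, 0 ≤ g c) :
    ∑ c, Real.exp (-(η * L c)) / (∑ c', Real.exp (-(η * L c'))) * (g c - η / 2 * g c ^ 2) ≤
      potential η (fun c => L c + g c) - potential η L := by
  set Z := ∑ c', Real.exp (-(η * L c')) with hZ
  have hZp : 0 < Z := Finset.sum_pos (fun _ _ => Real.exp_pos _) Finset.univ_nonempty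
  set Z' := ∑ c', Real.exp (-(η * (L c' + g c'))) with hZ'
  have hZp' : 0 < Z' := Finset.sum_pos (fun _ _ => Real.exp_pos _) Finset.univ_nonempty
  set A := ∑ c, Real.exp (-(η * L c)) / Z * (g c - η / 2 * g c ^ 2) with hA
  have h1 : Z' ≤ Z - η * (Z * A) := by
    have : Z - η * (Z * A) =
        ∑ c, Real.exp (-(η * L c)) * (1 - η * g c + (η * g c) ^ 2 / 2) := by
      rw [hA, Finset.mul_sum, Finset.mul_sum, hZ, ← hZ, ← Finset.sum_sub_distrib]
      refine Finset.sum_congr rfl fun c _ => ?_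
      field_simp
      ring
    rw [this]
    refine Finset.sum_le_sum fun c _ => ?_
    rw [show -(η * (L c + g c)) = -(η * L c) + -(η * g c) by ring, Real.exp_add]
    exact mul_le_mul_of_nonneg_left
      (exp_neg_le_quadratic (mul_nonneg hη.le (hg c))) (Real.exp_pos _).le
  have h2 : Z' / Z ≤ Real.exp (-(η * A)) := by
    rw [div_le_iff₀ hZp]
    have := Real.add_one_le_exp (-(η * A))
    nlinarith
  have h3 := Real.log_le_log (div_pos hZp' hZp) h2
  rw [Real.log_exp, Real.log_div hZp'.ne' hZp.ne'] at h3
  rw [potential, potential, ← hZ, ← hZ', neg_sub_neg, ← sub_div, le_div_iff₀ hη]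
  linarith

/-- Admissible parameters. -/
structure Params.Admissible (P : Params) : Prop where
  one_le_M : 1 ≤ P.M
  γ_pos : 0 < P.γ
  γ_lt_one : P.γ < 1
  η_pos : ∀ m, 0 < P.η m
  α_nonneg : ∀ m, 0 ≤ P.α m

/-! ### One round -/

section round

variable {d : ℕ} {P : Params} (L : State d) (x : Ctx d)

lemma drawLaw_nonneg (hP : P.Admissible) (k : ℕ) : 0 ≤ drawLaw P L x k := by
  rw [drawLaw]
  have h1 := nodeLaw_nonneg P L x [] k
  have h2 := hP.γ_pos
  have h3 := hP.γ_lt_one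
  have : 0 ≤ 1 - P.γ := by linarith
  split_ifs <;> positivity

lemma drawLaw_eq_zero {k : ℕ} (hk : k ∉ Finset.Icc 1 (2 ^ P.M)) : drawLaw P L x k = 0 := by
  have : k ≠ 1 := by
    rintro rfl
    exact hk (Finset.mem_Icc.2 ⟨le_rfl, Nat.one_le_two_pow⟩)
  rw [drawLaw, nodeLaw_eq_zero _ _ hk, if_neg this]
  ring

/-- The exploration mass γ sits on the smallest action, so it is counted in full at every index from
1 on. With this feedback a draw of action 1 reveals all losses at the actions. -/
lemma drawCdf_eq {i : ℕ} (hi : 1 ≤ i) :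
    drawCdf P L x i = (1 - P.γ) * ∑ k ∈ Finset.Icc 1 i, nodeLaw P L x [] k + P.γ := by
  simp only [drawCdf, drawLaw]
  rw [Finset.sum_add_distrib, ← Finset.mul_sum, ← Finset.mul_sum]
  congr 1
  rw [Finset.sum_ite_eq', if_pos (Finset.mem_Icc.2 ⟨le_rfl, hi⟩), mul_one]

lemma sum_drawLaw (hM : 1 ≤ P.M) : ∑ k ∈ Finset.Icc 1 (2 ^ P.M), drawLaw P L x k = 1 := by
  change drawCdf P L x (2 ^ P.M) = 1
  rw [drawCdf_eq L x Nat.one_le_two_pow, sum_nodeLaw L hM (active_nil x) (Nat.zero_le _)]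
  ring

lemma drawCdf_mono (hP : P.Admissible) : Monotone (drawCdf P L x) := by
  intro i j hij
  exact Finset.sum_le_sum_of_subset_of_nonneg (Finset.Icc_subset_Icc le_rfl hij)
    fun k _ _ => drawLaw_nonneg L x hP k

lemma le_drawCdf (hP : P.Admissible) {i : ℕ} (hi : 1 ≤ i) : P.γ ≤ drawCdf P L x i := by
  rw [drawCdf_eq L x hi]
  have h : 0 ≤ ∑ k ∈ Finset.Icc 1 i, nodeLaw P L x [] k :=
    Finset.sum_nonneg fun k _ => nodeLaw_nonneg P L x [] k
  have := mul_nonneg (sub_nonneg.2 hP.γ_lt_one.le) h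
  linarith

/-- Mean of a function of the action drawn. -/
noncomputable def drawMean (P : Params) (L : State d) (x : Ctx d) (f : ℕ → ℝ) : ℝ :=
  ∑ k ∈ Finset.Icc 1 (2 ^ P.M), drawLaw P L x k * f k

lemma drawMean_add (f g : ℕ → ℝ) :
    drawMean P L x (fun k => f k + g k) = drawMean P L x f + drawMean P L x g := by
  simp only [drawMean, mul_add, Finset.sum_add_distrib]

lemma drawMean_sub (f g : ℕ → ℝ) :
    drawMean P L x (fun k => f k - g k) = drawMean P L x f - drawMean P L x g := by
  simp only [drawMean, mul_sub, Finset.sum_sub_distrib]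

lemma drawMean_mul (a : ℝ) (f : ℕ → ℝ) :
    drawMean P L x (fun k => a * f k) = a * drawMean P L x f := by
  simp only [drawMean, Finset.mul_sum]
  exact Finset.sum_congr rfl fun k _ => by ring

lemma drawMean_sum {ι : Type*} (s : Finset ι) (f : ι → ℕ → ℝ) :
    drawMean P L x (fun k => ∑ i ∈ s, f i k) = ∑ i ∈ s, drawMean P L x (f i) := by
  simp only [drawMean, Finset.mul_sum]
  exact Finset.sum_comm

lemma drawMean_const (hM : 1 ≤ P.M) (a : ℝ) : drawMean P L x (fun _ => a) = a := by
  rw [drawMean, ← Finset.sum_mul, sum_drawLaw L x hM, one_mul]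

lemma drawMean_mono (hP : P.Admissible) {f g : ℕ → ℝ} (h : ∀ k, f k ≤ g k) :
    drawMean P L x f ≤ drawMean P L x g :=
  Finset.sum_le_sum fun k _ => mul_le_mul_of_nonneg_left (h k) (drawLaw_nonneg L x hP k)

lemma drawMean_indicator {i : ℕ} (hi : i ∈ Finset.Icc 1 (2 ^ P.M)) :
    drawMean P L x (fun k => if k ≤ i then 1 else 0) = drawCdf P L x i := by
  rw [Finset.mem_Icc] at hi
  simp only [drawMean, mul_ite, mul_one, mul_zero]
  rw [← Finset.sum_filter, drawCdf]
  congr 1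
  ext k
  simp only [Finset.mem_filter, Finset.mem_Icc]
  omega

variable {x} {ℓ : unitInterval → unitInterval}

lemma grid_coe {M k : ℕ} (hk : k ≤ 2 ^ M) : (grid M k : ℝ) = (k : ℝ) / 2 ^ M := by
  have hp : (0 : ℝ) < 2 ^ M := by positivity
  rw [grid, Set.projIcc_of_mem]
  exact ⟨by positivity, (div_le_one hp).2 (by exact_mod_cast hk)⟩

lemma mem_support_iff {w : ExpNode d} {i : ℕ} :
    i ∈ support P L x w ↔ i ∈ Finset.Icc 1 (2 ^ P.M) ∧ ∃ c, 0 < nodeLaw P L x (child w c) i := by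
  rw [support, Finset.mem_filter]

lemma sup_support_mem {w : ExpNode d} {i : ℕ} (hi : i ∈ support P L x w) :
    (support P L x w).sup id ∈ support P L x w ∧ i ≤ (support P L x w).sup id := by
  obtain ⟨j, hj, h⟩ := Finset.exists_mem_eq_sup (support P L x w) ⟨i, hi⟩ id
  exact ⟨h ▸ hj, Finset.le_sup (f := id) hi⟩

/-- Both actions come from labels within 2^(-m) of the label of `w.1`, and clipping is a
contraction. This diameter is why deep nodes need only estimates of small range. -/
lemma dist_support {w : ExpNode d} (hw : w.1.length < P.M) {i j : ℕ}
    (hi : i ∈ support P L x w) (hj : j ∈ support P L x w) :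
    |(i : ℝ) / 2 ^ P.M - (j : ℝ) / 2 ^ P.M| ≤ (2 : ℝ) ^ (1 - (w.1.length : ℤ)) := by
  have key : ∀ k ∈ support P L x w, ∃ y : ℝ, |y - label w.1| ≤ (1 / 2) ^ w.1.length ∧
      (k : ℝ) / 2 ^ P.M = clip P.M y := by
    intro k hk
    obtain ⟨-, c, hc⟩ := (mem_support_iff L).1 hk
    rw [nodeLaw] at hc
    obtain ⟨y, hy, hyk⟩ := actionLaw_pos _ _ (by rw [length_child]; omega) k hc.ne'
    refine ⟨y, ?_, hyk⟩
    rw [length_child] at hy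
    calc |y - label w.1| = |(y - label (child w c)) + (label (child w c) - label w.1)| := by
          ring_nf
      _ ≤ _ := abs_add_le _ _
      _ ≤ (1 / 2) ^ (w.1.length + 1) + (1 / 2) ^ (w.1.length + 1) :=
          add_le_add hy (dist_label_child w c)
      _ = (1 / 2) ^ w.1.length := by ring
  obtain ⟨y, hy, hyi⟩ := key i hi
  obtain ⟨z, hz, hzj⟩ := key j hj
  rw [hyi, hzj]
  refine (abs_clip_sub_le _ _ _).trans ?_
  rw [zpow_sub₀ two_ne_zero, zpow_one, zpow_natCast]
  rw [div_pow, one_pow] at hy hz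
  calc |y - z| = |(y - label w.1) - (z - label w.1)| := by ring_nf
    _ ≤ _ := abs_sub _ _
    _ ≤ 1 / 2 ^ w.1.length + 1 / 2 ^ w.1.length := add_le_add hy hz
    _ = 2 / 2 ^ w.1.length := by ring

lemma abs_loss_sub_le (hℓ : LipschitzWith 1 ℓ) (a b : unitInterval) :
    |(ℓ a : ℝ) - ℓ b| ≤ |(a : ℝ) - b| := by
  have := hℓ.dist_le_mul a b
  simpa [Subtype.dist_eq, Real.dist_eq] using this

/-- The shifted loss whose importance weighted version is the main part of the estimate. -/
noncomputable def shiftedLoss (P : Params) (L : State d) (x : Ctx d)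
    (ℓ : unitInterval → unitInterval) (w : ExpNode d) (i : ℕ) : ℝ :=
  (ℓ (grid P.M i) : ℝ) - (ℓ (grid P.M ((support P L x w).sup id)) : ℝ)
    + (2 : ℝ) ^ (1 - (w.1.length : ℤ))

/-- The loss difference has absolute value at most 2^(1-m), so adding 2^(1-m) puts it in [0,
2^(2-m)]. -/
lemma shiftedLoss_mem (hℓ : LipschitzWith 1 ℓ) {w : ExpNode d} (hw : w.1.length < P.M) {i : ℕ}
    (hi : i ∈ support P L x w) :
    0 ≤ shiftedLoss P L x ℓ w i ∧
      shiftedLoss P L x ℓ w i ^ 2 ≤ (2 : ℝ) ^ (4 - 2 * (w.1.length : ℤ)) := by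
  obtain ⟨hj, -⟩ := sup_support_mem L hi
  have h := abs_loss_sub_le hℓ (grid P.M i) (grid P.M ((support P L x w).sup id))
  rw [grid_coe (Finset.mem_Icc.1 ((mem_support_iff L).1 hi).1).2,
    grid_coe (Finset.mem_Icc.1 ((mem_support_iff L).1 hj).1).2] at h
  obtain ⟨h1, h2⟩ := abs_le.1 (h.trans (dist_support L hw hi hj))
  have h0 : 0 ≤ shiftedLoss P L x ℓ w i := by rw [shiftedLoss]; linarith
  refine ⟨h0, ?_⟩
  have h3 : shiftedLoss P L x ℓ w i ≤ (2 : ℝ) ^ (2 - (w.1.length : ℤ)) := by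
    rw [shiftedLoss, show (2 - (w.1.length : ℤ)) = 1 - (w.1.length : ℤ) + 1 by ring,
      zpow_add_one₀ two_ne_zero]
    linarith
  calc shiftedLoss P L x ℓ w i ^ 2 ≤ ((2 : ℝ) ^ (2 - (w.1.length : ℤ))) ^ 2 :=
        pow_le_pow_left₀ h0 h3 2
    _ = (2 : ℝ) ^ (4 - 2 * (w.1.length : ℤ)) := by
        rw [← zpow_natCast, ← zpow_mul]
        congr 1
        push_cast
        ring

lemma penalty_mem (hP : P.Admissible) {i : ℕ} (hi : 1 ≤ i) (m : ℕ) :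
    0 ≤ P.α m / P.γ - P.α m / drawCdf P L x i ∧
      (P.α m / P.γ - P.α m / drawCdf P L x i) ^ 2 ≤ (P.α m / P.γ) ^ 2 := by
  have h1 := le_drawCdf L x hP hi
  have h2 := hP.γ_pos
  have h3 : P.α m / drawCdf P L x i ≤ P.α m / P.γ :=
    div_le_div_of_nonneg_left (hP.α_nonneg m) h2 h1
  have h4 : 0 ≤ P.α m / drawCdf P L x i := div_nonneg (hP.α_nonneg m) (h2.le.trans h1)
  exact ⟨by linarith, pow_le_pow_left₀ (by linarith) (by linarith) 2⟩

lemma lossEst_eq (I : ℕ) (w : ExpNode d) (i : ℕ) :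
    lossEst P L x ℓ I w i =
      shiftedLoss P L x ℓ w i / drawCdf P L x i * (if I ≤ i then 1 else 0) +
        (P.α w.1.length / P.γ - P.α w.1.length / drawCdf P L x i) := by
  rw [lossEst, shiftedLoss]
  ring

lemma lossEst_nonneg (hP : P.Admissible) (hℓ : LipschitzWith 1 ℓ) (I : ℕ) {w : ExpNode d}
    (hw : w.1.length < P.M) {i : ℕ} (hi : i ∈ support P L x w) :
    0 ≤ lossEst P L x ℓ I w i := by
  have hi1 := (Finset.mem_Icc.1 ((mem_support_iff L).1 hi).1).1
  rw [lossEst_eq]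
  have h1 := (shiftedLoss_mem L hℓ hw hi).1
  have h2 := hP.γ_pos.trans_le (le_drawCdf L x hP hi1)
  have h3 := (penalty_mem L (x := x) hP hi1 w.1.length).1
  split_ifs <;> positivity

lemma expertLoss_nonneg (hP : P.Admissible) (hℓ : LipschitzWith 1 ℓ) (I : ℕ) {w : ExpNode d}
    (hw : w.1.length < P.M) (c : SignType) : 0 ≤ expertLoss P L x ℓ I w c :=
  Finset.sum_nonneg fun _ hi => mul_nonneg (nodeLaw_nonneg _ _ _ _ _)
    (lossEst_nonneg L hP hℓ I hw hi)

/-- Importance weighting is unbiased, because `drawCdf` is the probability of the event I ≤ i on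
which the loss of `i` is revealed. -/
lemma drawMean_lossEst (hP : P.Admissible) (w : ExpNode d) {i : ℕ}
    (hi : i ∈ Finset.Icc 1 (2 ^ P.M)) :
    drawMean P L x (fun I => lossEst P L x ℓ I w i) = shiftedLoss P L x ℓ w i +
      (P.α w.1.length / P.γ - P.α w.1.length / drawCdf P L x i) := by
  have h2 := hP.γ_pos.trans_le (le_drawCdf L x hP (Finset.mem_Icc.1 hi).1)
  simp only [lossEst_eq]
  rw [drawMean_add, drawMean_mul, drawMean_indicator L x hi, drawMean_const L x hP.one_le_M,
    div_mul_cancel₀ _ h2.ne']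

/-- After (a + b)^2 ≤ 2a^2 + 2b^2, averaging the squared indicator cancels one of the two factors
1/P*. The other remains; bounding it by 1/γ would be wasteful, and it is this term that the
penalization absorbs. -/
lemma drawMean_lossEst_sq_le (hP : P.Admissible) (hℓ : LipschitzWith 1 ℓ) {w : ExpNode d}
    (hw : w.1.length < P.M) {i : ℕ} (hi : i ∈ support P L x w) :
    drawMean P L x (fun I => lossEst P L x ℓ I w i ^ 2) ≤
      2 * (2 : ℝ) ^ (4 - 2 * (w.1.length : ℤ)) / drawCdf P L x i +
        2 * (P.α w.1.length / P.γ) ^ 2 := by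
  have hi' := ((mem_support_iff L).1 hi).1
  have hi1 := (Finset.mem_Icc.1 hi').1
  have h2 := hP.γ_pos.trans_le (le_drawCdf L x hP hi1)
  obtain ⟨-, hs⟩ := shiftedLoss_mem L hℓ hw hi
  obtain ⟨-, hp⟩ := penalty_mem L (x := x) hP hi1 w.1.length
  set a := shiftedLoss P L x ℓ w i
  set p := drawCdf P L x i
  set b := P.α w.1.length / P.γ - P.α w.1.length / p
  calc drawMean P L x (fun I => lossEst P L x ℓ I w i ^ 2)
      ≤ drawMean P L x (fun I => 2 * (a / p) ^ 2 * (if I ≤ i then 1 else 0) + 2 * b ^ 2) := by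
        refine drawMean_mono L x hP fun I => ?_
        rw [lossEst_eq]
        split_ifs
        · nlinarith [sq_nonneg (a / p - b)]
        · nlinarith [sq_nonneg b]
    _ = 2 * a ^ 2 / p + 2 * b ^ 2 := by
        rw [drawMean_add, drawMean_mul, drawMean_indicator L x hi', drawMean_const L x hP.one_le_M]
        change 2 * (a / p) ^ 2 * p + _ = _
        field_simp
    _ ≤ _ := by gcongr

/-- Mean loss of the action distribution of a node. -/
noncomputable def meanLoss (P : Params) (L : State d) (x : Ctx d)
    (ℓ : unitInterval → unitInterval) (v : BinNode d) : ℝ :=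
  ∑ i ∈ Finset.Icc 1 (2 ^ P.M), nodeLaw P L x v i * (ℓ (grid P.M i) : ℝ)

/-- Mean inverse observation probability of the action distribution of a node. -/
noncomputable def meanInv (P : Params) (L : State d) (x : Ctx d) (v : BinNode d) : ℝ :=
  ∑ i ∈ Finset.Icc 1 (2 ^ P.M), nodeLaw P L x v i / drawCdf P L x i

lemma meanInv_nonneg (hP : P.Admissible) (v : BinNode d) : 0 ≤ meanInv P L x v :=
  Finset.sum_nonneg fun _ hi => div_nonneg (nodeLaw_nonneg _ _ _ _ _)
    (hP.γ_pos.le.trans (le_drawCdf L x hP (Finset.mem_Icc.1 hi).1))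

lemma meanLoss_eq_sum {v : BinNode d} (hv : Active x v) (hl : v.length < P.M) :
    meanLoss P L x ℓ v = ∑ c, weights P L (activeExp x v) c *
      meanLoss P L x ℓ (child (activeExp x v) c) := by
  simp only [meanLoss, nodeLaw_eq_sum L hv hl, Finset.sum_mul, Finset.mul_sum]
  rw [Finset.sum_comm]
  simp only [mul_assoc]

lemma meanInv_eq_sum {v : BinNode d} (hv : Active x v) (hl : v.length < P.M) :
    meanInv P L x v = ∑ c, weights P L (activeExp x v) c *
      meanInv P L x (child (activeExp x v) c) := by
  simp only [meanInv, nodeLaw_eq_sum L hv hl, Finset.sum_div, Finset.mul_sum]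
  rw [Finset.sum_comm]
  simp only [mul_div_assoc]

lemma sum_support (w : ExpNode d) (c : SignType) (f : ℕ → ℝ) :
    ∑ i ∈ support P L x w, nodeLaw P L x (child w c) i * f i =
      ∑ i ∈ Finset.Icc 1 (2 ^ P.M), nodeLaw P L x (child w c) i * f i := by
  refine Finset.sum_subset (Finset.filter_subset _ _) fun i hi hn => ?_
  have : nodeLaw P L x (child w c) i = 0 := by
    by_contra hc
    exact hn ((mem_support_iff L).2 ⟨hi, c, (nodeLaw_nonneg _ _ _ _ _).lt_of_ne' hc⟩)
  rw [this, zero_mul]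

/-- The last bracket does not depend on `c`: the shift and α/γ make the estimates nonnegative but
drop out of every comparison between children. -/
lemma drawMean_expertLoss (hP : P.Admissible) {w : ExpNode d} (hx : x ∈ cubeOf w)
    (hw : w.1.length < P.M) (c : SignType) :
    drawMean P L x (fun I => expertLoss P L x ℓ I w c) =
      meanLoss P L x ℓ (child w c) - P.α w.1.length * meanInv P L x (child w c) +
        ((2 : ℝ) ^ (1 - (w.1.length : ℤ)) - (ℓ (grid P.M ((support P L x w).sup id)) : ℝ) +
          P.α w.1.length / P.γ) := by
  have h1 := sum_nodeLaw L hP.one_le_M (active_child hx c) (by rw [length_child]; omega)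
  simp only [expertLoss]
  rw [drawMean_sum]
  simp only [drawMean_mul]
  rw [sum_support L w c (fun i => drawMean P L x (fun I => lossEst P L x ℓ I w i))]
  rw [Finset.sum_congr rfl fun i hi => by rw [drawMean_lossEst L hP w hi]]
  set κ := ((2 : ℝ) ^ (1 - (w.1.length : ℤ)) - (ℓ (grid P.M ((support P L x w).sup id)) : ℝ) +
          P.α w.1.length / P.γ) with hκ
  rw [← mul_one κ, ← h1, meanLoss, meanInv, Finset.mul_sum, Finset.mul_sum,
    ← Finset.sum_sub_distrib, ← Finset.sum_add_distrib]
  refine Finset.sum_congr rfl fun i _ => ?_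
  rw [hκ, shiftedLoss]
  ring

lemma sq_sum_mul_le {ι : Type*} (s : Finset ι) (p f : ι → ℝ) (hp : ∀ i ∈ s, 0 ≤ p i)
    (h1 : ∑ i ∈ s, p i = 1) : (∑ i ∈ s, p i * f i) ^ 2 ≤ ∑ i ∈ s, p i * f i ^ 2 :=
  Real.pow_arith_mean_le_arith_mean_pow_of_even s p f hp h1 even_two

lemma drawMean_expertLoss_sq_le (hP : P.Admissible) (hℓ : LipschitzWith 1 ℓ) {w : ExpNode d}
    (hx : x ∈ cubeOf w) (hw : w.1.length < P.M) (c : SignType) :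
    drawMean P L x (fun I => expertLoss P L x ℓ I w c ^ 2) ≤
      2 * (2 : ℝ) ^ (4 - 2 * (w.1.length : ℤ)) * meanInv P L x (child w c) +
        2 * (P.α w.1.length / P.γ) ^ 2 := by
  have h1 := sum_nodeLaw L hP.one_le_M (active_child hx c) (by rw [length_child]; omega)
  have h1' : ∑ i ∈ support P L x w, nodeLaw P L x (child w c) i = 1 := by
    have := sum_support (P := P) L (x := x) w c (fun _ => 1)
    simpa [h1] using this
  calc drawMean P L x (fun I => expertLoss P L x ℓ I w c ^ 2)
      ≤ drawMean P L x (fun I => ∑ i ∈ support P L x w,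
          nodeLaw P L x (child w c) i * lossEst P L x ℓ I w i ^ 2) :=
        drawMean_mono L x hP fun I =>
          sq_sum_mul_le _ _ _ (fun i _ => nodeLaw_nonneg _ _ _ _ _) h1'
    _ = ∑ i ∈ support P L x w, nodeLaw P L x (child w c) i *
          drawMean P L x (fun I => lossEst P L x ℓ I w i ^ 2) := by
        rw [drawMean_sum]
        simp only [drawMean_mul]
    _ ≤ ∑ i ∈ support P L x w, nodeLaw P L x (child w c) i *
          (2 * (2 : ℝ) ^ (4 - 2 * (w.1.length : ℤ)) / drawCdf P L x i +
            2 * (P.α w.1.length / P.γ) ^ 2) :=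
        Finset.sum_le_sum fun i hi => mul_le_mul_of_nonneg_left
          (drawMean_lossEst_sq_le L hP hℓ hw hi) (nodeLaw_nonneg _ _ _ _ _)
    _ = _ := by
        rw [sum_support L w c (fun i => 2 * (2 : ℝ) ^ (4 - 2 * (w.1.length : ℤ)) /
          drawCdf P L x i + 2 * (P.α w.1.length / P.γ) ^ 2)]
        simp only [mul_add, Finset.sum_add_distrib]
        rw [← Finset.sum_mul, h1, one_mul, meanInv, Finset.mul_sum]
        congr 1
        refine Finset.sum_congr rfl fun i _ => ?_
        ring

/-- Second order surplus of the mixture at `w` over its child `c`, when the action `I` is drawn. -/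
noncomputable def surplus (P : Params) (L : State d) (x : Ctx d)
    (ℓ : unitInterval → unitInterval) (I : ℕ) (w : ExpNode d) (c : SignType) : ℝ :=
  ∑ c', weights P L w c' * (expertLoss P L x ℓ I w c' -
    P.η w.1.length / 2 * expertLoss P L x ℓ I w c' ^ 2) - expertLoss P L x ℓ I w c

/-- One link of the telescoping chain. Half the learning rate times the second moment is 2^(4-2m)
η_m times the mean of 1/P* plus η_m (α_m/γ)^2. The first part merges with the penalization of the
mixture, so the parent carries a larger coefficient than its child; the second part is an additive
cost. -/
lemma le_drawMean_surplus (hP : P.Admissible) (hℓ : LipschitzWith 1 ℓ) {v : BinNode d}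
    (hv : Active x v) (hl : v.length < P.M) (c : SignType) :
    (meanLoss P L x ℓ v - (P.α v.length + (2 : ℝ) ^ (4 - 2 * (v.length : ℤ)) * P.η v.length) *
        meanInv P L x v) -
      (meanLoss P L x ℓ (child (activeExp x v) c) -
        P.α v.length * meanInv P L x (child (activeExp x v) c)) -
      P.η v.length * (P.α v.length / P.γ) ^ 2 ≤
    drawMean P L x (fun I => surplus P L x ℓ I (activeExp x v) c) := by
  have hx := mem_cubeOf_activeExp hv
  set w := activeExp x v with hw
  have hwl : w.1.length = v.length := rfl
  have hl' : w.1.length < P.M := hl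
  simp only [surplus]
  rw [drawMean_sub, drawMean_sum]
  simp only [drawMean_mul, drawMean_sub]
  rw [drawMean_expertLoss L hP hx hl' c]
  simp only [drawMean_expertLoss L hP hx hl']
  rw [hwl]
  set κ := ((2 : ℝ) ^ (1 - (v.length : ℤ)) - (ℓ (grid P.M ((support P L x w).sup id)) : ℝ) +
          P.α v.length / P.γ) with hκ
  have hη := hP.η_pos v.length
  -- Only the second moment is estimated. Everything else is linear in the weights, so averaging
  -- over the children reproduces the quantities at `v`, and κ cancels because the weights sum to 1.
  have key : ∑ c', weights P L w c' * (meanLoss P L x ℓ (child w c') -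
      (P.α v.length + (2 : ℝ) ^ (4 - 2 * (v.length : ℤ)) * P.η v.length) *
        meanInv P L x (child w c') + (κ - P.η v.length * (P.α v.length / P.γ) ^ 2)) ≤
      ∑ c', weights P L w c' * (meanLoss P L x ℓ (child w c') -
        P.α v.length * meanInv P L x (child w c') + κ -
        P.η v.length / 2 * drawMean P L x (fun I => expertLoss P L x ℓ I w c' ^ 2)) := by
    refine Finset.sum_le_sum fun c' _ =>
      mul_le_mul_of_nonneg_left ?_ (weights_pos P L w c').le
    have := mul_le_mul_of_nonneg_left (drawMean_expertLoss_sq_le L hP hℓ hx hl' c')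
      (half_pos hη).le
    rw [hwl] at this
    nlinarith
  refine le_trans (le_of_eq ?_) (sub_le_sub_right key _)
  rw [meanLoss_eq_sum L hv hl, meanInv_eq_sum L hv hl, ← hw]
  simp only [mul_add, mul_sub, Finset.sum_add_distrib, Finset.sum_sub_distrib]
  rw [← Finset.sum_mul, ← Finset.sum_mul, sum_weights]
  simp only [mul_left_comm (weights P L w _), ← Finset.mul_sum]
  ring

lemma drawMean_loss_le (hP : P.Admissible) :
    drawMean P L x (fun k => (ℓ (grid P.M k) : ℝ)) ≤ meanLoss P L x ℓ [] + P.γ := by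
  have h : drawMean P L x (fun k => (ℓ (grid P.M k) : ℝ)) =
      (1 - P.γ) * meanLoss P L x ℓ [] + P.γ * ℓ (grid P.M 1) := by
    simp only [drawMean, drawLaw, meanLoss, add_mul, Finset.sum_add_distrib, Finset.mul_sum,
      mul_assoc]
    congr 1
    rw [← Finset.mul_sum]
    simp only [ite_mul, one_mul, zero_mul]
    rw [Finset.sum_ite_eq', if_pos (Finset.mem_Icc.2 ⟨le_rfl, Nat.one_le_two_pow⟩)]
  have h0 : 0 ≤ meanLoss P L x ℓ [] := Finset.sum_nonneg fun i _ =>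
    mul_nonneg (nodeLaw_nonneg _ _ _ _ _) (ℓ _).2.1
  have h1 := (ℓ (grid P.M 1)).2.2
  have h2 := hP.γ_pos
  rw [h]
  nlinarith

lemma one_sub_div_le_log {a b : ℝ} (ha : 0 < a) (hb : 0 < b) :
    (b - a) / b ≤ Real.log b - Real.log a := by
  have h := Real.log_le_sub_one_of_pos (div_pos ha hb)
  rw [Real.log_div ha.ne' hb.ne'] at h
  rw [sub_div, div_self hb.ne']
  linarith

/-- Up to the factor 1 - γ, the root probability of `i` is the increment of P* at `i`. Each term is
thus an increment divided by its right end value, at most an increment of log P*, and P* runs from γ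
to 1. -/
lemma meanInv_root_le (hP : P.Admissible) :
    meanInv P L x [] ≤ Real.log (1 / P.γ) / (1 - P.γ) := by
  have hγ : 0 < 1 - P.γ := by linarith [hP.γ_lt_one]
  -- Unlike `drawCdf`, this agrees with the formula at index 0 as well: there it equals γ rather
  -- than 0, which keeps the logarithm finite.
  set Q : ℕ → ℝ := fun i => (1 - P.γ) * ∑ k ∈ Finset.Icc 1 i, nodeLaw P L x [] k + P.γ with hQ
  have hQpos : ∀ i, 0 < Q i := fun i => by
    have h : 0 ≤ ∑ k ∈ Finset.Icc 1 i, nodeLaw P L x [] k :=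
      Finset.sum_nonneg fun k _ => nodeLaw_nonneg P L x [] k
    have h2 := hP.γ_pos
    simp only [hQ]
    positivity
  have key : ∀ n, (1 - P.γ) * ∑ i ∈ Finset.Icc 1 n, nodeLaw P L x [] i / drawCdf P L x i ≤
      Real.log (Q n) - Real.log (Q 0) := by
    intro n
    induction n with
    | zero => simp
    | succ n ih =>
      rw [Finset.sum_Icc_succ_top (by omega), mul_add, drawCdf_eq L x (by omega)]
      have h := one_sub_div_le_log (hQpos n) (hQpos (n + 1))
      have h2 : Q (n + 1) - Q n = (1 - P.γ) * nodeLaw P L x [] (n + 1) := by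
        simp only [hQ]
        rw [Finset.sum_Icc_succ_top (by omega)]
        ring
      rw [h2, mul_div_assoc] at h
      linarith
  have h := key (2 ^ P.M)
  have h1 : Q (2 ^ P.M) = 1 := by
    simp only [hQ]
    rw [sum_nodeLaw L hP.one_le_M (active_nil x) (Nat.zero_le _)]
    ring
  have h0 : Q 0 = P.γ := by simp [hQ]
  rw [h1, h0, Real.log_one, zero_sub, ← Real.log_inv, ← one_div] at h
  rw [le_div_iff₀ hγ, mul_comm]
  exact h

end round

/-! ### Comparator trees -/

section comparator

variable {d : ℕ}

/-- The node reached by following the cubes `σ` with the coefficients chosen by `ch`. -/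
def compNode (ch : ExpNode d → SignType) (σ : List (Subcube d)) : BinNode d :=
  σ.foldl (fun v s => child (v, s) (ch (v, s))) []

lemma compNode_append (ch : ExpNode d → SignType) (σ : List (Subcube d)) (s : Subcube d) :
    compNode ch (σ ++ [s]) = child (compNode ch σ, s) (ch (compNode ch σ, s)) := by
  simp [compNode]

lemma map_compNode (ch : ExpNode d → SignType) (σ : List (Subcube d)) :
    (compNode ch σ).map Prod.fst = σ := by
  induction σ using List.reverseRecOn with
  | nil => rfl
  | append_singleton σ s ih => simp [compNode_append, child, ih]

lemma length_compNode (ch : ExpNode d → SignType) (σ : List (Subcube d)) :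
    (compNode ch σ).length = σ.length := by
  rw [← List.length_map (f := Prod.fst), map_compNode]

/-- The active comparator node at depth `m`. -/
noncomputable def compPath (ch : ExpNode d → SignType) (x : Ctx d) (m : ℕ) : BinNode d :=
  compNode ch (addr x m)

lemma length_compPath (ch : ExpNode d → SignType) (x : Ctx d) (m : ℕ) :
    (compPath ch x m).length = m := by
  rw [compPath, length_compNode, length_addr]

lemma active_compPath (ch : ExpNode d → SignType) (x : Ctx d) (m : ℕ) :
    Active x (compPath ch x m) := by
  rw [Active, length_compPath, compPath, map_compNode]

lemma compPath_succ (ch : ExpNode d → SignType) (x : Ctx d) (m : ℕ) :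
    compPath ch x (m + 1) =
      child (activeExp x (compPath ch x m)) (ch (activeExp x (compPath ch x m))) := by
  rw [compPath, addr, compNode_append, activeExp, length_compPath]
  rfl

/-- The total penalization accumulated at depth `m`. -/
noncomputable def penalty (P : Params) : ℕ → ℝ
  | 0 => P.α 0 + 16 * P.η 0
  | m + 1 => P.α m

/-- The recursion satisfied by the penalization parameters. -/
def Params.Telescoping (P : Params) : Prop :=
  ∀ m, m + 1 < P.M →
    P.α m = P.α (m + 1) + (2 : ℝ) ^ (4 - 2 * ((m + 1 : ℕ) : ℤ)) * P.η (m + 1)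

lemma penalty_eq {P : Params} (h : P.Telescoping) {m : ℕ} (hm : m < P.M) :
    penalty P m = P.α m + (2 : ℝ) ^ (4 - 2 * (m : ℤ)) * P.η m := by
  cases m with
  | zero => norm_num [penalty]
  | succ m => exact h m hm

/-- The part of the regret bound that is incurred at every round. -/
noncomputable def roundBound (P : Params) : ℝ :=
  P.γ + penalty P 0 * (Real.log (1 / P.γ) / (1 - P.γ)) +
    ∑ m ∈ Finset.range P.M, P.η m * (P.α m / P.γ) ^ 2

/-- Summing `le_drawMean_surplus` along the comparator path: by the recursion for α, the coefficient
arriving at a child is the one with which that child starts its own inequality. -/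
lemma drawMean_loss_le_surplus {P : Params} (hP : P.Admissible) (hT : P.Telescoping) (L : State d)
    (x : Ctx d) {ℓ : unitInterval → unitInterval} (hℓ : LipschitzWith 1 ℓ)
    (ch : ExpNode d → SignType) :
    drawMean P L x (fun k => (ℓ (grid P.M k) : ℝ)) ≤
      drawMean P L x (fun I => ∑ m ∈ Finset.range P.M, surplus P L x ℓ I
        (activeExp x (compPath ch x m)) (ch (activeExp x (compPath ch x m)))) +
      meanLoss P L x ℓ (compPath ch x P.M) + roundBound P := by
  have key : ∀ n ≤ P.M, (meanLoss P L x ℓ [] - penalty P 0 * meanInv P L x []) -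
      (meanLoss P L x ℓ (compPath ch x n) - penalty P n * meanInv P L x (compPath ch x n)) -
      ∑ m ∈ Finset.range n, P.η m * (P.α m / P.γ) ^ 2 ≤
      ∑ m ∈ Finset.range n, drawMean P L x (fun I => surplus P L x ℓ I
        (activeExp x (compPath ch x m)) (ch (activeExp x (compPath ch x m)))) := by
    intro n hn
    induction n with
    | zero => simp [compPath, addr, compNode]
    | succ n ih =>
      have h := le_drawMean_surplus L hP hℓ (active_compPath ch x n)
        (by rw [length_compPath]; omega) (ch (activeExp x (compPath ch x n)))
      rw [length_compPath, ← compPath_succ, ← penalty_eq hT (by omega)] at h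
      rw [Finset.sum_range_succ, Finset.sum_range_succ]
      have h2 : penalty P (n + 1) = P.α n := rfl
      rw [h2]
      linarith [ih (by omega)]
  have h := key P.M le_rfl
  -- The penalization left over at the leaf has the right sign and is discarded; only the root term
  -- has to be bounded.
  have hM : 0 ≤ penalty P P.M := by
    obtain ⟨n, hn⟩ : ∃ n, P.M = n + 1 := ⟨P.M - 1, by have := hP.one_le_M; omega⟩
    rw [hn]
    exact hP.α_nonneg n
  have h0 : 0 ≤ penalty P 0 :=
    add_nonneg (hP.α_nonneg 0) (mul_nonneg (by norm_num) (hP.η_pos 0).le)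
  have h1 := mul_nonneg hM (meanInv_nonneg L hP (x := x) (compPath ch x P.M))
  have h2 := mul_le_mul_of_nonneg_left (meanInv_root_le L hP (x := x)) h0
  have h3 := drawMean_loss_le L hP (x := x) (ℓ := ℓ)
  rw [drawMean_sum, roundBound]
  linarith

/-- One 2^(-M) is the distance of `y` to the leaf label, preserved by clipping. The other pays for
clipping `y` itself, which only happens below 2^(-M). -/
lemma meanLoss_leaf_le {P : Params} (hP : P.Admissible) (L : State d) (x : Ctx d)
    {ℓ : unitInterval → unitInterval} (hℓ : LipschitzWith 1 ℓ) {v : BinNode d}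
    (hv : v.length = P.M) (y : unitInterval) (hy : |(y : ℝ) - label v| ≤ (1 / 2) ^ P.M) :
    meanLoss P L x ℓ v ≤ ℓ y + 2 * (1 / 2) ^ P.M := by
  obtain ⟨k, hk, hkv⟩ := exists_action hP.one_le_M hv
  have hp : (0 : ℝ) < 2 ^ P.M := by positivity
  have h1 : meanLoss P L x ℓ v = ℓ (grid P.M k) := by
    rw [meanLoss, Finset.sum_eq_single k]
    · rw [nodeLaw_leaf L hv, if_pos hkv, one_mul]
    · intro j _ hj
      rw [nodeLaw_leaf L hv, if_neg, zero_mul]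
      intro h
      rw [← hkv, div_left_inj' hp.ne'] at h
      exact hj (by exact_mod_cast h)
    · exact fun h => absurd hk h
  have h2 := abs_loss_sub_le hℓ (grid P.M k) y
  rw [grid_coe (Finset.mem_Icc.1 hk).2, hkv] at h2
  have h3 := abs_clip_sub_le P.M (label v) y
  rw [abs_sub_comm] at hy
  have h4 : |clip P.M y - y| ≤ (1 / 2) ^ P.M := by
    have hM1 : (1 : ℝ) / 2 ^ P.M ≤ 1 := (div_le_one hp).2 (one_le_pow₀ (by norm_num))
    have hM0 : (0 : ℝ) ≤ 1 / 2 ^ P.M := by positivity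
    rw [clip, min_eq_left (max_le y.2.2 hM1), div_pow, one_pow, abs_of_nonneg]
    · rcases max_cases (y : ℝ) (1 / 2 ^ P.M) with h | h <;> linarith [y.2.1]
    · linarith [le_max_left (y : ℝ) (1 / 2 ^ P.M)]
  have h5 := abs_sub_le (clip P.M (label v)) (clip P.M y) y
  rw [h1]
  have h6 := (abs_le.1 h2).2
  linarith

open Classical in
/-- Coefficients by which a comparator tree tracks the policy `f`. -/
noncomputable def track (f : Ctx d → unitInterval) (w : ExpNode d) : SignType :=
  if ∀ x ∈ cubeOf w, label w.1 ≤ f x then 1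
  else if ∀ x ∈ cubeOf w, (f x : ℝ) ≤ label w.1 then -1 else 0

lemma dist_le_of_mem_cube {σ : List (Subcube d)} {x y : Ctx d} (hx : x ∈ cube σ) (hy : y ∈ cube σ) :
    dist x y ≤ (1 / 2) ^ σ.length := by
  rw [dist_pi_le_iff (by positivity)]
  intro j
  rw [Subtype.dist_eq, Real.dist_eq, abs_le]
  obtain ⟨h1, h2⟩ := hx j
  obtain ⟨h3, h4⟩ := hy j
  constructor
  · rcases h4 with h4 | ⟨h4, h5⟩ <;> linarith
  · rcases h2 with h2 | ⟨h2, h5⟩ <;> linarith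

/-- If `f` lies on one side of the label throughout the half-size cube, moving the label by
2^(-(m+1)) towards it halves the error bound. Otherwise `f` takes values on both sides, and its
oscillation on that cube, at most 2^(-(m+1)), already bounds the error. -/
lemma abs_sub_label_compPath_le {f : Ctx d → unitInterval} (hf : LipschitzWith 1 f) (x : Ctx d)
    (m : ℕ) : |(f x : ℝ) - label (compPath (track f) x m)| ≤ (1 / 2) ^ m := by
  -- The induction needs the bound on the whole cube, because the coefficient at the next level is
  -- chosen from the values of `f` there.
  suffices H : ∀ y ∈ cube (addr x m),
      |(f y : ℝ) - label (compPath (track f) x m)| ≤ (1 / 2) ^ m from H x (mem_cube_addr x m)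
  induction m with
  | zero =>
    intro y _
    have h1 := (f y).2.1
    have h2 := (f y).2.2
    simp only [compPath, addr, compNode, List.foldl_nil, label, offset, pow_zero]
    rw [abs_le]
    constructor <;> linarith
  | succ m ih =>
    intro y hy
    set w := activeExp x (compPath (track f) x m) with hw
    have hcube : cubeOf w = cube (addr x (m + 1)) := by
      rw [cubeOf, hw, activeExp, length_compPath, compPath, map_compNode]
      rfl
    have hosc : ∀ z ∈ cube (addr x (m + 1)), |(f y : ℝ) - f z| ≤ (1 / 2) ^ (m + 1) := by
      intro z hz
      have h1 := hf.dist_le_mul y z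
      have h2 := dist_le_of_mem_cube hy hz
      rw [length_addr] at h2
      rw [Subtype.dist_eq, Real.dist_eq] at h1
      simp only [NNReal.coe_one, one_mul] at h1
      exact h1.trans h2
    have hih := abs_le.1 (ih y (cube_append_subset hy))
    have hlab : label (compPath (track f) x (m + 1)) = label (compPath (track f) x m) +
        (SignType.cast (track f w) : ℝ) * (1 / 2) ^ (m + 1) := by
      rw [compPath_succ, label_child, ← hw]
      congr 3
      rw [hw, activeExp, length_compPath]
    have hwl : label w.1 = label (compPath (track f) x m) := rfl
    have h2m : (1 / 2 : ℝ) ^ m = 2 * (1 / 2) ^ (m + 1) := by ring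
    rw [h2m] at hih
    rw [hlab, track, hcube, hwl]
    split_ifs with ha hb
    · have := ha y hy
      simp only [SignType.coe_one, one_mul]
      rw [abs_le]
      constructor <;> linarith
    · have := hb y hy
      simp only [SignType.coe_neg, SignType.coe_one, neg_mul, one_mul]
      rw [abs_le]
      constructor <;> linarith
    · push Not at ha hb
      obtain ⟨z, hz, hz'⟩ := ha
      obtain ⟨z', hzz, hzz'⟩ := hb
      have h1 := abs_le.1 (hosc z hz)
      have h2 := abs_le.1 (hosc z' hzz)
      simp only [SignType.coe_zero, zero_mul, add_zero]
      rw [abs_le]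
      constructor <;> linarith

end comparator

/-! ### Expectations over the draws -/

section paths

variable {d : ℕ} (P : Params) (x : ℕ → Ctx d) (ℓ : ℕ → unitInterval → unitInterval)

lemma stateAt_congr {h h' : ℕ → ℕ} {t : ℕ} (hh : ∀ s < t, h s = h' s) :
    stateAt P x ℓ h t = stateAt P x ℓ h' t := by
  induction t with
  | zero => rfl
  | succ t ih =>
    rw [stateAt, stateAt, ih fun s hs => hh s (by omega), hh t (by omega)]

lemma pad_snoc_lt {β : Type*} [Zero β] {T : ℕ} (h : Fin T → β) (k : β) {s : ℕ} (hs : s < T) :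
    pad (Fin.snoc h k : Fin (T + 1) → β) s = pad h s := by
  rw [pad, pad, dif_pos hs, dif_pos (by omega)]
  exact Fin.snoc_castSucc (α := fun _ => β) k h ⟨s, hs⟩

lemma pad_snoc_last {β : Type*} [Zero β] {T : ℕ} (h : Fin T → β) (k : β) :
    pad (Fin.snoc h k : Fin (T + 1) → β) T = k := by
  rw [pad, dif_pos (by omega)]
  exact Fin.snoc_last (α := fun _ => β) k h

lemma pathProb_snoc {T : ℕ} (h : Fin T → ℕ) (k : ℕ) :
    pathProb P (T + 1) x ℓ (Fin.snoc h k) =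
      pathProb P T x ℓ h * drawLaw P (stateAt P x ℓ (pad h) T) (x T) k := by
  rw [pathProb, Fin.prod_univ_castSucc, pathProb]
  congr 1
  · refine Finset.prod_congr rfl fun t _ => ?_
    rw [Fin.snoc_castSucc, Fin.val_castSucc,
      stateAt_congr P x ℓ fun s hs => pad_snoc_lt h k (hs.trans t.2)]
  · rw [Fin.snoc_last, Fin.val_last, stateAt_congr P x ℓ fun s hs => pad_snoc_lt h k hs]

lemma sum_piFinset_snoc {T : ℕ} (s : Finset ℕ) (G : (Fin (T + 1) → ℕ) → ℝ) :
    ∑ h ∈ Fintype.piFinset (fun _ : Fin (T + 1) => s), G h =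
      ∑ h ∈ Fintype.piFinset (fun _ : Fin T => s), ∑ k ∈ s, G (Fin.snoc h k) := by
  rw [← Finset.sum_product']
  symm
  refine Finset.sum_bij' (fun p _ => Fin.snoc p.1 p.2) (fun h _ => (Fin.init h, h (Fin.last T)))
    ?_ ?_ ?_ ?_ ?_
  · rintro ⟨h, k⟩ hp
    rw [Finset.mem_product, Fintype.mem_piFinset] at hp
    rw [Fintype.mem_piFinset]
    intro t
    refine Fin.lastCases ?_ (fun i => ?_) t
    · simpa using hp.2
    · simpa using hp.1 i
  · intro h hh
    rw [Fintype.mem_piFinset] at hh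
    rw [Finset.mem_product, Fintype.mem_piFinset]
    exact ⟨fun i => hh _, hh _⟩
  · rintro ⟨h, k⟩ _
    simp
  · intro h _
    simp
  · intros
    rfl

lemma pathProb_nonneg {P : Params} (hP : P.Admissible) {T : ℕ} (h : Fin T → ℕ) :
    0 ≤ pathProb P T x ℓ h :=
  Finset.prod_nonneg fun _ _ => drawLaw_nonneg _ _ hP _

lemma sum_pathProb {P : Params} (hM : 1 ≤ P.M) (T : ℕ) :
    ∑ h ∈ Fintype.piFinset (fun _ : Fin T => Finset.Icc 1 (2 ^ P.M)), pathProb P T x ℓ h = 1 := by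
  induction T with
  | zero => simp [pathProb]
  | succ T ih =>
    rw [sum_piFinset_snoc, ← ih]
    refine Finset.sum_congr rfl fun h _ => ?_
    simp only [pathProb_snoc]
    rw [← Finset.mul_sum, sum_drawLaw _ _ hM, mul_one]

/-- Tower property: if each increment has nonnegative conditional mean given the past, the sum has
nonnegative expectation. The past enters only through the state, and asking for all states avoids
describing the reachable ones. -/
lemma sum_pathProb_mul_nonneg {P : Params} (hP : P.Admissible) {T : ℕ}
    (F : ℕ → State d → ℕ → ℝ) (hF : ∀ t < T, ∀ L, 0 ≤ drawMean P L (x t) (F t L)) :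
    0 ≤ ∑ h ∈ Fintype.piFinset (fun _ : Fin T => Finset.Icc 1 (2 ^ P.M)), pathProb P T x ℓ h *
      ∑ t ∈ Finset.range T, F t (stateAt P x ℓ (pad h) t) (pad h t) := by
  induction T with
  | zero => simp
  | succ T ih =>
    rw [sum_piFinset_snoc]
    have h1 := ih fun t ht => hF t (by omega)
    refine h1.trans (Finset.sum_le_sum fun h _ => ?_)
    have hsum : ∀ k, ∑ t ∈ Finset.range (T + 1),
        F t (stateAt P x ℓ (pad (Fin.snoc h k : Fin (T + 1) → ℕ)) t)
          (pad (Fin.snoc h k : Fin (T + 1) → ℕ) t) =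
        ∑ t ∈ Finset.range T, F t (stateAt P x ℓ (pad h) t) (pad h t) +
          F T (stateAt P x ℓ (pad h) T) k := by
      intro k
      rw [Finset.sum_range_succ, pad_snoc_last,
        stateAt_congr P x ℓ fun s hs => pad_snoc_lt h k hs]
      congr 1
      refine Finset.sum_congr rfl fun t ht => ?_
      rw [Finset.mem_range] at ht
      rw [pad_snoc_lt h k ht, stateAt_congr P x ℓ fun s hs => pad_snoc_lt h k (hs.trans ht)]
    simp only [pathProb_snoc, hsum, mul_assoc, ← Finset.mul_sum]
    refine mul_le_mul_of_nonneg_left ?_ (pathProb_nonneg x ℓ hP h)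
    simp only [mul_add, Finset.sum_add_distrib]
    rw [← Finset.sum_mul, sum_drawLaw _ _ hP.one_le_M, one_mul]
    linarith [hF T (by omega) (stateAt P x ℓ (pad h) T), drawMean.eq_1 P
      (stateAt P x ℓ (pad h) T) (x T) (F T (stateAt P x ℓ (pad h) T))]

open Classical in
/-- Regret of exponential weights at one node, along an arbitrary sequence of draws. -/
lemma sum_surplus_le {P : Params} (hP : P.Admissible) {T : ℕ} (hℓ : ∀ t < T, LipschitzWith 1 (ℓ t))
    (h : ℕ → ℕ) {w : ExpNode d} (hw : w.1.length < P.M) (c : SignType) :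
    ∑ t ∈ Finset.range T, (if x t ∈ cubeOf w then
      surplus P (stateAt P x ℓ h t) (x t) (ℓ t) (h t) w c else 0) ≤
      Real.log 3 / P.η w.1.length := by
  set η := P.η w.1.length with hη
  have hη0 : 0 < η := hP.η_pos _
  -- The surplus is a lower bound for the increment of this difference, which starts at -log 3/η and
  -- never becomes positive. Rounds in which `w` is inactive leave it unchanged.
  set D : ℕ → ℝ := fun t => potential η (stateAt P x ℓ h t w) - stateAt P x ℓ h t w c
  have key : ∀ t ∈ Finset.range T, (if x t ∈ cubeOf w then
      surplus P (stateAt P x ℓ h t) (x t) (ℓ t) (h t) w c else 0) ≤ D (t + 1) - D t := by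
    intro t ht
    rw [Finset.mem_range] at ht
    have hs : ∀ c, stateAt P x ℓ h (t + 1) w c = stateAt P x ℓ h t w c +
        if w.1.length < P.M ∧ x t ∈ cubeOf w then
          expertLoss P (stateAt P x ℓ h t) (x t) (ℓ t) (h t) w c else 0 := fun c => rfl
    split_ifs with hx
    · have h1 := potential_step hη0 (stateAt P x ℓ h t w)
        (expertLoss P (stateAt P x ℓ h t) (x t) (ℓ t) (h t) w)
        (expertLoss_nonneg _ hP (hℓ t ht) _ hw)
      have h2 : stateAt P x ℓ h (t + 1) w = fun c => stateAt P x ℓ h t w c +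
          expertLoss P (stateAt P x ℓ h t) (x t) (ℓ t) (h t) w c := by
        funext c
        rw [hs, if_pos ⟨hw, hx⟩]
      rw [← h2] at h1
      have h3 := congrFun h2 c
      simp only [D, surplus]
      simp only [weights]
      linarith
    · have h2 : stateAt P x ℓ h (t + 1) w = stateAt P x ℓ h t w := by
        funext c
        rw [hs, if_neg (fun h => hx h.2), add_zero]
      simp only [D, h2, sub_self, le_refl]
  refine (Finset.sum_le_sum key).trans ?_
  rw [Finset.sum_range_sub]
  have h0 : stateAt P x ℓ h 0 w = fun _ => 0 := rfl
  have h1 := potential_le hη0 (stateAt P x ℓ h T w) c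
  simp only [D, h0, potential_zero]
  linarith

/-- Regret of the mixtures along a comparator tree. -/
lemma sum_surplus_compPath_le {P : Params} (hP : P.Admissible) {T : ℕ}
    (hℓ : ∀ t < T, LipschitzWith 1 (ℓ t)) (h : ℕ → ℕ) (ch : ExpNode d → SignType) {m : ℕ}
    (hm : m < P.M) :
    ∑ t ∈ Finset.range T, surplus P (stateAt P x ℓ h t) (x t) (ℓ t) (h t)
      (activeExp (x t) (compPath ch (x t) m)) (ch (activeExp (x t) (compPath ch (x t) m))) ≤
      2 ^ (d * (m + 1)) * (Real.log 3 / P.η m) := by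
  classical
  -- The comparator fixes one coefficient per node, so its nodes at this depth are indexed by the
  -- cubes alone, 2^(d(m+1)) of them, and each context activates exactly one.
  set W : Finset (ExpNode d) := Finset.univ.image
    (fun σ : (Fin m → Subcube d) × Subcube d => (compNode ch (List.ofFn σ.1), σ.2)) with hW
  have hcard : (W.card : ℝ) ≤ 2 ^ (d * (m + 1)) := by
    have h1 : W.card ≤ (2 ^ d) ^ m * 2 ^ d := by
      refine Finset.card_image_le.trans ?_
      simp
    calc (W.card : ℝ) ≤ (((2 ^ d) ^ m * 2 ^ d : ℕ) : ℝ) := by exact_mod_cast h1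
      _ = 2 ^ (d * (m + 1)) := by push_cast; ring
  have hlen : ∀ w ∈ W, w.1.length = m := by
    intro w hw
    obtain ⟨σ, -, rfl⟩ := Finset.mem_image.1 hw
    simp [length_compNode]
  have hmem : ∀ y : Ctx d, activeExp y (compPath ch y m) ∈ W := by
    intro y
    refine Finset.mem_image.2 ⟨(fun i => (addr y m).get (i.cast (length_addr y m).symm),
      bits y m), Finset.mem_univ _, ?_⟩
    rw [activeExp, length_compPath, compPath]
    congr 2
    refine List.ext_get (by simp) fun n h1 h2 => ?_
    simp
  have hiff : ∀ y : Ctx d, ∀ w ∈ W, (activeExp y (compPath ch y m) = w ↔ y ∈ cubeOf w) := by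
    intro y w hw
    constructor
    · rintro rfl
      exact mem_cubeOf_activeExp (active_compPath ch y m)
    · intro hy
      rw [mem_cubeOf_iff] at hy
      have hl := hlen w hw
      obtain ⟨σ, -, rfl⟩ := Finset.mem_image.1 hw
      obtain ⟨h1, h2⟩ := hy
      simp only at h1 h2 hl
      rw [Active, map_compNode, hl] at h1
      rw [hl] at h2
      simp only [activeExp, length_compPath]
      rw [h1, h2]
      rfl
  have hsplit : ∀ t, surplus P (stateAt P x ℓ h t) (x t) (ℓ t) (h t)
      (activeExp (x t) (compPath ch (x t) m)) (ch (activeExp (x t) (compPath ch (x t) m))) =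
      ∑ w ∈ W, if x t ∈ cubeOf w then
        surplus P (stateAt P x ℓ h t) (x t) (ℓ t) (h t) w (ch w) else 0 := by
    intro t
    rw [Finset.sum_eq_single (activeExp (x t) (compPath ch (x t) m))]
    · rw [if_pos ((hiff _ _ (hmem _)).1 rfl)]
    · intro w hw hne
      rw [if_neg fun hx => hne ((hiff _ _ hw).2 hx).symm]
    · exact fun hn => absurd (hmem _) hn
  simp only [hsplit]
  rw [Finset.sum_comm]
  have hb : 0 ≤ Real.log 3 / P.η m :=
    div_nonneg (Real.log_nonneg (by norm_num)) (hP.η_pos m).le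
  calc _ ≤ ∑ w ∈ W, Real.log 3 / P.η m := Finset.sum_le_sum fun w hw => by
        have := sum_surplus_le x ℓ hP hℓ h (w := w) (by rw [hlen w hw]; exact hm) (ch w)
        rwa [hlen w hw] at this
    _ = W.card * (Real.log 3 / P.η m) := by rw [Finset.sum_const, nsmul_eq_mul]
    _ ≤ _ := mul_le_mul_of_nonneg_right hcard hb

end paths

/-! ### The regret bound for general parameters -/

lemma expectedLoss_le {d : ℕ} {P : Params} (hP : P.Admissible) (hT : P.Telescoping) {T : ℕ}
    (x : ℕ → Ctx d) {ℓ : ℕ → unitInterval → unitInterval} (hℓ : ∀ t < T, LipschitzWith 1 (ℓ t))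
    {f : Ctx d → unitInterval} (hf : LipschitzWith 1 f) :
    expectedLoss P T x ℓ ≤ ∑ t ∈ Finset.range T, (ℓ t (f (x t)) : ℝ) +
      (T * (2 * (1 / 2) ^ P.M + roundBound P) +
        ∑ m ∈ Finset.range P.M, 2 ^ (d * (m + 1)) * (Real.log 3 / P.η m)) := by
  set ch := track f
  set X : ℕ → State d → ℕ → ℝ := fun t L I => ∑ m ∈ Finset.range P.M, surplus P L (x t) (ℓ t) I
    (activeExp (x t) (compPath ch (x t) m)) (ch (activeExp (x t) (compPath ch (x t) m)))
  set R := ∑ m ∈ Finset.range P.M, 2 ^ (d * (m + 1)) * (Real.log 3 / P.η m) with hR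
  set B := 2 * (1 / 2) ^ P.M + roundBound P with hB
  -- The bound of one round enters in conditional mean, whereas the sum of the surpluses is bounded
  -- below along every sequence of draws.
  have h0 := sum_pathProb_mul_nonneg x ℓ hP (T := T)
    (fun t L I => X t L I + ((ℓ t (f (x t)) : ℝ) + B) - (ℓ t (grid P.M I) : ℝ)) (by
      intro t ht L
      rw [drawMean_sub, drawMean_add, drawMean_const _ _ hP.one_le_M]
      have h1 := drawMean_loss_le_surplus hP hT L (x t) (hℓ t ht) ch
      have h2 := meanLoss_leaf_le hP L (x t) (hℓ t ht) (length_compPath ch (x t) P.M) (f (x t))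
        (abs_sub_label_compPath_le hf (x t) P.M)
      simp only [X]
      linarith)
  set H := Fintype.piFinset (fun _ : Fin T => Finset.Icc 1 (2 ^ P.M))
  have h1 : ∀ h ∈ H, pathProb P T x ℓ h * ∑ t ∈ Finset.range T,
      (X t (stateAt P x ℓ (pad h) t) (pad h t) + ((ℓ t (f (x t)) : ℝ) + B) -
        (ℓ t (grid P.M (pad h t)) : ℝ)) ≤
      pathProb P T x ℓ h * (R + (∑ t ∈ Finset.range T, (ℓ t (f (x t)) : ℝ) + T * B)) -
        pathProb P T x ℓ h * ∑ t : Fin T, (ℓ t (grid P.M (h t)) : ℝ) := by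
    intro h _
    rw [← mul_sub]
    refine mul_le_mul_of_nonneg_left ?_ (pathProb_nonneg x ℓ hP h)
    rw [Finset.sum_sub_distrib, Finset.sum_add_distrib, Finset.sum_add_distrib, Finset.sum_const,
      Finset.card_range, nsmul_eq_mul]
    have h2 : ∑ t ∈ Finset.range T, (ℓ t (grid P.M (pad h t)) : ℝ) =
        ∑ t : Fin T, (ℓ t (grid P.M (h t)) : ℝ) := by
      rw [Finset.sum_range]
      refine Finset.sum_congr rfl fun t _ => ?_
      rw [pad, dif_pos t.2]
    have h3 : ∑ t ∈ Finset.range T, X t (stateAt P x ℓ (pad h) t) (pad h t) ≤ R := by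
      rw [Finset.sum_comm]
      refine Finset.sum_le_sum fun m hm => ?_
      exact sum_surplus_compPath_le x ℓ hP hℓ (pad h) ch (Finset.mem_range.1 hm)
    rw [h2]
    linarith
  have h2 := h0.trans (Finset.sum_le_sum h1)
  rw [Finset.sum_sub_distrib, ← Finset.sum_mul, sum_pathProb x ℓ hP.one_le_M, one_mul] at h2
  rw [expectedLoss]
  linarith

lemma lipschitz_nonempty (d : ℕ) : Nonempty {f : Ctx d → unitInterval // LipschitzWith 1 f} :=
  ⟨⟨fun _ => 0, LipschitzWith.const' 0⟩⟩

lemma regret_le {d : ℕ} {P : Params} (hP : P.Admissible) (hT : P.Telescoping) {T : ℕ}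
    (x : ℕ → Ctx d) {ℓ : ℕ → unitInterval → unitInterval} (hℓ : ∀ t < T, LipschitzWith 1 (ℓ t)) :
    regret P T x ℓ ≤ T * (2 * (1 / 2) ^ P.M + roundBound P) +
        ∑ m ∈ Finset.range P.M, 2 ^ (d * (m + 1)) * (Real.log 3 / P.η m) := by
  have := lipschitz_nonempty d
  rw [regret, sub_le_comm]
  refine le_ciInf fun f => ?_
  have := expectedLoss_le hP hT x hℓ f.2
  linarith

/-! ### The tuned parameters -/

section tuning

lemma one_le_log {T : ℕ} (hT : 3 ≤ T) : 1 ≤ Real.log T := by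
  have h3 : (3 : ℝ) ≤ T := by exact_mod_cast hT
  rw [Real.le_log_iff_exp_le (by linarith)]
  linarith [Real.exp_one_lt_d9]

/-- Uniform upper bound on the exploration parameter. -/
noncomputable def gammaMax (d : ℕ) : ℝ :=
  if d = 1 then (3 : ℝ) ^ (-(1 / 2) : ℝ) else (3 : ℝ) ^ (-(1 / ((d : ℝ) + 2 / 3)))

/-- Keeps the factor 1/(1 - γ) of the root term below a constant that depends on `d` only. -/
lemma gammaMax_lt_one (d : ℕ) : gammaMax d < 1 := by
  rw [gammaMax]
  split_ifs
  · exact Real.rpow_lt_one_of_one_lt_of_neg (by norm_num) (by norm_num)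
  · refine Real.rpow_lt_one_of_one_lt_of_neg (by norm_num) ?_
    rw [neg_lt_zero]
    positivity

lemma tunedGamma_pos (d : ℕ) {T : ℕ} (hT : 3 ≤ T) : 0 < tunedGamma d T := by
  have h3 : (3 : ℝ) ≤ T := by exact_mod_cast hT
  have hT0 : (0 : ℝ) < T := by linarith
  have := one_le_log hT
  rw [tunedGamma]
  split_ifs <;> positivity

lemma tunedGamma_le (d : ℕ) {T : ℕ} (hT : 3 ≤ T) : tunedGamma d T ≤ gammaMax d := by
  have h3 : (3 : ℝ) ≤ T := by exact_mod_cast hT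
  have hl := one_le_log hT
  rw [tunedGamma, gammaMax]
  split_ifs
  · calc (T : ℝ) ^ (-(1 / 2) : ℝ) * (Real.log T)⁻¹ ≤ (T : ℝ) ^ (-(1 / 2) : ℝ) * 1 := by
          refine mul_le_mul_of_nonneg_left (inv_le_one_of_one_le₀ hl) ?_
          exact Real.rpow_nonneg (by linarith) _
      _ ≤ _ := by
          rw [mul_one]
          exact Real.rpow_le_rpow_of_nonpos (by norm_num) h3 (by norm_num)
  · refine Real.rpow_le_rpow_of_nonpos (by norm_num) h3 ?_
    rw [neg_nonpos]
    positivity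

lemma tunedGamma_lt_one (d : ℕ) {T : ℕ} (hT : 3 ≤ T) : tunedGamma d T < 1 :=
  (tunedGamma_le d hT).trans_lt (gammaMax_lt_one d)

lemma log_inv_gamma_pos (d : ℕ) {T : ℕ} (hT : 3 ≤ T) : 0 < Real.log (1 / tunedGamma d T) := by
  refine Real.log_pos ?_
  rw [lt_div_iff₀ (tunedGamma_pos d hT), one_mul]
  exact tunedGamma_lt_one d hT

lemma one_le_tunedDepth (d : ℕ) {T : ℕ} (hT : 3 ≤ T) : 1 ≤ tunedDepth d T := by
  rw [tunedDepth, Nat.one_le_ceil_iff, Real.logb]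
  exact div_pos (log_inv_gamma_pos d hT) (Real.log_pos (by norm_num))

lemma le_two_pow_tunedDepth (d : ℕ) {T : ℕ} (hT : 3 ≤ T) :
    1 / tunedGamma d T ≤ 2 ^ tunedDepth d T := by
  have hg := tunedGamma_pos d hT
  have h := Nat.le_ceil (Real.logb 2 (1 / tunedGamma d T))
  rw [Real.logb_le_iff_le_rpow (by norm_num) (by positivity), Real.rpow_natCast] at h
  exact h

lemma two_pow_tunedDepth_le (d : ℕ) {T : ℕ} (hT : 3 ≤ T) :
    (2 : ℝ) ^ tunedDepth d T ≤ 2 * (1 / tunedGamma d T) := by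
  have hg := tunedGamma_pos d hT
  have h0 : 0 ≤ Real.logb 2 (1 / tunedGamma d T) :=
    div_nonneg (log_inv_gamma_pos d hT).le (Real.log_nonneg (by norm_num))
  have h := (Nat.ceil_lt_add_one h0).le
  have h2 : (2 : ℝ) ^ (tunedDepth d T : ℝ) ≤ 2 ^ (Real.logb 2 (1 / tunedGamma d T) + 1) :=
    Real.rpow_le_rpow_of_exponent_le (by norm_num) h
  rw [Real.rpow_natCast, Real.rpow_add (by norm_num), Real.rpow_one,
    Real.rpow_logb (by norm_num) (by norm_num) (by positivity)] at h2
  linarith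

/-- For d = 1 the logarithm is (log T)/2 + log log T, which accounts for the constant 3/2; in higher
dimension it is at most log T. -/
lemma log_inv_gamma_le {d : ℕ} (hd : 1 ≤ d) {T : ℕ} (hT : 3 ≤ T) :
    Real.log (1 / tunedGamma d T) ≤ 3 / 2 * Real.log T := by
  have h3 : (3 : ℝ) ≤ T := by exact_mod_cast hT
  have hT0 : (0 : ℝ) < T := by linarith
  have hl := one_le_log hT
  rw [one_div, Real.log_inv, tunedGamma]
  split_ifs with h
  · rw [Real.log_mul (by positivity) (by positivity), Real.log_rpow hT0, Real.log_inv]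
    have := Real.log_le_sub_one_of_pos (zero_lt_one.trans_le hl)
    linarith
  · rw [Real.log_rpow hT0]
    have h1 : (1 : ℝ) / (d + 2 / 3) ≤ 1 := by
      have : (1 : ℝ) ≤ d := by exact_mod_cast hd
      rw [div_le_one (by positivity)]
      linarith
    nlinarith

lemma tunedDepth_le {d : ℕ} (hd : 1 ≤ d) {T : ℕ} (hT : 3 ≤ T) :
    (tunedDepth d T : ℝ) ≤ 4 * Real.log T := by
  have hl := one_le_log hT
  have h0 : 0 ≤ Real.logb 2 (1 / tunedGamma d T) :=
    div_nonneg (log_inv_gamma_pos d hT).le (Real.log_nonneg (by norm_num))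
  have h := (Nat.ceil_lt_add_one h0).le
  have h1 := log_inv_gamma_le hd hT
  have h2 := Real.log_two_gt_d9
  have h3 : Real.logb 2 (1 / tunedGamma d T) ≤ 3 * Real.log T := by
    rw [Real.logb, div_le_iff₀ (by linarith)]
    nlinarith
  rw [tunedDepth]
  linarith

lemma tunedC_pos (d : ℕ) {T : ℕ} (hT : 3 ≤ T) : 0 < tunedC d T := by
  have h : (0 : ℝ) < tunedDepth d T := by exact_mod_cast one_le_tunedDepth d hT
  rw [tunedC]
  split_ifs <;> positivity

/-- The factor `γ ^ (1 / 2) * T ^ (-1 / 4)` of the learning rates. -/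
noncomputable def rateScale (d T : ℕ) : ℝ := tunedGamma d T ^ (1 / 2 : ℝ) * (T : ℝ) ^ (-(1 / 4) : ℝ)

lemma rateScale_pos (d : ℕ) {T : ℕ} (hT : 3 ≤ T) : 0 < rateScale d T := by
  have h1 := tunedGamma_pos d hT
  have h3 : (3 : ℝ) ≤ T := by exact_mod_cast hT
  have hT0 : (0 : ℝ) < T := by linarith
  rw [rateScale]
  positivity

lemma tunedEta_eq (d T m : ℕ) :
    tunedEta d T m = tunedC d T * rateScale d T * ((2 : ℝ) ^ ((d : ℝ) / 4 + 1)) ^ m := by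
  rw [tunedEta, rateScale, ← Real.rpow_mul_natCast (by norm_num), mul_comm (m : ℝ)]
  ring

/-- The ratio 2^(d/4+1) of the learning rates is 4 times 2^(d/4-1), and the factor 2^(-2j) cancels
the 4^j. -/
lemma tunedAlpha_eq (d T m : ℕ) :
    tunedAlpha d T m = 16 * (tunedC d T * rateScale d T) *
      ∑ j ∈ Finset.Icc (m + 1) (tunedDepth d T), ((2 : ℝ) ^ ((d : ℝ) / 4 - 1)) ^ j := by
  rw [tunedAlpha, Finset.mul_sum]
  refine Finset.sum_congr rfl fun j _ => ?_
  have h : (2 : ℝ) ^ ((d : ℝ) / 4 + 1) = 4 * (2 : ℝ) ^ ((d : ℝ) / 4 - 1) := by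
    rw [show (4 : ℝ) = 2 ^ (2 : ℝ) by norm_num, ← Real.rpow_add (by norm_num)]
    congr 1
    ring
  rw [tunedEta_eq, h, mul_pow, zpow_sub₀ two_ne_zero, zpow_mul]
  have h4 : ((2 : ℝ) ^ (2 : ℤ)) ^ (j : ℤ) = 4 ^ j := by norm_num
  rw [h4]
  norm_num
  field_simp

lemma tuned_admissible (d : ℕ) {T : ℕ} (hT : 3 ≤ T) : (tuned d T).Admissible where
  one_le_M := one_le_tunedDepth d hT
  γ_pos := tunedGamma_pos d hT
  γ_lt_one := tunedGamma_lt_one d hT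
  η_pos m := by
    change 0 < tunedEta d T m
    have h1 := tunedC_pos d hT
    have h2 := rateScale_pos d hT
    rw [tunedEta_eq]
    positivity
  α_nonneg m := by
    change 0 ≤ tunedAlpha d T m
    have h1 := tunedC_pos d hT
    have h2 := rateScale_pos d hT
    rw [tunedAlpha_eq]
    positivity

lemma tuned_telescoping (d T : ℕ) : (tuned d T).Telescoping := by
  intro m hm
  change m + 1 < tunedDepth d T at hm
  change tunedAlpha d T m = tunedAlpha d T (m + 1) + _ * tunedEta d T (m + 1)
  have h : Finset.Icc (m + 1) (tunedDepth d T) =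
      insert (m + 1) (Finset.Icc (m + 1 + 1) (tunedDepth d T)) := by
    ext j
    simp only [Finset.mem_Icc, Finset.mem_insert]
    omega
  rw [tunedAlpha, h, Finset.sum_insert (by simp), tunedAlpha, add_comm]

end tuning

/-! ### Sums of geometric type -/

section geometric

lemma geom_le_of_lt_one {r : ℝ} (h0 : 0 ≤ r) (h1 : r < 1) (n : ℕ) :
    ∑ j ∈ Finset.range n, r ^ j ≤ 1 / (1 - r) := by
  have h := mul_neg_geom_sum r n
  rw [le_div_iff₀ (by linarith), mul_comm, h]
  linarith [pow_nonneg h0 n]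

lemma geom_le_of_one_lt {r : ℝ} (h1 : 1 < r) (n : ℕ) :
    ∑ j ∈ Finset.range n, r ^ j ≤ r ^ n / (r - 1) := by
  have h := mul_geom_sum r n
  rw [le_div_iff₀ (by linarith), mul_comm, h]
  linarith

lemma sum_Icc_pow_eq (r : ℝ) {m M : ℕ} (h : m ≤ M) :
    ∑ j ∈ Finset.Icc (m + 1) M, r ^ j = r ^ (m + 1) * ∑ j ∈ Finset.range (M - m), r ^ j := by
  have : Finset.Icc (m + 1) M = Finset.Ico (m + 1) (M + 1) := by
    ext j
    simp only [Finset.mem_Icc, Finset.mem_Ico]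
    omega
  rw [this, Finset.sum_Ico_eq_sum_range, Finset.mul_sum, show M + 1 - (m + 1) = M - m by omega]
  exact Finset.sum_congr rfl fun j _ => pow_add _ _ _

/-- The three sums entering the regret bound, when the rates are `a * h ^ m` and the penalizations
are `16 * a * ∑ p ^ j`. -/
structure RateSums (d M : ℕ) (a h p A B D : ℝ) : Prop where
  penalty_le : 16 * a * ∑ j ∈ Finset.Icc 1 M, p ^ j + 16 * a ≤ a * A
  square_le : ∑ m ∈ Finset.range M, a * h ^ m * (16 * a * ∑ j ∈ Finset.Icc (m + 1) M, p ^ j) ^ 2 ≤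
    a ^ 3 * B
  count_le : ∑ m ∈ Finset.range M, 2 ^ (d * (m + 1)) / (a * h ^ m) ≤ D / a

lemma sum_count_eq (d M : ℕ) {a h E : ℝ} (ha : 0 < a) (hh : 0 < h) (hE : (2 : ℝ) ^ d = E * h) :
    ∑ m ∈ Finset.range M, (2 : ℝ) ^ (d * (m + 1)) / (a * h ^ m) =
      2 ^ d * (∑ m ∈ Finset.range M, E ^ m) / a := by
  rw [Finset.mul_sum, Finset.sum_div]
  refine Finset.sum_congr rfl fun m _ => ?_
  rw [pow_mul, hE]
  field_simp
  ring

/-- Dimension 1: all series converge and the shallow levels dominate, so the constants do not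
involve M. -/
lemma rateSums_of_lt_one {d M : ℕ} {a h p E : ℝ} (ha : 0 < a) (hh : 0 < h) (hp : 0 < p)
    (hp1 : p < 1) (hE : (2 : ℝ) ^ d = E * h) (hE2 : h * p ^ 2 = E) (hE1 : E < 1) :
    RateSums d M a h p (32 / (1 - p)) (256 / (1 - p) ^ 2 / (1 - E)) (2 ^ d / (1 - E)) := by
  have hp' : 0 < 1 - p := by linarith
  have hE' : 0 < 1 - E := by linarith
  have hE0 : 0 < E := by rw [← hE2]; positivity
  have hsum : ∀ m ≤ M, ∑ j ∈ Finset.Icc (m + 1) M, p ^ j ≤ p ^ m / (1 - p) := by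
    intro m hm
    rw [sum_Icc_pow_eq p hm, ← mul_one_div]
    exact mul_le_mul (pow_le_pow_of_le_one hp.le hp1.le (by omega))
      (geom_le_of_lt_one hp.le hp1 _) (by positivity) (by positivity)
  refine ⟨?_, ?_, ?_⟩
  · have h1 := hsum 0 (Nat.zero_le _)
    rw [pow_zero, zero_add] at h1
    have h2 : 1 ≤ 1 / (1 - p) := by
      rw [le_div_iff₀ hp']
      linarith
    have h3 : 32 / (1 - p) = 16 * (1 / (1 - p)) + 16 * (1 / (1 - p)) := by ring
    rw [h3]
    nlinarith
  · calc _ ≤ ∑ m ∈ Finset.range M, a ^ 3 * (256 / (1 - p) ^ 2) * E ^ m := by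
          refine Finset.sum_le_sum fun m hm => ?_
          have h1 := hsum m (Finset.mem_range.1 hm).le
          calc _ ≤ a * h ^ m * (16 * a * (p ^ m / (1 - p))) ^ 2 := by gcongr
            _ = _ := by rw [← hE2]; field_simp; ring
      _ ≤ a ^ 3 * (256 / (1 - p) ^ 2) * (1 / (1 - E)) := by
          rw [← Finset.mul_sum]
          exact mul_le_mul_of_nonneg_left (geom_le_of_lt_one hE0.le hE1 _) (by positivity)
      _ = _ := by ring
  · rw [sum_count_eq d M ha hh hE]
    gcongr
    rw [← mul_one_div]
    exact mul_le_mul_of_nonneg_left (geom_le_of_lt_one hE0.le hE1 _) (by positivity)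

/-- Dimensions 2 to 4: the penalization series is bounded by its number of terms times the first
one, which also covers p = 1 at d = 4. This is the source of the powers of M. The other two sums are
dominated by the deepest level. -/
lemma rateSums_of_le_one {d M : ℕ} {a h p E : ℝ} (hM : 1 ≤ M) (ha : 0 < a) (hh : 0 < h)
    (hp : 0 < p) (hp1 : p ≤ 1) (hE : (2 : ℝ) ^ d = E * h) (hE2 : h * p ^ 2 = E) (hE1 : 1 < E) :
    RateSums d M a h p (32 * M) (256 / (E - 1) * (M ^ 2 * E ^ M)) (2 ^ d / (E - 1) * E ^ M) := by
  have hE' : 0 < E - 1 := by linarith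
  have hM' : (1 : ℝ) ≤ M := by exact_mod_cast hM
  have hsum : ∀ m ≤ M, ∑ j ∈ Finset.Icc (m + 1) M, p ^ j ≤ M * p ^ m := by
    intro m hm
    calc _ ≤ ∑ j ∈ Finset.Icc (m + 1) M, p ^ m := Finset.sum_le_sum fun j hj =>
          pow_le_pow_of_le_one hp.le hp1 (by rw [Finset.mem_Icc] at hj; omega)
      _ = ((M - m : ℕ) : ℝ) * p ^ m := by
          rw [Finset.sum_const, nsmul_eq_mul, Nat.card_Icc]
          congr 2
          omega
      _ ≤ _ := by
          gcongr
          omega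
  refine ⟨?_, ?_, ?_⟩
  · have h1 := hsum 0 (Nat.zero_le _)
    rw [pow_zero, zero_add, mul_one] at h1
    nlinarith
  · calc _ ≤ ∑ m ∈ Finset.range M, a ^ 3 * (256 * M ^ 2) * E ^ m := by
          refine Finset.sum_le_sum fun m hm => ?_
          have h1 := hsum m (Finset.mem_range.1 hm).le
          calc _ ≤ a * h ^ m * (16 * a * (M * p ^ m)) ^ 2 := by gcongr
            _ = _ := by rw [← hE2]; ring
      _ ≤ a ^ 3 * (256 * M ^ 2) * (E ^ M / (E - 1)) := by
          rw [← Finset.mul_sum]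
          exact mul_le_mul_of_nonneg_left (geom_le_of_one_lt hE1 _) (by positivity)
      _ = _ := by ring
  · rw [sum_count_eq d M ha hh hE]
    refine div_le_div_of_nonneg_right ?_ ha.le
    rw [div_mul_eq_mul_div, mul_div_assoc]
    exact mul_le_mul_of_nonneg_left (geom_le_of_one_lt hE1 _) (by positivity)

/-- Dimension at least 5: the deepest level dominates every sum. The penalization at any depth is
bounded by the full series, and h^M p^(2M) = E^M restores the common rate. -/
lemma rateSums_of_one_lt {d M : ℕ} {a h p E : ℝ} (ha : 0 < a) (hh : 1 < h)
    (hp1 : 1 < p) (hE : (2 : ℝ) ^ d = E * h) (hE2 : h * p ^ 2 = E) :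
    RateSums d M a h p (16 * (p / (p - 1)) * p ^ M)
      (256 * (p / (p - 1)) ^ 2 / (h - 1) * E ^ M) (2 ^ d / (E - 1) * E ^ M) := by
  have hp' : 0 < p - 1 := by linarith
  have hh' : 0 < h - 1 := by linarith
  have hE1 : 1 < E := by nlinarith
  have hfull : 1 + ∑ j ∈ Finset.Icc 1 M, p ^ j ≤ p / (p - 1) * p ^ M := by
    have h1 := geom_le_of_one_lt hp1 (M + 1)
    rw [Finset.sum_range_succ', pow_zero] at h1
    have h2 := sum_Icc_pow_eq p (Nat.zero_le M)
    rw [zero_add, Nat.sub_zero, pow_one, Finset.mul_sum] at h2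
    rw [h2]
    calc _ = (∑ k ∈ Finset.range M, p ^ (k + 1)) + 1 := by
          rw [add_comm]
          congr 1
          exact Finset.sum_congr rfl fun j _ => by ring
      _ ≤ _ := h1
      _ = _ := by rw [pow_succ]; ring
  have hsum : ∀ m, ∑ j ∈ Finset.Icc (m + 1) M, p ^ j ≤ p / (p - 1) * p ^ M := by
    intro m
    have h1 : ∑ j ∈ Finset.Icc (m + 1) M, p ^ j ≤ ∑ j ∈ Finset.Icc 1 M, p ^ j :=
      Finset.sum_le_sum_of_subset_of_nonneg (Finset.Icc_subset_Icc (by omega) le_rfl)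
        fun j _ _ => by positivity
    linarith
  refine ⟨?_, ?_, ?_⟩
  · nlinarith
  · calc _ ≤ ∑ m ∈ Finset.range M, a ^ 3 * (256 * (p / (p - 1) * p ^ M) ^ 2) * h ^ m := by
          refine Finset.sum_le_sum fun m _ => ?_
          calc _ ≤ a * h ^ m * (16 * a * (p / (p - 1) * p ^ M)) ^ 2 := by
                gcongr
                exact hsum m
            _ = _ := by ring
      _ ≤ a ^ 3 * (256 * (p / (p - 1) * p ^ M) ^ 2) * (h ^ M / (h - 1)) := by
          rw [← Finset.mul_sum]
          exact mul_le_mul_of_nonneg_left (geom_le_of_one_lt hh _) (by positivity)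
      _ = _ := by rw [← hE2]; ring
  · rw [sum_count_eq d M ha (by linarith) hE]
    refine div_le_div_of_nonneg_right ?_ ha.le
    rw [div_mul_eq_mul_div, mul_div_assoc]
    exact mul_le_mul_of_nonneg_left (geom_le_of_one_lt hE1 _) (by positivity)

end geometric

/-! ### The regret of the tuned algorithm -/

section regret

/-- With h = 2^(d/4+1) and p = 2^(d/4-1), the ratio 2^d/h of the learning costs per depth coincides
with h p^2, the ratio that governs the squared penalizations; this is what the exponent d/4 + 1
balances. -/
lemma two_rpow_relations (d : ℕ) :
    (2 : ℝ) ^ d = (2 : ℝ) ^ (3 * (d : ℝ) / 4 - 1) * (2 : ℝ) ^ ((d : ℝ) / 4 + 1) ∧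
      (2 : ℝ) ^ ((d : ℝ) / 4 + 1) * ((2 : ℝ) ^ ((d : ℝ) / 4 - 1)) ^ 2 =
        (2 : ℝ) ^ (3 * (d : ℝ) / 4 - 1) := by
  constructor
  · rw [← Real.rpow_add (by norm_num), ← Real.rpow_natCast]
    congr 1
    ring
  · rw [← Real.rpow_mul_natCast (by norm_num), ← Real.rpow_add (by norm_num)]
    congr 1
    push_cast
    ring

/-- The fourth power of the scale is γ^2/T. This makes the cost of the squared penalizations, T
g^3/γ^2, equal to the learning cost 1/g. -/
lemma scale_identity (d : ℕ) {T : ℕ} (hT : 3 ≤ T) :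
    T * rateScale d T ^ 3 / tunedGamma d T ^ 2 = 1 / rateScale d T := by
  have hg := tunedGamma_pos d hT
  have h3 : (3 : ℝ) ≤ T := by exact_mod_cast hT
  have hT0 : (0 : ℝ) < T := by linarith
  have hr := rateScale_pos d hT
  have h4 : rateScale d T ^ 4 = tunedGamma d T ^ 2 * (T : ℝ)⁻¹ := by
    rw [rateScale, mul_pow, ← Real.rpow_mul_natCast hg.le, ← Real.rpow_mul_natCast hT0.le]
    rw [← Real.rpow_neg_one, ← Real.rpow_natCast (tunedGamma d T)]
    norm_num
  rw [div_eq_div_iff (by positivity) (by positivity), one_mul]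
  calc _ = T * rateScale d T ^ 4 := by ring
    _ = _ := by rw [h4]; field_simp

/-- The four terms are discretization plus exploration (2·2^(-M) ≤ 2γ, and γ), the root penalty, the
squared penalizations and the learning cost, where log 3 ≤ 2. -/
lemma tuned_regret_le {d : ℕ} (hd : 1 ≤ d) {T : ℕ} (hT : 3 ≤ T) (x : ℕ → Ctx d)
    {ℓ : ℕ → unitInterval → unitInterval} (hℓ : ∀ t < T, LipschitzWith 1 (ℓ t)) {A B D : ℝ}
    (h : RateSums d (tunedDepth d T) (tunedC d T * rateScale d T) ((2 : ℝ) ^ ((d : ℝ) / 4 + 1))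
      ((2 : ℝ) ^ ((d : ℝ) / 4 - 1)) A B D) :
    regret (tuned d T) T x ℓ ≤ 3 * (T * tunedGamma d T) +
      2 / (1 - gammaMax d) * (T * rateScale d T * (tunedC d T * A) * Real.log T) +
      tunedC d T ^ 3 * B / rateScale d T + 2 * (D / (tunedC d T * rateScale d T)) := by
  have hP := tuned_admissible d hT
  have hM : (tuned d T).M = tunedDepth d T := rfl
  have hη : ∀ m, (tuned d T).η m =
      tunedC d T * rateScale d T * ((2 : ℝ) ^ ((d : ℝ) / 4 + 1)) ^ m := tunedEta_eq d T
  have hα : ∀ m, (tuned d T).α m = 16 * (tunedC d T * rateScale d T) *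
      ∑ j ∈ Finset.Icc (m + 1) (tunedDepth d T), ((2 : ℝ) ^ ((d : ℝ) / 4 - 1)) ^ j :=
    tunedAlpha_eq d T
  have hγ : (tuned d T).γ = tunedGamma d T := rfl
  have hg := tunedGamma_pos d hT
  have hgm := tunedGamma_le d hT
  have hgm1 := gammaMax_lt_one d
  have hr := rateScale_pos d hT
  have hc := tunedC_pos d hT
  have hl := one_le_log hT
  have h3 : (3 : ℝ) ≤ T := by exact_mod_cast hT
  have hT0 : (0 : ℝ) < T := by linarith
  have hid := scale_identity d hT
  refine (regret_le hP (tuned_telescoping d T) x hℓ).trans ?_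
  rw [roundBound, penalty, hM, hγ]
  simp only [hη, hα]
  set c := tunedC d T
  set g := rateScale d T
  set γ := tunedGamma d T
  have h1 : 2 * (1 / 2 : ℝ) ^ tunedDepth d T ≤ 2 * γ := by
    have := le_two_pow_tunedDepth d hT
    rw [div_pow, one_pow]
    have h2 : 1 / (2 : ℝ) ^ tunedDepth d T ≤ γ := (one_div_le (by positivity) hg).2 this
    linarith
  have h2 := h.penalty_le
  have h2' : (16 * (c * g) * ∑ j ∈ Finset.Icc (0 + 1) (tunedDepth d T),
      ((2 : ℝ) ^ ((d : ℝ) / 4 - 1)) ^ j + 16 * (c * g * ((2 : ℝ) ^ ((d : ℝ) / 4 + 1)) ^ 0)) *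
      (Real.log (1 / γ) / (1 - γ)) ≤ c * g * A * (2 * Real.log T / (1 - gammaMax d)) := by
    have h5 : Real.log (1 / γ) / (1 - γ) ≤ 2 * Real.log T / (1 - gammaMax d) := by
      have := log_inv_gamma_le hd hT
      exact div_le_div₀ (by positivity) (by linarith) (by linarith) (by linarith)
    have h6 : 0 ≤ Real.log (1 / γ) / (1 - γ) :=
      div_nonneg (log_inv_gamma_pos d hT).le (by linarith)
    have h7 : 0 ≤ 16 * (c * g) * ∑ j ∈ Finset.Icc 1 (tunedDepth d T),
      ((2 : ℝ) ^ ((d : ℝ) / 4 - 1)) ^ j + 16 * (c * g) := by positivity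
    rw [zero_add, pow_zero, mul_one]
    exact mul_le_mul h2 h5 h6 (h7.trans h2)
  have h4 : T * ∑ m ∈ Finset.range (tunedDepth d T),
      c * g * ((2 : ℝ) ^ ((d : ℝ) / 4 + 1)) ^ m * (16 * (c * g) *
        (∑ j ∈ Finset.Icc (m + 1) (tunedDepth d T), ((2 : ℝ) ^ ((d : ℝ) / 4 - 1)) ^ j) / γ) ^ 2 ≤
      c ^ 3 * B / g := by
    calc _ = T / γ ^ 2 * ∑ m ∈ Finset.range (tunedDepth d T),
          c * g * ((2 : ℝ) ^ ((d : ℝ) / 4 + 1)) ^ m * (16 * (c * g) *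
          ∑ j ∈ Finset.Icc (m + 1) (tunedDepth d T), ((2 : ℝ) ^ ((d : ℝ) / 4 - 1)) ^ j) ^ 2 := by
          rw [Finset.mul_sum, Finset.mul_sum]
          refine Finset.sum_congr rfl fun m _ => ?_
          rw [div_pow]
          field_simp
      _ ≤ T / γ ^ 2 * ((c * g) ^ 3 * B) :=
          mul_le_mul_of_nonneg_left h.square_le (by positivity)
      _ = c ^ 3 * B * (T * g ^ 3 / γ ^ 2) := by ring
      _ = _ := by rw [hid]; ring
  have h5 : ∑ m ∈ Finset.range (tunedDepth d T), 2 ^ (d * (m + 1)) *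
      (Real.log 3 / (c * g * ((2 : ℝ) ^ ((d : ℝ) / 4 + 1)) ^ m)) ≤ 2 * (D / (c * g)) := by
    have hlog : Real.log 3 ≤ 2 := by
      have := Real.log_le_sub_one_of_pos (show (0 : ℝ) < 3 by norm_num)
      linarith
    have hlog0 : 0 ≤ Real.log 3 := Real.log_nonneg (by norm_num)
    calc _ = Real.log 3 * ∑ m ∈ Finset.range (tunedDepth d T), 2 ^ (d * (m + 1)) /
          (c * g * ((2 : ℝ) ^ ((d : ℝ) / 4 + 1)) ^ m) := by
          rw [Finset.mul_sum]
          exact Finset.sum_congr rfl fun m _ => by ring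
      _ ≤ _ := mul_le_mul hlog h.count_le (by positivity) (by norm_num)
  have h6 := mul_le_mul_of_nonneg_left h1 hT0.le
  have h7 := mul_le_mul_of_nonneg_left h2' hT0.le
  calc _ = T * (2 * (1 / 2 : ℝ) ^ tunedDepth d T) + T * γ + T * ((16 * (c * g) *
        ∑ j ∈ Finset.Icc (0 + 1) (tunedDepth d T), ((2 : ℝ) ^ ((d : ℝ) / 4 - 1)) ^ j +
        16 * (c * g * ((2 : ℝ) ^ ((d : ℝ) / 4 + 1)) ^ 0)) * (Real.log (1 / γ) / (1 - γ))) + _ + _ := by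
        rw [mul_add, mul_add, mul_add, ← add_assoc, ← add_assoc]
    _ ≤ T * (2 * γ) + T * γ + T * (c * g * A * (2 * Real.log T / (1 - gammaMax d))) +
        c ^ 3 * B / g + 2 * (D / (c * g)) := by
        gcongr
    _ = _ := by ring

lemma tuned_regret_le_of_eq_one : ∃ C : ℝ, ∀ T : ℕ, 3 ≤ T → ∀ (x : ℕ → Ctx 1)
    (ℓ : ℕ → unitInterval → unitInterval), (∀ t < T, LipschitzWith 1 (ℓ t)) →
    regret (tuned 1 T) T x ℓ ≤ C * Real.sqrt (T * Real.log T) := by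
  set p : ℝ := (2 : ℝ) ^ (((1 : ℕ) : ℝ) / 4 - 1) with hp
  set E : ℝ := (2 : ℝ) ^ (3 * ((1 : ℕ) : ℝ) / 4 - 1) with hE
  set c : ℝ := (2 : ℝ) ^ (-(5 / 4) : ℝ) * (2 : ℝ) ^ (-(1 / 2) : ℝ) with hc
  have hc0 : 0 < c := by positivity
  set A := 32 / (1 - p)
  set B := 256 / (1 - p) ^ 2 / (1 - E)
  set D := 2 ^ 1 / (1 - E)
  refine ⟨3 + 2 / (1 - gammaMax 1) * (c * A) + c ^ 3 * B + 2 * (D / c), fun T hT x ℓ hℓ => ?_⟩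
  have hl := one_le_log hT
  have h3 : (3 : ℝ) ≤ T := by exact_mod_cast hT
  have hT0 : (0 : ℝ) < T := by linarith
  have hcT : tunedC 1 T = c := by rw [tunedC, if_pos rfl]
  have hr := rateScale_pos 1 hT
  have hsums : RateSums 1 (tunedDepth 1 T) (tunedC 1 T * rateScale 1 T)
      ((2 : ℝ) ^ (((1 : ℕ) : ℝ) / 4 + 1)) p A B D :=
    rateSums_of_lt_one (mul_pos (tunedC_pos 1 hT) hr) (by positivity) (by positivity)
      (Real.rpow_lt_one_of_one_lt_of_neg (by norm_num) (by norm_num))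
      (two_rpow_relations 1).1 (two_rpow_relations 1).2
      (Real.rpow_lt_one_of_one_lt_of_neg (by norm_num) (by norm_num))
  have h := tuned_regret_le le_rfl hT x hℓ hsums
  rw [hcT] at h
  set R := Real.sqrt (T * Real.log T) with hR
  have hRpos : 0 < R := Real.sqrt_pos.2 (by positivity)
  have hRsq : R ^ 2 = T * Real.log T := Real.sq_sqrt (by positivity)
  have hγ : tunedGamma 1 T = (T : ℝ) ^ (-(1 / 2) : ℝ) * (Real.log T)⁻¹ := if_pos rfl
  -- The logarithm in γ is chosen so that 1/g and T g log T both equal √(T log T).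
  have hg : rateScale 1 T = 1 / R := by
    rw [rateScale, hγ, hR, Real.mul_rpow (by positivity) (by positivity), ← Real.rpow_mul hT0.le,
      mul_right_comm, ← Real.rpow_add hT0, Real.sqrt_mul hT0.le, Real.inv_rpow (by linarith),
      ← Real.sqrt_eq_rpow (Real.log T), ← div_div, ← div_eq_mul_inv, Real.sqrt_eq_rpow (T : ℝ),
      one_div ((T : ℝ) ^ _), ← Real.rpow_neg hT0.le]
    norm_num
  have hTγ : T * tunedGamma 1 T ≤ R := by
    have h1 : (T : ℝ) * (T : ℝ) ^ (-(1 / 2) : ℝ) = Real.sqrt T := by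
      nth_rewrite 1 [← Real.rpow_one (T : ℝ)]
      rw [← Real.rpow_add hT0, Real.sqrt_eq_rpow]
      norm_num
    calc T * tunedGamma 1 T = Real.sqrt T * (Real.log T)⁻¹ := by rw [hγ, ← mul_assoc, h1]
      _ ≤ Real.sqrt T * 1 := by
        gcongr
        exact inv_le_one_of_one_le₀ hl
      _ ≤ R := by
        rw [mul_one]
        exact Real.sqrt_le_sqrt (le_mul_of_one_le_right hT0.le hl)
  rw [hg] at h
  have e1 : T * (1 / R) * (c * A) * Real.log T = c * A * R := by
    calc _ = c * A * (T * Real.log T) / R := by ring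
      _ = _ := by rw [← hRsq]; field_simp
  rw [e1] at h
  have e2 : c ^ 3 * B / (1 / R) = c ^ 3 * B * R := by field_simp
  have e3 : D / (c * (1 / R)) = D / c * R := by field_simp
  rw [e2, e3] at h
  calc _ ≤ _ := h
    _ ≤ 3 * R + 2 / (1 - gammaMax 1) * (c * A * R) + c ^ 3 * B * R + 2 * (D / c * R) := by gcongr
    _ = _ := by ring

/-! ### Powers of T in dimension at least two -/

section large

variable {d T : ℕ}

lemma tunedGamma_eq (hd : 2 ≤ d) (T : ℕ) :
    tunedGamma d T = (T : ℝ) ^ (-(1 / ((d : ℝ) + 2 / 3))) := if_neg (by omega)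

lemma rateScale_eq (hd : 2 ≤ d) (hT : 3 ≤ T) :
    rateScale d T = (T : ℝ) ^ (-(1 / ((d : ℝ) + 2 / 3)) / 2 - 1 / 4) := by
  have h3 : (3 : ℝ) ≤ T := by exact_mod_cast hT
  have hT0 : (0 : ℝ) < T := by linarith
  rw [rateScale, tunedGamma_eq hd, ← Real.rpow_mul hT0.le, ← Real.rpow_add hT0]
  congr 1
  ring

lemma mul_tunedGamma (hd : 2 ≤ d) (hT : 3 ≤ T) :
    T * tunedGamma d T = (T : ℝ) ^ (((d : ℝ) - 1 / 3) / ((d : ℝ) + 2 / 3)) := by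
  have h3 : (3 : ℝ) ≤ T := by exact_mod_cast hT
  have hT0 : (0 : ℝ) < T := by linarith
  have hd' : (2 : ℝ) ≤ d := by exact_mod_cast hd
  rw [tunedGamma_eq hd]
  nth_rewrite 1 [← Real.rpow_one (T : ℝ)]
  rw [← Real.rpow_add hT0]
  congr 1
  field_simp
  ring

lemma pow_tunedDepth_le (hd : 2 ≤ d) (hT : 3 ≤ T) {e : ℝ} (he : 0 ≤ e) :
    ((2 : ℝ) ^ e) ^ tunedDepth d T ≤ 2 ^ e * (T : ℝ) ^ (1 / ((d : ℝ) + 2 / 3) * e) := by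
  have h3 : (3 : ℝ) ≤ T := by exact_mod_cast hT
  have hT0 : (0 : ℝ) < T := by linarith
  have h := two_pow_tunedDepth_le d hT
  rw [tunedGamma_eq hd, one_div, ← Real.rpow_neg hT0.le, neg_neg] at h
  calc ((2 : ℝ) ^ e) ^ tunedDepth d T = ((2 : ℝ) ^ tunedDepth d T) ^ e := by
        rw [← Real.rpow_mul_natCast (by norm_num), ← Real.rpow_natCast,
          ← Real.rpow_mul (by norm_num), mul_comm]
    _ ≤ (2 * (T : ℝ) ^ (1 / ((d : ℝ) + 2 / 3))) ^ e := Real.rpow_le_rpow (by positivity) h he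
    _ = _ := by rw [Real.mul_rpow (by norm_num) (by positivity), ← Real.rpow_mul hT0.le]

/-- Since 2^M is of order T^(1/D) with D = d + 2/3, the exponent is ((3d/4 - 1) + 1/2 + D/4)/D = (d
- 1/3)/D. The same power as Tγ appears, which is how the 2/3 in γ is determined. -/
lemma pow_div_rateScale_le (hd : 2 ≤ d) (hT : 3 ≤ T) :
    ((2 : ℝ) ^ (3 * (d : ℝ) / 4 - 1)) ^ tunedDepth d T / rateScale d T ≤
      2 ^ (3 * (d : ℝ) / 4 - 1) * (T : ℝ) ^ (((d : ℝ) - 1 / 3) / ((d : ℝ) + 2 / 3)) := by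
  have h3 : (3 : ℝ) ≤ T := by exact_mod_cast hT
  have hT0 : (0 : ℝ) < T := by linarith
  have hd' : (2 : ℝ) ≤ d := by exact_mod_cast hd
  have h := pow_tunedDepth_le hd hT (e := 3 * (d : ℝ) / 4 - 1) (by linarith)
  have hr := rateScale_pos d hT
  rw [div_le_iff₀ hr]
  refine h.trans (le_of_eq ?_)
  rw [rateScale_eq hd hT, mul_assoc, ← Real.rpow_add hT0]
  congr 2
  field_simp
  ring

/-- The comparison of exponents amounts to d + 2/3 ≥ 2, so it fails for d = 1. -/
lemma mul_rateScale_le (hd : 2 ≤ d) (hT : 3 ≤ T) :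
    T * rateScale d T ≤ (T : ℝ) ^ (((d : ℝ) - 1 / 3) / ((d : ℝ) + 2 / 3)) := by
  have h3 : (3 : ℝ) ≤ T := by exact_mod_cast hT
  have hT0 : (0 : ℝ) < T := by linarith
  have hd' : (2 : ℝ) ≤ d := by exact_mod_cast hd
  rw [rateScale_eq hd hT]
  nth_rewrite 1 [← Real.rpow_one (T : ℝ)]
  rw [← Real.rpow_add hT0]
  refine Real.rpow_le_rpow_of_exponent_le (by linarith) ?_
  have hpos : 0 < (d : ℝ) + 2 / 3 := by linarith
  rw [le_div_iff₀ hpos]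
  have : 1 / ((d : ℝ) + 2 / 3) * ((d : ℝ) + 2 / 3) = 1 := by field_simp
  nlinarith

lemma mul_rateScale_mul_pow_le (hd : 4 ≤ d) (hT : 3 ≤ T) :
    T * rateScale d T * ((2 : ℝ) ^ ((d : ℝ) / 4 - 1)) ^ tunedDepth d T ≤
      2 ^ ((d : ℝ) / 4 - 1) * (T : ℝ) ^ (((d : ℝ) - 1 / 3) / ((d : ℝ) + 2 / 3)) := by
  have h3 : (3 : ℝ) ≤ T := by exact_mod_cast hT
  have hT0 : (0 : ℝ) < T := by linarith
  have hd' : (4 : ℝ) ≤ d := by exact_mod_cast hd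
  have h := pow_tunedDepth_le (show 2 ≤ d by omega) hT (e := (d : ℝ) / 4 - 1) (by linarith)
  have hr := rateScale_pos d hT
  calc _ ≤ T * rateScale d T * (2 ^ ((d : ℝ) / 4 - 1) *
        (T : ℝ) ^ (1 / ((d : ℝ) + 2 / 3) * ((d : ℝ) / 4 - 1))) := by gcongr
    _ = 2 ^ ((d : ℝ) / 4 - 1) * (T * rateScale d T *
        (T : ℝ) ^ (1 / ((d : ℝ) + 2 / 3) * ((d : ℝ) / 4 - 1))) := by ring
    _ ≤ _ := by
      refine mul_le_mul_of_nonneg_left ?_ (by positivity)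
      rw [rateScale_eq (by omega) hT]
      nth_rewrite 1 [← Real.rpow_one (T : ℝ)]
      rw [← Real.rpow_add hT0, ← Real.rpow_add hT0]
      refine Real.rpow_le_rpow_of_exponent_le (by linarith) ?_
      have hpos : 0 < (d : ℝ) + 2 / 3 := by linarith
      rw [le_div_iff₀ hpos]
      have : 1 / ((d : ℝ) + 2 / 3) * ((d : ℝ) + 2 / 3) = 1 := by field_simp
      nlinarith

end large

/-- The factor M^(-1/2) in c_T turns M, M^2 and 1 in the three sums all into √M, which is at most
2√(log T). The extra log T of the root penalty then gives the power 3/2. -/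
lemma tuned_regret_le_of_le_four {d : ℕ} (hd : 2 ≤ d) (hd4 : d ≤ 4) :
    ∃ C : ℝ, ∀ T : ℕ, 3 ≤ T → ∀ (x : ℕ → Ctx d)
    (ℓ : ℕ → unitInterval → unitInterval), (∀ t < T, LipschitzWith 1 (ℓ t)) →
    regret (tuned d T) T x ℓ ≤ C * ((T : ℝ) ^ (((d : ℝ) - 1 / 3) / ((d : ℝ) + 2 / 3)) *
      Real.log T ^ (3 / 2 : ℝ)) := by
  have hd' : (2 : ℝ) ≤ d := by exact_mod_cast hd
  have hd4' : (d : ℝ) ≤ 4 := by exact_mod_cast hd4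
  set p : ℝ := (2 : ℝ) ^ ((d : ℝ) / 4 - 1) with hp
  set E : ℝ := (2 : ℝ) ^ (3 * (d : ℝ) / 4 - 1) with hE
  have hE1 : 1 < E := Real.one_lt_rpow (by norm_num) (by linarith)
  have hE1' : 0 < E - 1 := by linarith
  set c₀ : ℝ := (2 : ℝ) ^ (-(5 / 4) : ℝ) with hc
  have hc0 : 0 < c₀ := by positivity
  have hgm : 0 < 1 - gammaMax d := by linarith [gammaMax_lt_one d]
  refine ⟨3 + 2 / (1 - gammaMax d) * (c₀ * 32) * 2 + c₀ ^ 3 * (256 / (E - 1)) * E * 2 +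
    2 * (2 ^ d / (E - 1) / c₀) * E * 2, fun T hT x ℓ hℓ => ?_⟩
  have hl := one_le_log hT
  have h3 : (3 : ℝ) ≤ T := by exact_mod_cast hT
  have hT0 : (0 : ℝ) < T := by linarith
  have hr := rateScale_pos d hT
  have hM1 : (1 : ℝ) ≤ tunedDepth d T := by exact_mod_cast one_le_tunedDepth d hT
  have hM2 := tunedDepth_le (by omega : 1 ≤ d) hT
  set s := Real.sqrt (tunedDepth d T) with hs
  have hs0 : 0 < s := Real.sqrt_pos.2 (by linarith)
  have hssq : s ^ 2 = tunedDepth d T := Real.sq_sqrt (by linarith)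
  have hcT : tunedC d T = c₀ / s := by
    rw [tunedC, if_neg (by omega), if_pos hd4, hs, Real.sqrt_eq_rpow,
      Real.rpow_neg (by linarith : (0 : ℝ) ≤ tunedDepth d T), ← div_eq_mul_inv]
  have hsums : RateSums d (tunedDepth d T) (tunedC d T * rateScale d T)
      ((2 : ℝ) ^ ((d : ℝ) / 4 + 1)) p _ _ _ :=
    rateSums_of_le_one (one_le_tunedDepth d hT) (mul_pos (tunedC_pos d hT) hr) (by positivity)
      (by positivity) (Real.rpow_le_one_of_one_le_of_nonpos (by norm_num) (by linarith))
      (two_rpow_relations d).1 (two_rpow_relations d).2 hE1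
  have h := tuned_regret_le (by omega : 1 ≤ d) hT x hℓ hsums
  rw [hcT, mul_tunedGamma hd hT, ← hssq] at h
  have f1 := pow_div_rateScale_le hd hT
  have f2 := mul_rateScale_le hd hT
  rw [← hE] at f1
  set G := (T : ℝ) ^ (((d : ℝ) - 1 / 3) / ((d : ℝ) + 2 / 3))
  have hG : 0 < G := by positivity
  set lam := Real.log T
  set u := Real.sqrt lam with hu
  have hu1 : 1 ≤ u := by
    rw [hu, Real.one_le_sqrt]
    exact hl
  have hlam : lam ^ (3 / 2 : ℝ) = u * lam := by
    rw [hu, Real.sqrt_eq_rpow]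
    nth_rewrite 3 [← Real.rpow_one lam]
    rw [← Real.rpow_add (by linarith)]
    norm_num
  have hsu : s ≤ 2 * u := by
    rw [hs, hu, Real.sqrt_le_left (by positivity), mul_pow, Real.sq_sqrt (by linarith)]
    linarith
  have hul : u ≤ u * lam := le_mul_of_one_le_right (by linarith) hl
  set g := rateScale d T
  set F := E ^ tunedDepth d T
  rw [hlam]
  have t1 : 3 * G ≤ 3 * (G * (u * lam)) := by
    have : G * 1 ≤ G * (u * lam) := mul_le_mul_of_nonneg_left (hu1.trans hul) hG.le
    linarith
  have t2 : 2 / (1 - gammaMax d) * (T * g * (c₀ / s * (32 * s ^ 2)) * lam) ≤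
      2 / (1 - gammaMax d) * (c₀ * 32) * 2 * (G * (u * lam)) := by
    calc _ = 2 / (1 - gammaMax d) * (c₀ * 32) * (T * g * (s * lam)) := by field_simp
      _ ≤ 2 / (1 - gammaMax d) * (c₀ * 32) * (G * (2 * u * lam)) := by gcongr
      _ = _ := by ring
  have t3 : (c₀ / s) ^ 3 * (256 / (E - 1) * ((s ^ 2) ^ 2 * F)) / g ≤
      c₀ ^ 3 * (256 / (E - 1)) * E * 2 * (G * (u * lam)) := by
    calc _ = c₀ ^ 3 * (256 / (E - 1)) * (s * (F / g)) := by field_simp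
      _ ≤ c₀ ^ 3 * (256 / (E - 1)) * (2 * (u * lam) * (E * G)) := by
        gcongr
        linarith
      _ = _ := by ring
  have t4 : 2 * (2 ^ d / (E - 1) * F / (c₀ / s * g)) ≤
      2 * (2 ^ d / (E - 1) / c₀) * E * 2 * (G * (u * lam)) := by
    calc _ = 2 * (2 ^ d / (E - 1) / c₀) * (s * (F / g)) := by field_simp
      _ ≤ 2 * (2 ^ d / (E - 1) / c₀) * (2 * (u * lam) * (E * G)) := by
        gcongr
        linarith
      _ = _ := by ring
  linarith

lemma tuned_regret_le_of_four_lt {d : ℕ} (hd : 4 < d) :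
    ∃ C : ℝ, ∀ T : ℕ, 3 ≤ T → ∀ (x : ℕ → Ctx d)
    (ℓ : ℕ → unitInterval → unitInterval), (∀ t < T, LipschitzWith 1 (ℓ t)) →
    regret (tuned d T) T x ℓ ≤ C * ((T : ℝ) ^ (((d : ℝ) - 1 / 3) / ((d : ℝ) + 2 / 3)) *
      Real.log T ^ (3 / 2 : ℝ)) := by
  have hd' : (4 : ℝ) < d := by exact_mod_cast hd
  set p : ℝ := (2 : ℝ) ^ ((d : ℝ) / 4 - 1) with hp
  set h₀ : ℝ := (2 : ℝ) ^ ((d : ℝ) / 4 + 1) with hh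
  set E : ℝ := (2 : ℝ) ^ (3 * (d : ℝ) / 4 - 1) with hE
  have hE1 : 1 < E := Real.one_lt_rpow (by norm_num) (by linarith)
  have hp1 : 1 < p := Real.one_lt_rpow (by norm_num) (by linarith)
  have hh1 : 1 < h₀ := Real.one_lt_rpow (by norm_num) (by linarith)
  have hE1' : 0 < E - 1 := by linarith
  have hp1' : 0 < p - 1 := by linarith
  have hh1' : 0 < h₀ - 1 := by linarith
  set c : ℝ := (2 : ℝ) ^ ((d : ℝ) / 4 - 3) with hc
  have hc0 : 0 < c := by positivity
  have hgm : 0 < 1 - gammaMax d := by linarith [gammaMax_lt_one d]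
  refine ⟨3 + 2 / (1 - gammaMax d) * (c * (16 * (p / (p - 1)))) * p +
    c ^ 3 * (256 * (p / (p - 1)) ^ 2 / (h₀ - 1)) * E + 2 * (2 ^ d / (E - 1) / c) * E,
    fun T hT x ℓ hℓ => ?_⟩
  have hl := one_le_log hT
  have h3 : (3 : ℝ) ≤ T := by exact_mod_cast hT
  have hT0 : (0 : ℝ) < T := by linarith
  have hr := rateScale_pos d hT
  have hcT : tunedC d T = c := by
    rw [tunedC, if_neg (by omega), if_neg (by omega)]
  have hsums : RateSums d (tunedDepth d T) (tunedC d T * rateScale d T) h₀ p _ _ _ :=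
    rateSums_of_one_lt (mul_pos (tunedC_pos d hT) hr) hh1 hp1
      (two_rpow_relations d).1 (two_rpow_relations d).2
  have h := tuned_regret_le (by omega : 1 ≤ d) hT x hℓ hsums
  rw [hcT, mul_tunedGamma (by omega) hT] at h
  have f1 := pow_div_rateScale_le (by omega : 2 ≤ d) hT
  have f2 := mul_rateScale_mul_pow_le (by omega : 4 ≤ d) hT
  rw [← hE] at f1
  rw [← hp] at f2
  set G := (T : ℝ) ^ (((d : ℝ) - 1 / 3) / ((d : ℝ) + 2 / 3))
  have hG : 0 < G := by positivity
  set lam := Real.log T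
  have hlam : lam ≤ lam ^ (3 / 2 : ℝ) := by
    nth_rewrite 1 [← Real.rpow_one lam]
    exact Real.rpow_le_rpow_of_exponent_le hl (by norm_num)
  set g := rateScale d T
  set F := E ^ tunedDepth d T
  set Q := p ^ tunedDepth d T
  set Λ := lam ^ (3 / 2 : ℝ)
  have hΛ1 : 1 ≤ Λ := hl.trans hlam
  have hGΛ : G ≤ G * Λ := le_mul_of_one_le_right hG.le hΛ1
  have t1 : 3 * G ≤ 3 * (G * Λ) := by linarith
  have t2 : 2 / (1 - gammaMax d) * (T * g * (c * (16 * (p / (p - 1)) * Q)) * lam) ≤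
      2 / (1 - gammaMax d) * (c * (16 * (p / (p - 1)))) * p * (G * Λ) := by
    calc _ = 2 / (1 - gammaMax d) * (c * (16 * (p / (p - 1)))) * (T * g * Q * lam) := by ring
      _ ≤ 2 / (1 - gammaMax d) * (c * (16 * (p / (p - 1)))) * (p * G * Λ) := by gcongr
      _ = _ := by ring
  have t3 : c ^ 3 * (256 * (p / (p - 1)) ^ 2 / (h₀ - 1) * F) / g ≤
      c ^ 3 * (256 * (p / (p - 1)) ^ 2 / (h₀ - 1)) * E * (G * Λ) := by
    calc _ = c ^ 3 * (256 * (p / (p - 1)) ^ 2 / (h₀ - 1)) * (F / g) := by ring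
      _ ≤ c ^ 3 * (256 * (p / (p - 1)) ^ 2 / (h₀ - 1)) * (E * (G * Λ)) := by
        gcongr
        refine f1.trans ?_
        gcongr
      _ = _ := by ring
  have t4 : 2 * (2 ^ d / (E - 1) * F / (c * g)) ≤
      2 * (2 ^ d / (E - 1) / c) * E * (G * Λ) := by
    calc _ = 2 * (2 ^ d / (E - 1) / c) * (F / g) := by field_simp
      _ ≤ 2 * (2 ^ d / (E - 1) / c) * (E * (G * Λ)) := by
        gcongr
        refine f1.trans ?_
        gcongr
      _ = _ := by ring
  linarith

lemma exists_tuned_regret_le {d : ℕ} (hd : 1 ≤ d) : ∃ C : ℝ, ∀ T : ℕ, 3 ≤ T →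
    ∀ (x : ℕ → Ctx d) (ℓ : ℕ → unitInterval → unitInterval),
      (∀ t < T, LipschitzWith 1 (ℓ t)) →
      regret (tuned d T) T x ℓ ≤
        if d = 1 then C * Real.sqrt ((T : ℝ) * Real.log T)
        else C * ((T : ℝ) ^ (((d : ℝ) - 1 / 3) / ((d : ℝ) + 2 / 3)) *
          Real.log T ^ (3 / 2 : ℝ)) := by
  rcases eq_or_ne d 1 with rfl | h1
  · simpa using tuned_regret_le_of_eq_one
  · simp only [if_neg h1]
    rcases le_or_gt d 4 with h4 | h4
    · exact tuned_regret_le_of_le_four (by omega) h4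
    · exact tuned_regret_le_of_four_lt h4

end regret

/-! ### Reasoning about machine programs -/

/-- Final memory of a program. -/
noncomputable def Prog.run (o : ℝ → ℝ) (p : Prog) (μ : Mem) : Mem := (p.exec o μ).1

/-- Arrays of natural numbers that a program may write to. -/
def Prog.natOut : Prog → List ℕ
  | .skip => []
  | .setNat a _ _ => [a]
  | .setReal _ _ _ => []
  | .seq p q => p.natOut ++ q.natOut
  | .ite _ p q => p.natOut ++ q.natOut
  | .loop a _ p => a :: p.natOut

/-- Arrays of real numbers that a program may write to. -/
def Prog.realOut : Prog → List ℕ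
  | .skip => []
  | .setNat _ _ _ => []
  | .setReal a _ _ => [a]
  | .seq p q => p.realOut ++ q.realOut
  | .ite _ p q => p.realOut ++ q.realOut
  | .loop _ _ p => p.realOut

/-- Two memories that differ only in arrays that the program may write to. -/
structure Prog.Agree (p : Prog) (μ ν : Mem) : Prop where
  nat : ∀ b, b ∉ p.natOut → ν.nat b = μ.nat b
  real : ∀ b, b ∉ p.realOut → ν.real b = μ.real b

section run

variable {o : ℝ → ℝ}

@[simp] lemma setNat_nat (μ : Mem) (a i n b j : ℕ) :
    (μ.setNat a i n).nat b j = if b = a ∧ j = i then n else μ.nat b j := rfl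

@[simp] lemma setNat_real (μ : Mem) (a i n : ℕ) : (μ.setNat a i n).real = μ.real := rfl

@[simp] lemma setReal_nat (μ : Mem) (a i : ℕ) (r : ℝ) : (μ.setReal a i r).nat = μ.nat := rfl

@[simp] lemma setReal_real (μ : Mem) (a i : ℕ) (r : ℝ) (b j : ℕ) :
    (μ.setReal a i r).real b j = if b = a ∧ j = i then r else μ.real b j := rfl

@[simp] lemma run_skip (μ : Mem) : Prog.skip.run o μ = μ := rfl

@[simp] lemma run_setNat (a : ℕ) (i e : NatExpr) (μ : Mem) :
    (Prog.setNat a i e).run o μ = μ.setNat a (i.eval μ) (e.eval μ) := rfl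

@[simp] lemma run_setReal (a : ℕ) (i : NatExpr) (e : RealExpr) (μ : Mem) :
    (Prog.setReal a i e).run o μ = μ.setReal a (i.eval μ) (e.eval o μ) := rfl

@[simp] lemma run_seq (p q : Prog) (μ : Mem) : (p.seq q).run o μ = q.run o (p.run o μ) := rfl

lemma run_ite_pos {b : Test} {p q : Prog} {μ : Mem} (h : b.Holds o μ) :
    (Prog.ite b p q).run o μ = p.run o μ := by
  rw [Prog.run, Prog.exec, if_pos h]
  rfl

lemma run_ite_neg {b : Test} {p q : Prog} {μ : Mem} (h : ¬b.Holds o μ) :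
    (Prog.ite b p q).run o μ = q.run o μ := by
  rw [Prog.run, Prog.exec, if_neg h]
  rfl

lemma run_loop (a : ℕ) (n : NatExpr) (p : Prog) (μ : Mem) :
    (Prog.loop a n p).run o μ =
      (iter (fun k ν => p.exec o (ν.setNat a 0 k)) (n.eval μ) μ).1 := rfl

lemma agree_setNat_trans {p : Prog} {μ ν : Mem} {a : ℕ} (ha : a ∈ p.natOut) (h : p.Agree μ ν)
    (i n : ℕ) : p.Agree μ (ν.setNat a i n) where
  nat b hb := by
    rw [← h.nat b hb]
    funext j
    rw [setNat_nat, if_neg]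
    rintro ⟨rfl, -⟩
    exact hb ha
  real b hb := h.real b hb

lemma iter_agree {a : ℕ} {n : NatExpr} {p : Prog} (hp : ∀ μ, p.Agree μ (p.run o μ)) (μ : Mem)
    (k : ℕ) : (Prog.loop a n p).Agree μ (iter (fun k ν => p.exec o (ν.setNat a 0 k)) k μ).1 := by
  induction k with
  | zero => exact ⟨fun _ _ => rfl, fun _ _ => rfl⟩
  | succ k ih =>
    have h1 := agree_setNat_trans (a := a) (by simp [Prog.natOut]) ih 0 k
    have h2 := hp ((iter (fun k ν => p.exec o (ν.setNat a 0 k)) k μ).1.setNat a 0 k)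
    refine ⟨fun b hb => ?_, fun b hb => ?_⟩
    · exact (h2.nat b fun h => hb (by simp [Prog.natOut, h])).trans (h1.nat b hb)
    · exact (h2.real b hb).trans (h1.real b hb)

/-- Frame rule: indices are dynamic, but the arrays written to are visible in the program text.
Facts about other arrays therefore survive by a mere membership check. -/
lemma agree_run (p : Prog) (μ : Mem) : p.Agree μ (p.run o μ) := by
  induction p generalizing μ with
  | skip => exact ⟨fun _ _ => rfl, fun _ _ => rfl⟩
  | setNat a i e =>
    refine ⟨fun b hb => ?_, fun _ _ => rfl⟩
    have : b ≠ a := fun h => hb (by simp [Prog.natOut, h])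
    funext j
    simp [this]
  | setReal a i e =>
    refine ⟨fun _ _ => rfl, fun b hb => ?_⟩
    have : b ≠ a := fun h => hb (by simp [Prog.realOut, h])
    funext j
    simp [this]
  | seq p q hp hq =>
    refine ⟨fun b hb => ?_, fun b hb => ?_⟩
    · simp only [Prog.natOut, List.mem_append, not_or] at hb
      exact ((hq _).nat b hb.2).trans ((hp μ).nat b hb.1)
    · simp only [Prog.realOut, List.mem_append, not_or] at hb
      exact ((hq _).real b hb.2).trans ((hp μ).real b hb.1)
  | ite t p q hp hq =>
    refine ⟨fun b hb => ?_, fun b hb => ?_⟩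
    · simp only [Prog.natOut, List.mem_append, not_or] at hb
      by_cases h : t.Holds o μ
      · rw [run_ite_pos h, (hp μ).nat b hb.1]
      · rw [run_ite_neg h, (hq μ).nat b hb.2]
    · simp only [Prog.realOut, List.mem_append, not_or] at hb
      by_cases h : t.Holds o μ
      · rw [run_ite_pos h, (hp μ).real b hb.1]
      · rw [run_ite_neg h, (hq μ).real b hb.2]
  | loop a n p hp => exact iter_agree hp μ _

/-- Induction rule for loops. -/
lemma loop_induct {a : ℕ} {n : NatExpr} {p : Prog} {μ : Mem} (Inv : ℕ → Mem → Prop)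
    (h0 : Inv 0 μ)
    (hs : ∀ k < n.eval μ, ∀ ν, (Prog.loop a n p).Agree μ ν → Inv k ν →
      Inv (k + 1) (p.run o (ν.setNat a 0 k))) :
    Inv (n.eval μ) ((Prog.loop a n p).run o μ) := by
  rw [run_loop]
  suffices H : ∀ k ≤ n.eval μ, Inv k (iter (fun k ν => p.exec o (ν.setNat a 0 k)) k μ).1 from
    H _ le_rfl
  intro k hk
  induction k with
  | zero => exact h0
  | succ k ih => exact hs k (by omega) _ (iter_agree (agree_run p) μ k) (ih (by omega))

end run

/-! ### Running times -/

/-- Arrays that a natural number expression reads from. -/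
def NatExpr.arrays : NatExpr → List ℕ
  | .const _ => []
  | .get a i => a :: i.arrays
  | .add e f => e.arrays ++ f.arrays
  | .sub e f => e.arrays ++ f.arrays

/-- Arrays that determine how often the loops of a program are run. -/
def Prog.boundArrays : Prog → List ℕ
  | .skip => []
  | .setNat _ _ _ => []
  | .setReal _ _ _ => []
  | .seq p q => p.boundArrays ++ q.boundArrays
  | .ite _ p q => p.boundArrays ++ q.boundArrays
  | .loop _ n p => n.arrays ++ p.boundArrays

/-- Running time when every loop is run once. -/
def Prog.size : Prog → ℕ
  | .skip => 1
  | .setNat _ i e => i.cost + e.cost + 1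
  | .setReal _ i e => i.cost + e.cost + 1
  | .seq p q => p.size + q.size
  | .ite b p q => b.cost + p.size + q.size
  | .loop _ n p => n.cost + 1 + (p.size + 1)

/-- The largest product of the numbers of iterations of nested loops. -/
def Prog.growth (μ : Mem) : Prog → ℕ
  | .skip => 1
  | .setNat _ _ _ => 1
  | .setReal _ _ _ => 1
  | .seq p q => max (p.growth μ) (q.growth μ)
  | .ite _ p q => max (p.growth μ) (q.growth μ)
  | .loop _ n p => max 1 (n.eval μ) * p.growth μ

lemma NatExpr.eval_congr {e : NatExpr} {μ ν : Mem} (h : ∀ b ∈ e.arrays, ν.nat b = μ.nat b) :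
    e.eval ν = e.eval μ := by
  induction e with
  | const n => rfl
  | get a i ih =>
    simp only [NatExpr.arrays, List.mem_cons, forall_eq_or_imp] at h
    simp only [NatExpr.eval, ih h.2, h.1]
  | add e f he hf =>
    simp only [NatExpr.arrays, List.mem_append] at h
    simp only [NatExpr.eval, he fun b hb => h b (Or.inl hb), hf fun b hb => h b (Or.inr hb)]
  | sub e f he hf =>
    simp only [NatExpr.arrays, List.mem_append] at h
    simp only [NatExpr.eval, he fun b hb => h b (Or.inl hb), hf fun b hb => h b (Or.inr hb)]

lemma Prog.one_le_growth (μ : Mem) (p : Prog) : 1 ≤ p.growth μ := by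
  induction p with
  | skip => exact le_rfl
  | setNat => exact le_rfl
  | setReal => exact le_rfl
  | seq p q hp hq => exact le_max_of_le_left hp
  | ite t p q hp hq => exact le_max_of_le_left hp
  | loop a n p hp => exact Nat.one_le_iff_ne_zero.2 (mul_ne_zero (by omega) (by omega))

/-- The running time of a program that does not change its own loop bounds. -/
lemma Prog.time_le (o : ℝ → ℝ) (p : Prog) (B : List ℕ) (hB : ∀ b ∈ p.boundArrays, b ∈ B)
    (hout : ∀ b ∈ p.natOut, b ∉ B) (μ₀ μ : Mem) (hμ : ∀ b ∈ B, μ.nat b = μ₀.nat b) :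
    (p.exec o μ).2 ≤ p.size * p.growth μ₀ := by
  induction p generalizing μ with
  | skip => exact le_rfl
  | setNat a i e => simp [Prog.exec, Prog.size, Prog.growth]
  | setReal a i e => simp [Prog.exec, Prog.size, Prog.growth]
  | seq p q hp hq =>
    simp only [Prog.boundArrays, Prog.natOut, List.mem_append] at hB hout
    have h1 := hp (fun b hb => hB b (Or.inl hb)) (fun b hb => hout b (Or.inl hb)) μ hμ
    have h2 := hq (fun b hb => hB b (Or.inr hb)) (fun b hb => hout b (Or.inr hb)) (p.run o μ)
      fun b hb => ((agree_run p μ).nat b fun h => hout b (Or.inl h) hb).trans (hμ b hb)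
    calc _ = (p.exec o μ).2 + (q.exec o (p.run o μ)).2 := rfl
      _ ≤ p.size * max (p.growth μ₀) (q.growth μ₀) + q.size * max (p.growth μ₀) (q.growth μ₀) :=
        add_le_add (h1.trans (Nat.mul_le_mul_left _ (le_max_left _ _)))
          (h2.trans (Nat.mul_le_mul_left _ (le_max_right _ _)))
      _ = _ := by rw [← Nat.add_mul]; rfl
  | ite t p q hp hq =>
    simp only [Prog.boundArrays, Prog.natOut, List.mem_append] at hB hout
    have h1 := hp (fun b hb => hB b (Or.inl hb)) (fun b hb => hout b (Or.inl hb)) μ hμ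
    have h2 := hq (fun b hb => hB b (Or.inr hb)) (fun b hb => hout b (Or.inr hb)) μ hμ
    have h3 := h1.trans (Nat.mul_le_mul_left p.size (le_max_left _ (q.growth μ₀)))
    have h4 := h2.trans (Nat.mul_le_mul_left q.size (le_max_right (p.growth μ₀) _))
    have h5 : 1 ≤ max (p.growth μ₀) (q.growth μ₀) := le_max_of_le_left (p.one_le_growth μ₀)
    have h6 : t.cost ≤ t.cost * max (p.growth μ₀) (q.growth μ₀) := Nat.le_mul_of_pos_right _ h5
    simp only [Prog.exec, Prog.size, Prog.growth, Nat.add_mul]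
    split_ifs
    · simp only
      omega
    · simp only
      omega
  | loop a n p hp =>
    simp only [Prog.boundArrays, Prog.natOut, List.mem_append, List.mem_cons] at hB hout
    have hn : n.eval μ = n.eval μ₀ :=
      NatExpr.eval_congr fun b hb => hμ b (hB b (Or.inl hb))
    have key : ∀ k, (iter (fun k ν => p.exec o (ν.setNat a 0 k)) k μ).2 ≤
        k * (p.size * p.growth μ₀ + 1) := by
      intro k
      induction k with
      | zero => simp [iter]
      | succ k ih =>
        have h1 := hp (fun b hb => hB b (Or.inr hb)) (fun b hb => hout b (Or.inr hb))
          ((iter (fun k ν => p.exec o (ν.setNat a 0 k)) k μ).1.setNat a 0 k) (by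
            intro b hb
            have hag := agree_setNat_trans (a := a) (by simp [Prog.natOut])
              (iter_agree (a := a) (n := n) (agree_run (o := o) p) μ k) 0 k
            refine (hag.nat b fun h => hout b ?_ hb).trans (hμ b hb)
            simpa [Prog.natOut] using h)
        rw [iter, Nat.succ_mul]
        simp only
        omega
    have h1 := key (n.eval μ)
    have h2 := p.one_le_growth μ₀
    simp only [Prog.exec, Prog.size, Prog.growth]
    rw [hn] at h1 ⊢
    -- The maximum with 1 leaves room for the cost of evaluating the bound of a loop that is run
    -- zero times.
    set X := max 1 (n.eval μ₀) with hX
    have h3 : n.eval μ₀ * (p.size * p.growth μ₀ + 1) ≤ X * (p.size * p.growth μ₀ + p.growth μ₀) :=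
      Nat.mul_le_mul (le_max_right _ _) (by omega)
    have h4 : 1 ≤ X * p.growth μ₀ :=
      Nat.one_le_iff_ne_zero.2 (mul_ne_zero (by omega) (by omega))
    have h5 : n.cost + 1 ≤ (n.cost + 1) * (X * p.growth μ₀) := Nat.le_mul_of_pos_right _ h4
    calc _ ≤ (n.cost + 1) * (X * p.growth μ₀) + X * (p.size * p.growth μ₀ + p.growth μ₀) := by
          omega
      _ = _ := by ring

/-! ### Enumeration of the active nodes and codes of nodes -/

/-- Binary number formed by the first `j` entries of `s`. -/
def subcubeIndex {d : ℕ} (s : Subcube d) : ℕ → ℕ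
  | 0 => 0
  | j + 1 => 2 * subcubeIndex s j + if h : j < d then (if s ⟨j, h⟩ then 1 else 0) else 0

lemma subcubeIndex_lt {d : ℕ} (s : Subcube d) (j : ℕ) : subcubeIndex s j < 2 ^ j := by
  induction j with
  | zero => simp [subcubeIndex]
  | succ j ih =>
    rw [subcubeIndex, pow_succ]
    split_ifs <;> omega

lemma subcubeIndex_inj {d : ℕ} {s s' : Subcube d} {j : ℕ} (hj : j ≤ d)
    (h : subcubeIndex s j = subcubeIndex s' j) (i : Fin d) (hi : i.val < j) : s i = s' i := by
  induction j with
  | zero => omega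
  | succ j ih =>
    have hjd : j < d := by omega
    rw [subcubeIndex, subcubeIndex, dif_pos hjd, dif_pos hjd] at h
    have h1 : subcubeIndex s j = subcubeIndex s' j ∧ s ⟨j, hjd⟩ = s' ⟨j, hjd⟩ := by
      cases h2 : s ⟨j, hjd⟩ <;> cases h3 : s' ⟨j, hjd⟩ <;> simp [h2, h3] at h ⊢ <;> omega
    rcases Nat.lt_succ_iff_lt_or_eq.1 hi with hi | hi
    · exact ih (by omega) h1.1 hi
    · have : i = ⟨j, hjd⟩ := Fin.ext hi
      rw [this]
      exact h1.2

/-- The three coefficients in increasing order. -/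
def coeff : ℕ → SignType
  | 0 => -1
  | 1 => 0
  | _ + 2 => 1

/-- Position of a coefficient. -/
def coeffIndex (c : SignType) : ℕ := if c = -1 then 0 else if c = 0 then 1 else 2

lemma coeffIndex_lt (c : SignType) : coeffIndex c < 3 := by cases c <;> decide

lemma coeff_coeffIndex (c : SignType) : coeff (coeffIndex c) = c := by cases c <;> decide

lemma coeffIndex_coeff {i : ℕ} (hi : i < 3) : coeffIndex (coeff i) = i := by
  interval_cases i <;> decide

lemma coeff_cast {i : ℕ} (hi : i < 3) : (SignType.cast (coeff i) : ℝ) = (i : ℝ) - 1 := by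
  interval_cases i <;> norm_num [coeff]

lemma sum_signType {β : Type*} [AddCommMonoid β] (f : SignType → β) :
    ∑ c, f c = f (coeff 0) + f (coeff 1) + f (coeff 2) := by
  have : (Finset.univ : Finset SignType) = {coeff 0, coeff 1, coeff 2} := by decide
  rw [this, Finset.sum_insert (by decide), Finset.sum_insert (by decide), Finset.sum_singleton,
    add_assoc]

/-- Injective numbering of the nodes at integer depths. -/
def code {d : ℕ} (v : BinNode d) : ℕ :=
  v.foldl (fun n a => 3 * 2 ^ d * n + (3 * subcubeIndex a.1 d + coeffIndex a.2 + 1)) 0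

lemma code_nil {d : ℕ} : code ([] : BinNode d) = 0 := rfl

lemma code_child {d : ℕ} (w : ExpNode d) (c : SignType) :
    code (child w c) =
      3 * 2 ^ d * code w.1 + (3 * subcubeIndex w.2 d + coeffIndex c + 1) := by
  simp [code, child]

lemma code_append {d : ℕ} (v : BinNode d) (a : Subcube d × SignType) :
    code (v ++ [a]) = 3 * 2 ^ d * code v + (3 * subcubeIndex a.1 d + coeffIndex a.2 + 1) :=
  code_child (v, a.1) a.2

/-- Numeration in base B = 3·2^d with digits 1, …, B. Without a digit 0, lists of different lengths
cannot collide, and removing 1 from the last digit reduces its recovery to division with remainder.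
-/
lemma code_injective {d : ℕ} : Function.Injective (code : BinNode d → ℕ) := by
  intro v
  induction v using List.reverseRecOn with
  | nil =>
    intro v' h
    induction v' using List.reverseRecOn with
    | nil => rfl
    | append_singleton v' a' _ =>
      rw [code_append, code_nil] at h
      omega
  | append_singleton v a ih =>
    intro v' h
    induction v' using List.reverseRecOn with
    | nil =>
      rw [code_append, code_nil] at h
      omega
    | append_singleton v' a' _ =>
      rw [code_append, code_append] at h
      have h1 := subcubeIndex_lt a.1 d
      have h2 := subcubeIndex_lt a'.1 d
      have h3 := coeffIndex_lt a.2
      have h4 := coeffIndex_lt a'.2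
      have h5 : 3 * 2 ^ d * code v + (3 * subcubeIndex a.1 d + coeffIndex a.2) =
          3 * 2 ^ d * code v' + (3 * subcubeIndex a'.1 d + coeffIndex a'.2) := by omega
      have hB : 0 < 3 * 2 ^ d := by positivity
      have h6 := congrArg (· / (3 * 2 ^ d)) h5
      rw [Nat.mul_add_div hB, Nat.mul_add_div hB, Nat.div_eq_of_lt (by omega),
        Nat.div_eq_of_lt (by omega), add_zero, add_zero] at h6
      rw [h6] at h5
      have h7 := Nat.add_left_cancel h5
      have h8 : subcubeIndex a.1 d = subcubeIndex a'.1 d := by omega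
      have h9 : coeffIndex a.2 = coeffIndex a'.2 := by omega
      have h10 : a.2 = a'.2 := by rw [← coeff_coeffIndex a.2, h9, coeff_coeffIndex]
      have h11 : a.1 = a'.1 := funext fun i => subcubeIndex_inj le_rfl h8 i i.2
      rw [ih h6, Prod.ext h11 h10]

/-- The active nodes at integer depths, in heap order: the children of the node with number `n` have
the numbers `3 * n + 1`, `3 * n + 2` and `3 * n + 3`. -/
noncomputable def treeNode {d : ℕ} (x : Ctx d) : ℕ → BinNode d
  | 0 => []
  | k + 1 => child (activeExp x (treeNode x (k / 3))) (coeff (k % 3))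
decreasing_by omega

lemma treeNode_zero {d : ℕ} (x : Ctx d) : treeNode x 0 = [] := by rw [treeNode]

lemma treeNode_succ {d : ℕ} (x : Ctx d) (k : ℕ) :
    treeNode x (k + 1) = child (activeExp x (treeNode x (k / 3))) (coeff (k % 3)) := by
  rw [treeNode]

lemma treeNode_child {d : ℕ} (x : Ctx d) (n : ℕ) {c : ℕ} (hc : c < 3) :
    treeNode x (3 * n + c + 1) = child (activeExp x (treeNode x n)) (coeff c) := by
  rw [treeNode_succ, show (3 * n + c) / 3 = n by omega, show (3 * n + c) % 3 = c by omega]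

lemma active_treeNode {d : ℕ} (x : Ctx d) (j : ℕ) : Active x (treeNode x j) := by
  induction j using Nat.strong_induction_on with
  | _ j ih =>
    rcases j with _ | k
    · rw [treeNode_zero]
      exact active_nil x
    · rw [treeNode_succ]
      exact active_child (mem_cubeOf_activeExp (ih _ (by omega))) _

lemma length_treeNode_succ {d : ℕ} (x : Ctx d) (k : ℕ) :
    (treeNode x (k + 1)).length = (treeNode x (k / 3)).length + 1 := by
  rw [treeNode_succ, length_child]
  rfl

/-- Number of nodes of depth less than `m` in a ternary tree. -/
def internalCount : ℕ → ℕ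
  | 0 => 0
  | m + 1 => 3 * internalCount m + 1

lemma two_mul_internalCount (m : ℕ) : 2 * internalCount m + 1 = 3 ^ m := by
  induction m with
  | zero => rfl
  | succ m ih =>
    rw [internalCount, pow_succ]
    omega

/-- Heap order lists the nodes by depth, so depth is read off from the number. With S =
`internalCount M`, the internal nodes are those below S and the leaves are S, …, 3S. -/
lemma length_treeNode_lt_iff {d : ℕ} (x : Ctx d) (m j : ℕ) :
    (treeNode x j).length < m ↔ j < internalCount m := by
  induction m generalizing j with
  | zero => simp [internalCount]
  | succ m ih =>
    rcases j with _ | k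
    · simp [treeNode_zero, internalCount]
    · rw [length_treeNode_succ, internalCount]
      have := ih (k / 3)
      omega

lemma treeNode_injective {d : ℕ} (x : Ctx d) : Function.Injective (treeNode x) := by
  intro j
  induction j using Nat.strong_induction_on with
  | _ j ih =>
    intro j' h
    rcases j with _ | k <;> rcases j' with _ | k'
    · rfl
    · have := congrArg List.length h
      rw [length_treeNode_succ, treeNode_zero] at this
      simp at this
    · have := congrArg List.length h
      rw [length_treeNode_succ, treeNode_zero] at this
      simp at this
    · rw [treeNode_succ, treeNode_succ, child, child] at h
      obtain ⟨h1, h2⟩ := List.append_inj' h rfl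
      have h3 := ih (k / 3) (by omega) h1
      have h4 : coeff (k % 3) = coeff (k' % 3) := by simpa using (congrArg (List.map Prod.snd) h2)
      have h5 := congrArg coeffIndex h4
      rw [coeffIndex_coeff (by omega), coeffIndex_coeff (by omega)] at h5
      omega

/-- The halvings along an active node are forced by the context, so only its coefficients, the
ternary digits of the heap number, remain free. -/
lemma exists_treeNode {d : ℕ} {x : Ctx d} {v : BinNode d} (hv : Active x v) :
    ∃ j, treeNode x j = v := by
  induction v using List.reverseRecOn with
  | nil => exact ⟨0, treeNode_zero x⟩
  | append_singleton v a ih =>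
    rw [Active, List.map_append, List.length_append, List.length_singleton, addr] at hv
    obtain ⟨h1, h2⟩ := List.append_inj' hv rfl
    obtain ⟨n, hn⟩ := ih h1
    refine ⟨3 * n + coeffIndex a.2 + 1, ?_⟩
    have h3 : a.1 = bits x v.length := by simpa using h2
    rw [treeNode_child x n (coeffIndex_lt _), coeff_coeffIndex, hn, child, activeExp, ← h3]

/-! ### The program -/

/-- Entry `0` of an array. -/
abbrev NatExpr.cell (a : ℕ) : NatExpr := .get a (.const 0)

/-- Entry `0` of an array. -/
abbrev RealExpr.cell (a : ℕ) : RealExpr := .get a (.const 0)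

/-- Successor. -/
abbrev NatExpr.succ (e : NatExpr) : NatExpr := .add e (.const 1)

/-- Three times an expression, plus a constant. -/
abbrev NatExpr.triple (e : NatExpr) (c : ℕ) : NatExpr := .add (.add (.add e e) e) (.const c)

/-- Product with a constant. -/
def NatExpr.mulConst : ℕ → NatExpr → NatExpr
  | 0, _ => .const 0
  | k + 1, e => .add (NatExpr.mulConst k e) e

@[simp] lemma NatExpr.eval_mulConst (k : ℕ) (e : NatExpr) (μ : Mem) :
    (NatExpr.mulConst k e).eval μ = k * e.eval μ := by
  induction k with
  | zero => simp [NatExpr.mulConst, NatExpr.eval]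
  | succ k ih => rw [NatExpr.mulConst, NatExpr.eval, ih, Nat.succ_mul]

/-! Memory layout. Natural arrays: `0` depth `M` of the tree, `1` action, `2` number `N = 2 ^ M` of
actions, `3` number `S` of internal active nodes, `4` and `5` loop counters, `6` halving containing
the context at every depth, `7` parent, `8` depth and `9` code of the active nodes, `10` and `11`
parent and coefficient of the node being constructed, `12` largest supported action.
Real arrays: `0` `γ`, `1` `η`, `2` `α`, `3` relative position of the context, `4` random number,
`5` cumulative losses (indexed by codes), `6` widths `2 ^ (-m)`, `7` labels, `8` unnormalized and
`9` normalized weights, `10` probabilities of the current action, `11` cumulative distribution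
function, `12` estimated losses of the round, `13` auxiliary cell. -/

/-- Doubles the `j`-th relative position and records the leading bit. -/
def bitProg : Prog :=
  .seq (.setNat 6 (.cell 4) (.add (.get 6 (.cell 4)) (.get 6 (.cell 4)))) <|
  .seq (.setReal 3 (.cell 5) (.add (.get 3 (.cell 5)) (.get 3 (.cell 5)))) <|
  .ite (.realLt (.get 3 (.cell 5)) (.const 1)) .skip <|
  .seq (.setReal 3 (.cell 5) (.sub (.get 3 (.cell 5)) (.const 1)))
    (.setNat 6 (.cell 4) (.succ (.get 6 (.cell 4))))

/-- Processes one level of the tree. -/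
def levelProg (d : ℕ) : Prog :=
  .seq (.setNat 2 (.const 0) (.add (.cell 2) (.cell 2))) <|
  .seq (.setNat 3 (.const 0) (.triple (.cell 3) 1)) <|
  .seq (.setReal 6 (.succ (.cell 4)) (.div (.get 6 (.cell 4)) (.const 2))) <|
  .seq (.setNat 6 (.cell 4) (.const 0))
    (.loop 5 (.const d) bitProg)

/-- Computes the sizes of the tree, the widths of the cubes and the halvings of the context. -/
def levelsProg (d : ℕ) : Prog :=
  .seq (.setNat 2 (.const 0) (.const 1)) <|
  .seq (.setNat 3 (.const 0) (.const 0)) <|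
  .seq (.setReal 6 (.const 0) (.const 1))
    (.loop 4 (.cell 0) (levelProg d))

/-- Constructs one active node. -/
def nodeProg (d : ℕ) : Prog :=
  .seq (.setNat 7 (.succ (.cell 4)) (.cell 10)) <|
  .seq (.setNat 8 (.succ (.cell 4)) (.succ (.get 8 (.cell 10)))) <|
  .seq (.setNat 9 (.succ (.cell 4)) (.add (.mulConst (3 * 2 ^ d) (.get 9 (.cell 10)))
    (.succ (.add (.mulConst 3 (.get 6 (.get 8 (.cell 10)))) (.cell 11))))) <|
  .seq (.setReal 7 (.succ (.cell 4)) (.add (.get 7 (.cell 10))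
    (.mul (.sub (.ofNat (.cell 11)) (.const 1)) (.get 6 (.succ (.get 8 (.cell 10))))))) <|
  .ite (.natLt (.cell 11) (.const 2))
    (.setNat 11 (.const 0) (.succ (.cell 11)))
    (.seq (.setNat 11 (.const 0) (.const 0)) (.setNat 10 (.const 0) (.succ (.cell 10))))

/-- Constructs all active nodes. -/
def treeProg (d : ℕ) : Prog :=
  .seq (.setNat 8 (.const 0) (.const 0)) <|
  .seq (.setNat 9 (.const 0) (.const 0)) <|
  .seq (.setReal 7 (.const 0) (.const (1 / 2))) <|
  .seq (.setNat 10 (.const 0) (.const 0)) <|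
  .seq (.setNat 11 (.const 0) (.const 0))
    (.loop 4 (.triple (.cell 3) 0) (nodeProg d))

/-- Unnormalized weight of one active node. -/
def expProg : Prog :=
  .setReal 8 (.succ (.cell 4)) (.exp (.sub (.const 0)
    (.mul (.get 1 (.get 8 (.get 7 (.succ (.cell 4))))) (.get 5 (.get 9 (.succ (.cell 4)))))))

/-- Normalized weight of one active node. -/
def normProg : Prog :=
  .setReal 9 (.succ (.cell 4)) (.div (.get 8 (.succ (.cell 4)))
    (.add (.add (.get 8 (.triple (.get 7 (.succ (.cell 4))) 1))
      (.get 8 (.triple (.get 7 (.succ (.cell 4))) 2)))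
      (.get 8 (.triple (.get 7 (.succ (.cell 4))) 3))))

/-- Weights of all active nodes. -/
def weightsProg : Prog :=
  .seq (.loop 4 (.triple (.cell 3) 0) expProg) (.loop 4 (.triple (.cell 3) 0) normProg)

/-- The action considered by the current step of the outer loop, as a point of the interval. -/
def pointExpr : RealExpr := .div (.ofNat (.succ (.cell 4))) (.ofNat (.cell 2))

/-- Probability of the current action at one leaf. -/
def leafProg : Prog :=
  .seq (.setReal 10 (.add (.cell 3) (.cell 5)) (.const 0)) <|
  .seq (.setReal 13 (.const 0) (.get 7 (.add (.cell 3) (.cell 5)))) <|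
  .seq (.ite (.realLt (.cell 13) (.div (.const 1) (.ofNat (.cell 2))))
    (.setReal 13 (.const 0) (.div (.const 1) (.ofNat (.cell 2)))) .skip) <|
  .seq (.ite (.realLt (.const 1) (.cell 13)) (.setReal 13 (.const 0) (.const 1)) .skip) <|
  .ite (.realLt pointExpr (.cell 13)) .skip <|
  .ite (.realLt (.cell 13) pointExpr) .skip <|
  .setReal 10 (.add (.cell 3) (.cell 5)) (.const 1)

/-- The internal node considered when the nodes are run through backwards. -/
abbrev backExpr : NatExpr := .sub (.sub (.cell 3) (.const 1)) (.cell 5)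

/-- Probability of the current action at one internal node. -/
def mixProg : Prog :=
  .setReal 10 backExpr
    (.add (.add (.mul (.get 9 (.triple backExpr 1)) (.get 10 (.triple backExpr 1)))
      (.mul (.get 9 (.triple backExpr 2)) (.get 10 (.triple backExpr 2))))
      (.mul (.get 9 (.triple backExpr 3)) (.get 10 (.triple backExpr 3))))

/-- Probabilities of the current action at all active nodes. -/
def columnProg : Prog :=
  .seq (.loop 5 (.succ (.add (.cell 3) (.cell 3))) leafProg)
    (.loop 5 (.cell 3) mixProg)

/-- Cumulative probability of the current action, and comparison with the random number. -/
def cdfProg : Prog :=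
  .seq columnProg <|
  .seq (.setReal 11 (.succ (.cell 4)) (.add (.get 11 (.cell 4))
    (.mul (.sub (.const 1) (.cell 0)) (.cell 10)))) <|
  .ite (.realLt (.cell 4) (.get 11 (.succ (.cell 4)))) .skip
    (.setNat 1 (.const 0) (.succ (.succ (.cell 4))))

/-- Draws an action. -/
def drawProg : Prog :=
  .seq (.setReal 11 (.const 0) (.cell 0)) <|
  .seq (.setNat 1 (.const 0) (.const 1))
    (.loop 4 (.cell 2) cdfProg)

/-- The part of the selection that follows the computation of the sizes. -/
def choiceProg (d : ℕ) : Prog := .seq (treeProg d) (.seq weightsProg drawProg)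

/-- Selection of an action. -/
def selectProg (d : ℕ) : Prog := .seq (levelsProg d) (choiceProg d)

/-- Records that the current action is supported at an internal node. -/
def maxProg : Prog :=
  .ite (.realLt (.const 0) (.add (.add (.get 10 (.triple (.cell 5) 1))
    (.get 10 (.triple (.cell 5) 2))) (.get 10 (.triple (.cell 5) 3))))
    (.setNat 12 (.cell 5) (.succ (.cell 4))) .skip

/-- Largest supported actions of the internal nodes. -/
def supportProg : Prog :=
  .seq (.loop 4 (.cell 3) (.setNat 12 (.cell 4) (.const 0)))
    (.loop 4 (.cell 2) (.seq columnProg (.loop 5 (.cell 3) maxProg)))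

/-- Contribution of the current action to the estimated loss of one active node. -/
def estimateProg : Prog :=
  .seq (.setReal 13 (.const 0) (.sub
    (.div (.get 2 (.get 8 (.get 7 (.succ (.cell 5))))) (.cell 0))
    (.div (.get 2 (.get 8 (.get 7 (.succ (.cell 5))))) (.get 11 (.succ (.cell 4)))))) <|
  .seq (.ite (.natLt (.succ (.cell 4)) (.cell 1)) .skip
    (.setReal 13 (.const 0) (.add (.div (.add (.sub (.query pointExpr)
      (.query (.div (.ofNat (.get 12 (.get 7 (.succ (.cell 5))))) (.ofNat (.cell 2)))))
      (.mul (.const 2) (.get 6 (.get 8 (.get 7 (.succ (.cell 5)))))))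
      (.get 11 (.succ (.cell 4)))) (.cell 13))))
    (.setReal 12 (.succ (.cell 5)) (.add (.get 12 (.succ (.cell 5)))
      (.mul (.get 10 (.succ (.cell 5))) (.cell 13))))

/-- Estimated losses of the active nodes. -/
def lossProg : Prog :=
  .seq (.loop 4 (.triple (.cell 3) 0) (.setReal 12 (.succ (.cell 4)) (.const 0)))
    (.loop 4 (.cell 2) (.seq columnProg (.loop 5 (.triple (.cell 3) 0) estimateProg)))

/-- Adds the estimated losses to the cumulative losses. -/
def accumulateProg : Prog :=
  .loop 4 (.triple (.cell 3) 0)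
    (.setReal 5 (.get 9 (.succ (.cell 4))) (.add (.get 5 (.get 9 (.succ (.cell 4))))
      (.get 12 (.succ (.cell 4)))))

/-- Processing of the feedback. -/
def updateProg : Prog := .seq supportProg (.seq lossProg accumulateProg)

/-- The learner that runs the algorithm on contexts of dimension `d`. -/
def treeLearner (d : ℕ) : Learner where
  select := selectProg d
  update := updateProg

/-! ### Correctness of the selection -/

section correctness

variable {d : ℕ} {o : ℝ → ℝ}

/-- Memory holding the parameters and the state of the algorithm. -/
structure StateMem (P : Params) (L : State d) (μ : Mem) : Prop where
  depth : μ.nat 0 0 = P.M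
  gamma : μ.real 0 0 = P.γ
  eta : ∀ m ≤ P.M, μ.real 1 m = P.η m
  alpha : ∀ m ≤ P.M, μ.real 2 m = P.α m
  loss : ∀ w : ExpNode d, w.1.length < P.M → ∀ c, μ.real 5 (code (child w c)) = L w c

/-- Memory holding the sizes of the tree, the widths of the cubes and the halvings of `x` up to
depth `m`. -/
structure LevelMem (x : Ctx d) (m : ℕ) (μ : Mem) : Prop where
  actions : μ.nat 2 0 = 2 ^ m
  internal : μ.nat 3 0 = internalCount m
  half : ∀ k < m, μ.nat 6 k = subcubeIndex (bits x k) d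
  width : ∀ k ≤ m, μ.real 6 k = (1 / 2) ^ k

/-- Memory holding the active nodes up to the number `n`. -/
structure TreeMem (x : Ctx d) (n : ℕ) (μ : Mem) : Prop where
  parent : ∀ k < n, μ.nat 7 (k + 1) = k / 3
  level : ∀ j ≤ n, μ.nat 8 j = (treeNode x j).length
  code : ∀ j ≤ n, μ.nat 9 j = code (treeNode x j)
  label : ∀ j ≤ n, μ.real 7 j = label (treeNode x j)

/-- The relative positions are overwritten in place, one coordinate per step: at step n the
coordinates below n have already moved to depth k + 1, and their leading bits form the prefix of the
index. -/
lemma bitProg_spec (x : Ctx d) (k : ℕ) (μ : Mem) (hk : μ.nat 4 0 = k) (h6 : μ.nat 6 k = 0)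
    (h3 : ∀ j : Fin d, μ.real 3 j = resid (x j) k) :
    ((Prog.loop 5 (.const d) bitProg).run o μ).nat 6 k = subcubeIndex (bits x k) d ∧
    (∀ i ≠ k, ((Prog.loop 5 (.const d) bitProg).run o μ).nat 6 i = μ.nat 6 i) ∧
    ∀ j : Fin d, ((Prog.loop 5 (.const d) bitProg).run o μ).real 3 j = resid (x j) (k + 1) := by
  have h := loop_induct (o := o) (a := 5) (n := .const d) (p := bitProg) (μ := μ)
    (fun n ν => ν.nat 6 k = subcubeIndex (bits x k) n ∧ (∀ i ≠ k, ν.nat 6 i = μ.nat 6 i) ∧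
      ∀ j : Fin d, ν.real 3 j = resid (x j) (if j.val < n then k + 1 else k))
    ⟨h6, fun _ _ => rfl, fun j => by simp [h3]⟩ ?_
  · refine ⟨h.1, h.2.1, fun j => ?_⟩
    rw [h.2.2 j, if_pos (show j.val < NatExpr.eval μ (.const d) from j.2)]
  · intro n hn ν hag ⟨i1, i2, i3⟩
    change n < d at hn
    have hk' : ν.nat 4 0 = k := by
      rw [hag.nat 4 (by simp [Prog.natOut, bitProg]), hk]
    have hr := i3 ⟨n, hn⟩
    simp only [lt_irrefl, if_false] at hr
    have hb : (bits x k ⟨n, hn⟩ = true) ↔ (1 : ℝ) / 2 ≤ resid (x ⟨n, hn⟩) k := by simp [bits]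
    by_cases hlt : resid (x ⟨n, hn⟩) k + resid (x ⟨n, hn⟩) k < 1
    · have hb' : bits x k ⟨n, hn⟩ = false := by
        rw [Bool.eq_false_iff, Ne, hb]
        linarith
      rw [bitProg, run_seq, run_seq, run_ite_pos]
      · simp only [run_skip, run_setNat, run_setReal, setNat_nat, setReal_nat, setReal_real,
          setNat_real, NatExpr.eval, RealExpr.eval]
        refine ⟨?_, fun i hi => ?_, fun j => ?_⟩
        · simp [hk', i1, subcubeIndex, hn, hb', two_mul]
        · simp [hk', hi, i2 i hi]
        · rcases lt_trichotomy j.val n with hj | hj | hj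
          · simp [hj.ne, i3 j, hj, hj.trans (Nat.lt_succ_self n)]
          · have : j = ⟨n, hn⟩ := Fin.ext hj
            have hr' : resid (x ⟨n, hn⟩) (k + 1) = 2 * resid (x ⟨n, hn⟩) k := by
              rw [resid, if_neg (by linarith)]
            subst this
            simp [hr, hr', two_mul]
          · simp [hj.ne', i3 j, show ¬ (j.val < n) by omega, show ¬ (j.val < n + 1) by omega]
      · simp [Test.Holds, NatExpr.eval, RealExpr.eval, hr, hlt]
    · have hb' : bits x k ⟨n, hn⟩ = true := by
        rw [hb]
        linarith
      rw [bitProg, run_seq, run_seq, run_ite_neg]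
      · simp only [run_seq, run_setNat, run_setReal, setNat_nat, setReal_nat, setReal_real,
          setNat_real, NatExpr.eval, RealExpr.eval]
        refine ⟨?_, fun i hi => ?_, fun j => ?_⟩
        · simp [hk', i1, subcubeIndex, hn, hb', two_mul]
        · simp [hk', hi, i2 i hi]
        · rcases lt_trichotomy j.val n with hj | hj | hj
          · simp [hj.ne, i3 j, hj, hj.trans (Nat.lt_succ_self n)]
          · have : j = ⟨n, hn⟩ := Fin.ext hj
            have hr' : resid (x ⟨n, hn⟩) (k + 1) = 2 * resid (x ⟨n, hn⟩) k - 1 := by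
              rw [resid, if_pos (by linarith)]
            subst this
            simp [hr, hr', two_mul]
          · simp [hj.ne', i3 j, show ¬ (j.val < n) by omega, show ¬ (j.val < n + 1) by omega]
      · simpa [Test.Holds, NatExpr.eval, RealExpr.eval, hr] using hlt

lemma levelsProg_spec (x : Ctx d) (μ : Mem) (h3 : ∀ j : Fin d, μ.real 3 j = x j) :
    LevelMem x (μ.nat 0 0) ((levelsProg d).run o μ) := by
  rw [levelsProg, run_seq, run_seq, run_seq]
  set μ₁ := (Prog.setReal 6 (.const 0) (.const 1)).run o ((Prog.setNat 3 (.const 0) (.const 0)).run o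
    ((Prog.setNat 2 (.const 0) (.const 1)).run o μ)) with hμ₁
  have h := loop_induct (o := o) (a := 4) (n := .cell 0) (p := levelProg d) (μ := μ₁)
    (fun m ν => LevelMem x m ν ∧ ∀ j : Fin d, ν.real 3 j = resid (x j) m) ?_ ?_
  · have h0 : NatExpr.eval μ₁ (.cell 0) = μ.nat 0 0 := by simp [hμ₁, NatExpr.eval]
    rw [h0] at h
    exact h.1
  · refine ⟨⟨?_, ?_, ?_, ?_⟩, ?_⟩ <;> simp [hμ₁, NatExpr.eval, RealExpr.eval, internalCount, resid, h3]
  · intro m _ ν hag ⟨⟨i1, i2, i3, i4⟩, i5⟩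
    rw [levelProg, run_seq, run_seq, run_seq, run_seq]
    set ν₁ := (Prog.setNat 6 (.cell 4) (.const 0)).run o ((Prog.setReal 6 (.succ (.cell 4))
      (.div (.get 6 (.cell 4)) (.const 2))).run o ((Prog.setNat 3 (.const 0)
      (.triple (.cell 3) 1)).run o ((Prog.setNat 2 (.const 0) (.add (.cell 2) (.cell 2))).run o
        (ν.setNat 4 0 m)))) with hν₁
    have hsp := bitProg_spec (o := o) x m ν₁ (by simp [hν₁, NatExpr.eval])
      (by simp [hν₁, NatExpr.eval]) (by simpa [hν₁, NatExpr.eval, RealExpr.eval] using i5)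
    have hfr := agree_run (o := o) (.loop 5 (.const d) bitProg) ν₁
    set ν₂ := (Prog.loop 5 (.const d) bitProg).run o ν₁
    refine ⟨⟨?_, ?_, ?_, ?_⟩, hsp.2.2⟩
    · rw [hfr.nat 2 (by simp [Prog.natOut, bitProg])]
      simp [hν₁, NatExpr.eval, i1, pow_succ, mul_two]
    · rw [hfr.nat 3 (by simp [Prog.natOut, bitProg])]
      simp [hν₁, NatExpr.eval, i2, internalCount]
      ring
    · intro k hk
      rcases Nat.lt_succ_iff_lt_or_eq.1 hk with hk | rfl
      · rw [hsp.2.1 k hk.ne, ← i3 k hk]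
        simp [hν₁, NatExpr.eval, hk.ne]
      · exact hsp.1
    · intro k hk
      rw [hfr.real 6 (by simp [Prog.realOut, bitProg])]
      rcases Nat.le_succ_iff.1 hk with hk | rfl
      · have : k ≠ m + 1 := by omega
        simp [hν₁, NatExpr.eval, RealExpr.eval, this]
        simpa using i4 k hk
      · simp [hν₁, NatExpr.eval, RealExpr.eval, i4 m le_rfl]
        ring

end correctness

/-! ### Construction of the active tree and of its weights -/

section selection

variable {d : ℕ} {o : ℝ → ℝ} {P : Params} {L : State d} {x : Ctx d}

lemma TreeMem.congr {n : ℕ} {μ ν : Mem} (h : TreeMem x n μ) (h7 : ν.nat 7 = μ.nat 7)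
    (h8 : ν.nat 8 = μ.nat 8) (h9 : ν.nat 9 = μ.nat 9) (hr : ν.real 7 = μ.real 7) :
    TreeMem x n ν :=
  ⟨by rw [h7]; exact h.parent, by rw [h8]; exact h.level, by rw [h9]; exact h.code,
    by rw [hr]; exact h.label⟩

lemma LevelMem.agree {m : ℕ} {p : Prog} {μ ν : Mem} (h : LevelMem x m μ) (hag : p.Agree μ ν)
    (hn : ∀ b ∈ [2, 3, 6], b ∉ p.natOut) (hr : 6 ∉ p.realOut) : LevelMem x m ν :=
  ⟨by rw [hag.nat 2 (hn 2 (by decide))]; exact h.actions,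
    by rw [hag.nat 3 (hn 3 (by decide))]; exact h.internal,
    by rw [hag.nat 6 (hn 6 (by decide))]; exact h.half,
    by rw [hag.real 6 hr]; exact h.width⟩

lemma StateMem.agree {p : Prog} {μ ν : Mem} (h : StateMem P L μ) (hag : p.Agree μ ν)
    (hn : 0 ∉ p.natOut) (hr : ∀ b ∈ [0, 1, 2, 5], b ∉ p.realOut) : StateMem P L ν :=
  ⟨by rw [hag.nat 0 hn]; exact h.depth, by rw [hag.real 0 (hr 0 (by decide))]; exact h.gamma,
    by rw [hag.real 1 (hr 1 (by decide))]; exact h.eta,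
    by rw [hag.real 2 (hr 2 (by decide))]; exact h.alpha,
    by rw [hag.real 5 (hr 5 (by decide))]; exact h.loss⟩

/-- The machine has no integer division, so the parent k / 3 and the coefficient position k % 3 are
maintained incrementally by the cells 10 and 11. -/
lemma nodeProg_spec {M k : ℕ} (hk : k < 3 * internalCount M) {ν : Mem} (hν : LevelMem x M ν)
    (h4 : ν.nat 4 0 = k) (ht : TreeMem x k ν) (h10 : ν.nat 10 0 = k / 3)
    (h11 : ν.nat 11 0 = k % 3) :
    TreeMem x (k + 1) ((nodeProg d).run o ν) ∧
      ((nodeProg d).run o ν).nat 10 0 = (k + 1) / 3 ∧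
      ((nodeProg d).run o ν).nat 11 0 = (k + 1) % 3 := by
  have hlen : (treeNode x (k / 3)).length < M := (length_treeNode_lt_iff x M _).2 (by omega)
  have hd8 := ht.level (k / 3) (by omega)
  have hd9 := ht.code (k / 3) (by omega)
  have hd7 := ht.label (k / 3) (by omega)
  have hc : k % 3 < 3 := Nat.mod_lt _ (by norm_num)
  have hsid := hν.half _ hlen
  have hwid := hν.width ((treeNode x (k / 3)).length + 1) (by omega)
  rw [nodeProg, run_seq, run_seq, run_seq, run_seq]
  set ν₁ := (Prog.setReal 7 _ _).run o _ with hν₁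
  have e7 : ∀ j, ν₁.nat 7 j = if j = k + 1 then k / 3 else ν.nat 7 j := by
    intro j
    simp [hν₁, NatExpr.eval, h4, h10]
  have e8 : ∀ j, ν₁.nat 8 j = if j = k + 1 then (treeNode x (k + 1)).length else ν.nat 8 j := by
    intro j
    simp [hν₁, NatExpr.eval, h4, h10, hd8, length_treeNode_succ]
  have hk3 : k / 3 ≠ k + 1 := by omega
  have e9 : ∀ j, ν₁.nat 9 j = if j = k + 1 then code (treeNode x (k + 1)) else ν.nat 9 j := by
    intro j
    rw [treeNode_succ, code_child, coeffIndex_coeff hc]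
    simp [hν₁, NatExpr.eval, h4, h10, h11, hd8, hd9, hk3, hsid, activeExp]
  have er : ∀ j, ν₁.real 7 j = if j = k + 1 then label (treeNode x (k + 1)) else ν.real 7 j := by
    intro j
    rw [treeNode_succ, label_child, coeff_cast hc]
    simp [hν₁, NatExpr.eval, RealExpr.eval, h4, h10, h11, hd8, hd7, hk3, activeExp]
    rw [hwid]
    simp
  have e10 : ν₁.nat 10 0 = k / 3 := by simp [hν₁, h10]
  have e11 : ν₁.nat 11 0 = k % 3 := by simp [hν₁, h11]
  clear_value ν₁
  have ht₁ : TreeMem x (k + 1) ν₁ := by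
    refine ⟨fun i hi => ?_, fun j hj => ?_, fun j hj => ?_, fun j hj => ?_⟩
    · rw [e7]
      split_ifs with h
      · rw [show i = k by omega]
      · exact ht.parent i (by omega)
    · rw [e8]
      split_ifs with h
      · rw [h]
      · exact ht.level j (by omega)
    · rw [e9]
      split_ifs with h
      · rw [h]
      · exact ht.code j (by omega)
    · rw [er]
      split_ifs with h
      · rw [h]
      · exact ht.label j (by omega)
  by_cases hlt : k % 3 < 2
  · rw [run_ite_pos (by simpa [Test.Holds, NatExpr.eval, e11] using hlt)]
    refine ⟨ht₁.congr ?_ ?_ ?_ ?_, ?_, ?_⟩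
    · funext j; simp
    · funext j; simp
    · funext j; simp
    · rfl
    · simp [NatExpr.eval, e10]; omega
    · simp [NatExpr.eval, e11]; omega
  · rw [run_ite_neg (by simpa [Test.Holds, NatExpr.eval, e11] using hlt)]
    refine ⟨ht₁.congr ?_ ?_ ?_ ?_, ?_, ?_⟩
    · funext j; simp
    · funext j; simp
    · funext j; simp
    · rfl
    · simp [NatExpr.eval, e10]; omega
    · simp [NatExpr.eval]; omega

lemma treeProg_spec {M : ℕ} {μ : Mem} (hμ : LevelMem x M μ) :
    TreeMem x (3 * internalCount M) ((treeProg d).run o μ) := by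
  rw [treeProg, run_seq, run_seq, run_seq, run_seq, run_seq]
  set μ₁ := (Prog.setNat 11 _ _).run o _ with hμ₁
  have hl₁ : LevelMem x M μ₁ := by
    refine ⟨?_, ?_, fun k hk => ?_, fun k hk => ?_⟩
    · simpa [hμ₁, NatExpr.eval] using hμ.actions
    · simpa [hμ₁, NatExpr.eval] using hμ.internal
    · simpa [hμ₁, NatExpr.eval] using hμ.half k hk
    · simpa [hμ₁, NatExpr.eval] using hμ.width k hk
  have hn : NatExpr.eval μ₁ (.triple (.cell 3) 0) = 3 * internalCount M := by
    simp only [NatExpr.eval, hl₁.internal]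
    ring
  have h := loop_induct (o := o) (a := 4) (n := .triple (.cell 3) 0) (p := nodeProg d) (μ := μ₁)
    (fun k ν => TreeMem x k ν ∧ ν.nat 10 0 = k / 3 ∧ ν.nat 11 0 = k % 3) ?_ ?_
  · rw [hn] at h
    exact h.1
  · refine ⟨⟨fun k hk => absurd hk (Nat.not_lt_zero _), fun j hj => ?_, fun j hj => ?_,
      fun j hj => ?_⟩, ?_, ?_⟩
    · simp [Nat.le_zero.1 hj, treeNode_zero, hμ₁, NatExpr.eval]
    · simp [Nat.le_zero.1 hj, treeNode_zero, hμ₁, NatExpr.eval, code_nil]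
    · simp [Nat.le_zero.1 hj, treeNode_zero, hμ₁, NatExpr.eval, RealExpr.eval, label, offset]
    · simp [hμ₁, NatExpr.eval]
    · simp [hμ₁, NatExpr.eval]
  · intro k hk ν hag ⟨i1, i2, i3⟩
    rw [hn] at hk
    have hl := hl₁.agree hag (by simp [Prog.natOut, nodeProg]) (by simp [Prog.realOut, nodeProg])
    refine nodeProg_spec hk ?_ ?_ ?_ ?_ ?_
    · exact hl.agree (agree_run (o := o) (.setNat 4 (.const 0) (.const k)) ν)
        (by simp [Prog.natOut]) (by simp [Prog.realOut])
    · simp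
    · exact i1.congr (by funext; simp) (by funext; simp) (by funext; simp) rfl
    · simpa using i2
    · simpa using i3

/-- Memory from which the action probabilities of all active nodes can be computed. -/
structure ReadyMem (P : Params) (L : State d) (x : Ctx d) (μ : Mem) : Prop where
  state : StateMem P L μ
  actions : μ.nat 2 0 = 2 ^ P.M
  internal : μ.nat 3 0 = internalCount P.M
  width : ∀ k ≤ P.M, μ.real 6 k = (1 / 2) ^ k
  tree : TreeMem x (3 * internalCount P.M) μ
  weight : ∀ k < 3 * internalCount P.M, μ.real 9 (k + 1) =
    weights P L (activeExp x (treeNode x (k / 3))) (coeff (k % 3))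

lemma ReadyMem.agree {p : Prog} {μ ν : Mem} (h : ReadyMem P L x μ) (hag : p.Agree μ ν)
    (hn : ∀ b ∈ [0, 2, 3, 7, 8, 9], b ∉ p.natOut)
    (hr : ∀ b ∈ [0, 1, 2, 5, 6, 7, 9], b ∉ p.realOut) : ReadyMem P L x ν :=
  ⟨h.state.agree hag (hn 0 (by decide)) fun b hb => hr b (by revert b; decide),
    by rw [hag.nat 2 (hn 2 (by decide))]; exact h.actions,
    by rw [hag.nat 3 (hn 3 (by decide))]; exact h.internal,
    by rw [hag.real 6 (hr 6 (by decide))]; exact h.width,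
    h.tree.congr (hag.nat 7 (hn 7 (by decide))) (hag.nat 8 (hn 8 (by decide)))
      (hag.nat 9 (hn 9 (by decide))) (hag.real 7 (hr 7 (by decide))),
    by rw [hag.real 9 (hr 9 (by decide))]; exact h.weight⟩

lemma ReadyMem.setCounter {μ : Mem} (h : ReadyMem P L x μ) {a : ℕ}
    (ha : ∀ b ∈ [0, 2, 3, 7, 8, 9], b ≠ a) (k : ℕ) : ReadyMem P L x (μ.setNat a 0 k) :=
  h.agree (agree_run (o := fun _ => 0) (.setNat a (.const 0) (.const k)) μ)
    (fun b hb => by simpa [Prog.natOut] using ha b hb) (by simp [Prog.realOut])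

/-- Two passes are needed because a normalized weight involves the exponentials of all three
siblings, stored at 3n + 1, 3n + 2 and 3n + 3 for the parent n. -/
lemma weightsProg_spec {μ : Mem} (hs : StateMem P L μ) (hl : LevelMem x P.M μ)
    (ht : TreeMem x (3 * internalCount P.M) μ) : ReadyMem P L x (weightsProg.run o μ) := by
  have hag := agree_run (o := o) weightsProg μ
  refine ⟨hs.agree hag (by decide) (by decide), ?_, ?_, ?_, ?_, ?_⟩
  · rw [hag.nat 2 (by decide)]; exact hl.actions
  · rw [hag.nat 3 (by decide)]; exact hl.internal
  · rw [hag.real 6 (by decide)]; exact hl.width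
  · exact ht.congr (hag.nat 7 (by decide)) (hag.nat 8 (by decide)) (hag.nat 9 (by decide))
      (hag.real 7 (by decide))
  · clear hag
    rw [weightsProg, run_seq]
    set n : NatExpr := .triple (.cell 3) 0 with hn
    have hnμ : ∀ ν : Mem, ν.nat 3 = μ.nat 3 → n.eval ν = 3 * internalCount P.M := by
      intro ν h3
      simp only [hn, NatExpr.eval, h3, hl.internal]
      ring
    set g : ℕ → ℝ := fun k => Real.exp (-(P.η (treeNode x (k / 3)).length *
      L (activeExp x (treeNode x (k / 3))) (coeff (k % 3)))) with hg
    have h1 := loop_induct (o := o) (a := 4) (n := n) (p := expProg) (μ := μ)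
      (fun k ν => ∀ i < k, ν.real 8 (i + 1) = g i) (fun i hi => absurd hi (Nat.not_lt_zero _)) ?_
    · rw [hnμ μ rfl] at h1
      have hag := agree_run (o := o) (.loop 4 n expProg) μ
      set μ₁ := (Prog.loop 4 n expProg).run o μ
      have h2 := loop_induct (o := o) (a := 4) (n := n) (p := normProg) (μ := μ₁)
        (fun k ν => ∀ i < k, ν.real 9 (i + 1) =
          weights P L (activeExp x (treeNode x (i / 3))) (coeff (i % 3)))
        (fun i hi => absurd hi (Nat.not_lt_zero _)) ?_
      · rwa [hnμ μ₁ (hag.nat 3 (by decide))] at h2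
      · intro k hk ν hag' hν i hi
        rw [hnμ μ₁ (hag.nat 3 (by decide))] at hk
        have h8 : ν.real 8 = μ₁.real 8 := hag'.real 8 (by decide)
        have h7 : ν.nat 7 = μ.nat 7 := (hag'.nat 7 (by decide)).trans (hag.nat 7 (by decide))
        rcases Nat.lt_succ_iff_lt_or_eq.1 hi with hi | rfl
        · rw [← hν i hi]
          simp [normProg, NatExpr.eval, RealExpr.eval, hi.ne]
        · have hp := ht.parent i hk
          have e1 := h1 (3 * (i / 3)) (by omega)
          have e2 := h1 (3 * (i / 3) + 1) (by omega)
          have e3 := h1 (3 * (i / 3) + 2) (by omega)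
          have e0 := h1 i hk
          simp only [normProg, run_setReal, setReal_real, NatExpr.eval, RealExpr.eval, setNat_nat,
            setNat_real, h8, h7]
          norm_num [hp, e0]
          rw [weights, sum_signType,
            show i / 3 + i / 3 + i / 3 + 1 = 3 * (i / 3) + 1 by ring,
            show i / 3 + i / 3 + i / 3 + 2 = 3 * (i / 3) + 1 + 1 by ring,
            show i / 3 + i / 3 + i / 3 + 3 = 3 * (i / 3) + 2 + 1 by ring, e1, e2, e3, hg]
          simp only [show 3 * (i / 3) / 3 = i / 3 by omega, show 3 * (i / 3) % 3 = 0 by omega,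
            show (3 * (i / 3) + 1) / 3 = i / 3 by omega,
            show (3 * (i / 3) + 1) % 3 = 1 by omega,
            show (3 * (i / 3) + 2) / 3 = i / 3 by omega,
            show (3 * (i / 3) + 2) % 3 = 2 by omega]
          rfl
    · intro k hk ν hag hν i hi
      rw [hnμ μ rfl] at hk
      have h1 : ν.real 1 = μ.real 1 := hag.real 1 (by decide)
      have h5 : ν.real 5 = μ.real 5 := hag.real 5 (by decide)
      have h7 : ν.nat 7 = μ.nat 7 := hag.nat 7 (by decide)
      have h8 : ν.nat 8 = μ.nat 8 := hag.nat 8 (by decide)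
      have h9 : ν.nat 9 = μ.nat 9 := hag.nat 9 (by decide)
      rcases Nat.lt_succ_iff_lt_or_eq.1 hi with hi | rfl
      · rw [← hν i hi]
        simp [expProg, NatExpr.eval, RealExpr.eval, hi.ne]
      · have hp := ht.parent i hk
        have hlen : (treeNode x (i / 3)).length < P.M :=
          (length_treeNode_lt_iff x P.M _).2 (by omega)
        have hd := ht.level (i / 3) (by omega)
        have hc := ht.code (i + 1) (by omega)
        have hη := hs.eta _ hlen.le
        have hL := hs.loss (activeExp x (treeNode x (i / 3))) hlen (coeff (i % 3))
        rw [← treeNode_succ, ← hc] at hL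
        simp only [expProg, run_setReal, setReal_real, NatExpr.eval, RealExpr.eval, setNat_nat,
          setNat_real, h1, h5, h7, h8, h9]
        norm_num [hp, hd, hη, hL, hg]

end selection

/-! ### Probabilities of one action at all active nodes, and the draw -/

section columns

variable {d : ℕ} {o : ℝ → ℝ} {P : Params} {L : State d} {x : Ctx d}

lemma leafProg_spec {μ : Mem} (h : ReadyMem P L x μ) {k i : ℕ} (h4 : μ.nat 4 0 = i)
    (h5 : μ.nat 5 0 = k) (hk : k ≤ 2 * internalCount P.M) (j : ℕ) :
    (leafProg.run o μ).real 10 j = if j = internalCount P.M + k then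
      nodeLaw P L x (treeNode x (internalCount P.M + k)) (i + 1) else μ.real 10 j := by
  set S := internalCount P.M with hS
  have hlen : (treeNode x (S + k)).length = P.M := by
    have h1 := length_treeNode_lt_iff x P.M (S + k)
    have h2 := length_treeNode_lt_iff x (P.M + 1) (S + k)
    rw [internalCount] at h2
    omega
  have hlab := h.tree.label (S + k) (by omega)
  have h3 : μ.nat 3 0 = S := h.internal
  have h2 := h.actions
  rw [leafProg, run_seq, run_seq, run_seq, run_seq]
  set μ₁ := (Prog.setReal 13 (.const 0) (.get 7 (.add (.cell 3) (.cell 5)))).run o _ with hμ₁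
  have a2 : μ₁.nat = μ.nat := rfl
  have a10 : ∀ j, μ₁.real 10 j = if j = S + k then 0 else μ.real 10 j := by
    intro j
    simp [hμ₁, NatExpr.eval, RealExpr.eval, h3, h5]
  have a13 : μ₁.real 13 0 = label (treeNode x (S + k)) := by
    simp [hμ₁, NatExpr.eval, RealExpr.eval, h3, h5, hlab]
  clear_value μ₁
  set μ₂ := (Prog.ite (.realLt (.cell 13) (.div (.const 1) (.ofNat (.cell 2))))
    (.setReal 13 (.const 0) (.div (.const 1) (.ofNat (.cell 2)))) .skip).run o μ₁ with hμ₂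
  have b : μ₂.nat = μ.nat ∧ μ₂.real 10 = μ₁.real 10 ∧
      μ₂.real 13 0 = max (label (treeNode x (S + k))) (1 / 2 ^ P.M) := by
    by_cases hlt : label (treeNode x (S + k)) < 1 / 2 ^ P.M
    · rw [hμ₂, run_ite_pos
        (by simpa [Test.Holds, NatExpr.eval, RealExpr.eval, a13, a2, h2] using hlt)]
      refine ⟨a2, by funext; simp, ?_⟩
      rw [max_eq_right hlt.le]
      simp [NatExpr.eval, RealExpr.eval, a2, h2]
    · rw [hμ₂, run_ite_neg
        (by simpa [Test.Holds, NatExpr.eval, RealExpr.eval, a13, a2, h2] using hlt)]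
      rw [max_eq_left (not_lt.1 hlt)]
      exact ⟨a2, rfl, a13⟩
  clear_value μ₂
  obtain ⟨b2, b10, b13⟩ := b
  set μ₃ := (Prog.ite (.realLt (.const 1) (.cell 13)) (.setReal 13 (.const 0) (.const 1))
    .skip).run o μ₂ with hμ₃
  have c : μ₃.nat = μ.nat ∧ μ₃.real 10 = μ₁.real 10 ∧
      μ₃.real 13 0 = clip P.M (label (treeNode x (S + k))) := by
    by_cases hlt : 1 < max (label (treeNode x (S + k))) (1 / 2 ^ P.M)
    · rw [hμ₃, run_ite_pos
        (by simpa [Test.Holds, NatExpr.eval, RealExpr.eval, b13] using hlt)]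
      refine ⟨b2, by rw [← b10]; funext; simp, ?_⟩
      rw [clip, min_eq_right hlt.le]
      simp [NatExpr.eval, RealExpr.eval]
    · rw [hμ₃, run_ite_neg
        (by simpa [Test.Holds, NatExpr.eval, RealExpr.eval, b13] using hlt)]
      rw [clip, min_eq_left (not_lt.1 hlt)]
      exact ⟨b2, b10, b13⟩
  clear_value μ₃
  obtain ⟨c2, c10, c13⟩ := c
  have hpt : pointExpr.eval o μ₃ = ((i + 1 : ℕ) : ℝ) / 2 ^ P.M := by
    simp [pointExpr, NatExpr.eval, RealExpr.eval, c2, h4, h2]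
  have hcell : RealExpr.eval o μ₃ (.cell 13) = clip P.M (label (treeNode x (S + k))) := c13
  rw [nodeLaw_leaf L hlen]
  -- The machine only compares by `<`; equality of the action with the clipped label is the failure
  -- of both strict inequalities.
  by_cases h6 : ((i + 1 : ℕ) : ℝ) / 2 ^ P.M < clip P.M (label (treeNode x (S + k)))
  · rw [run_ite_pos (by rw [Test.Holds, hpt, hcell]; exact h6), run_skip, c10, a10,
      if_neg h6.ne]
  · rw [run_ite_neg (by rw [Test.Holds, hpt, hcell]; exact h6)]
    by_cases h7 : clip P.M (label (treeNode x (S + k))) < ((i + 1 : ℕ) : ℝ) / 2 ^ P.M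
    · rw [run_ite_pos (by rw [Test.Holds, hpt, hcell]; exact h7), run_skip, c10, a10,
        if_neg h7.ne']
    · rw [run_ite_neg (by rw [Test.Holds, hpt, hcell]; exact h7),
        if_pos (le_antisymm (not_lt.1 h7) (not_lt.1 h6))]
      by_cases hj : j = S + k
      · simp [NatExpr.eval, RealExpr.eval, c2, h3, h5, hj]
      · simp [NatExpr.eval, c2, h3, h5, hj, c10, a10]

lemma mixProg_spec {μ : Mem} (h : ReadyMem P L x μ) {n i : ℕ} (hn : n < internalCount P.M)
    (h5 : NatExpr.eval μ backExpr = n)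
    (hcol : ∀ j, n < j → j ≤ 3 * internalCount P.M →
      μ.real 10 j = nodeLaw P L x (treeNode x j) (i + 1)) (j : ℕ) :
    (mixProg.run o μ).real 10 j = if j = n then nodeLaw P L x (treeNode x n) (i + 1)
      else μ.real 10 j := by
  have e : ∀ c < 3, NatExpr.eval μ (.triple backExpr (c + 1)) = 3 * n + c + 1 := by
    intro c _
    simp only [NatExpr.eval] at h5 ⊢
    rw [h5]
    ring
  have hw : ∀ c < 3, μ.real 9 (3 * n + c + 1) =
      weights P L (activeExp x (treeNode x n)) (coeff c) := by
    intro c hc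
    rw [h.weight (3 * n + c) (by omega), show (3 * n + c) / 3 = n by omega,
      show (3 * n + c) % 3 = c by omega]
  have hc : ∀ c < 3, μ.real 10 (3 * n + c + 1) =
      nodeLaw P L x (child (activeExp x (treeNode x n)) (coeff c)) (i + 1) := by
    intro c hc
    rw [hcol _ (by omega) (by omega), treeNode_child x n hc]
  have hlen : (treeNode x n).length < P.M := (length_treeNode_lt_iff x P.M n).2 hn
  rw [nodeLaw_eq_sum L (active_treeNode x n) hlen, sum_signType, mixProg, run_setReal, setReal_real,
    h5]
  simp only [true_and]
  refine if_congr Iff.rfl ?_ rfl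
  simp only [RealExpr.eval]
  rw [e 0 (by norm_num), e 1 (by norm_num), e 2 (by norm_num), hw 0 (by norm_num),
    hw 1 (by norm_num), hw 2 (by norm_num), hc 0 (by norm_num), hc 1 (by norm_num),
    hc 2 (by norm_num)]

/-- Leaves first, then the internal nodes in decreasing heap order: children have larger numbers
than their parent and are ready when it is reached. Only one action is held at a time, and entry j
belongs to action counter + 1. -/
lemma columnProg_spec {μ : Mem} (h : ReadyMem P L x μ) {j : ℕ} (hj : j ≤ 3 * internalCount P.M) :
    (columnProg.run o μ).real 10 j = nodeLaw P L x (treeNode x j) (μ.nat 4 0 + 1) := by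
  set S := internalCount P.M with hS
  rw [columnProg, run_seq]
  set n₁ : NatExpr := .succ (.add (.cell 3) (.cell 3)) with hn₁
  have hn : n₁.eval μ = 2 * S + 1 := by
    simp only [hn₁, NatExpr.eval, h.internal]
    ring
  have h1 := loop_induct (o := o) (a := 5) (n := n₁) (p := leafProg) (μ := μ)
    (fun k ν => ∀ j, S ≤ j → j < S + k → ν.real 10 j = nodeLaw P L x (treeNode x j) (μ.nat 4 0 + 1))
    (fun j h1 h2 => by omega) ?_
  · rw [hn] at h1
    have hag := agree_run (o := o) (.loop 5 n₁ leafProg) μ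
    set μ₁ := (Prog.loop 5 n₁ leafProg).run o μ
    have h' := h.agree hag (by decide) (by decide)
    have h3 : NatExpr.eval μ₁ (.cell 3) = S := h'.internal
    have h2 := loop_induct (o := o) (a := 5) (n := .cell 3) (p := mixProg) (μ := μ₁)
      (fun k ν => ∀ j, S ≤ j + k → j ≤ 3 * S →
        ν.real 10 j = nodeLaw P L x (treeNode x j) (μ.nat 4 0 + 1))
      (fun j hj1 hj2 => h1 j hj1 (by omega)) ?_
    · rw [h3] at h2
      exact h2 j (by omega) hj
    · intro k hk ν hag' hν j hj1 hj2
      rw [h3] at hk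
      have hr := (h'.agree hag' (by decide) (by decide)).setCounter (a := 5) (by decide) k
      rw [mixProg_spec hr (n := S - 1 - k) (i := μ.nat 4 0) (by omega)]
      · split_ifs with hjk
        · rw [hjk]
        · exact hν j (by omega) hj2
      · have := hr.internal
        simp only [NatExpr.eval, this]
        simp [← hS]
      · intro j h6 h7
        exact hν j (by omega) h7
  · intro k hk ν hag hν j hj1 hj2
    rw [hn] at hk
    have hr := (h.agree hag (by decide) (by decide)).setCounter (a := 5) (by decide) k
    have h4 : ν.nat 4 = μ.nat 4 := hag.nat 4 (by decide)
    rw [leafProg_spec hr (k := k) (i := μ.nat 4 0) (by simp [h4]) (by simp) (by omega)]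
    split_ifs with hjk
    · rw [hjk]
    · exact hν j hj1 (by omega)

/-- Memory after an action has been drawn with the random number `u`. -/
structure DrawnMem (P : Params) (L : State d) (x : Ctx d) (u : ℝ) (μ : Mem) : Prop where
  ready : ReadyMem P L x μ
  cdf : ∀ i, 1 ≤ i → i ≤ 2 ^ P.M → μ.real 11 i = drawCdf P L x i
  one_le : 1 ≤ μ.nat 1 0
  below : μ.nat 1 0 = 1 ∨ drawCdf P L x (μ.nat 1 0 - 1) ≤ u
  above : ∀ i, μ.nat 1 0 ≤ i → i ≤ 2 ^ P.M → u < drawCdf P L x i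

lemma drawProg_spec {μ : Mem} (h : ReadyMem P L x μ) :
    DrawnMem P L x (μ.real 4 0) (drawProg.run o μ) := by
  have hag := agree_run (o := o) drawProg μ
  have hfin : ReadyMem P L x (drawProg.run o μ) := h.agree hag (by decide) (by decide)
  clear hag
  set u := μ.real 4 0 with hu
  -- The array starts from γ instead of adding the exploration mass at action 1. It thus differs
  -- from `drawCdf` at index 0, so the lower bound on `u` is claimed only when the chosen action is
  -- not 1.
  set Q : ℕ → ℝ := fun n => (1 - P.γ) * ∑ k ∈ Finset.Icc 1 n, nodeLaw P L x [] k + P.γ with hQ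
  have hQcdf : ∀ i, 1 ≤ i → Q i = drawCdf P L x i := fun i hi => (drawCdf_eq L x hi).symm
  rw [drawProg, run_seq, run_seq] at hfin ⊢
  set μ₁ := (Prog.setNat 1 (.const 0) (.const 1)).run o
    ((Prog.setReal 11 (.const 0) (.cell 0)).run o μ) with hμ₁
  have hr₁ : ReadyMem P L x μ₁ :=
    (h.agree (agree_run (o := o) (.setReal 11 (.const 0) (.cell 0)) μ) (by decide)
      (by decide)).agree (agree_run (o := o) (.setNat 1 (.const 0) (.const 1)) _) (by decide)
      (by decide)
  have hn : NatExpr.eval μ₁ (.cell 2) = 2 ^ P.M := hr₁.actions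
  have hmain := loop_induct (o := o) (a := 4) (n := .cell 2) (p := cdfProg) (μ := μ₁)
    (fun n ν => (∀ i ≤ n, ν.real 11 i = Q i) ∧ 1 ≤ ν.nat 1 0 ∧ ν.nat 1 0 ≤ n + 1 ∧
      (ν.nat 1 0 = 1 ∨ Q (ν.nat 1 0 - 1) ≤ u) ∧ ∀ i, ν.nat 1 0 ≤ i → i ≤ n → u < Q i) ?_ ?_
  · rw [hn] at hmain
    obtain ⟨i1, i2, i3, i4, i5⟩ := hmain
    refine ⟨hfin, fun i h1 h2 => by rw [i1 i h2, hQcdf i h1], i2, ?_, fun i h1 h2 => ?_⟩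
    · by_cases hI : ((Prog.loop 4 (.cell 2) cdfProg).run o μ₁).nat 1 0 = 1
      · exact Or.inl hI
      · right
        rw [← hQcdf _ (by omega)]
        exact i4.resolve_left hI
    · rw [← hQcdf _ (by omega)]
      exact i5 i h1 h2
  · refine ⟨fun i hi => ?_, ?_, ?_, ?_, fun i h1 h2 => ?_⟩
    · rw [Nat.le_zero.1 hi]
      simp [hμ₁, hQ, NatExpr.eval, RealExpr.eval, h.state.gamma]
    · simp [hμ₁, NatExpr.eval]
    · simp [hμ₁, NatExpr.eval]
    · simp [hμ₁, NatExpr.eval]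
    · simp [hμ₁, NatExpr.eval] at h1
      omega
  · intro n hn' ν hag ⟨i1, i2, i3, i4, i5⟩
    have hr := (hr₁.agree hag (by decide) (by decide)).setCounter (a := 4) (by decide) n
    have hu4 : ν.real 4 0 = u := by
      rw [hag.real 4 (by decide)]
      simp [hμ₁, hu]
    rw [cdfProg, run_seq, run_seq]
    have hcol := columnProg_spec (o := o) hr (j := 0) (Nat.zero_le _)
    have hagc := agree_run (o := o) columnProg (ν.setNat 4 0 n)
    set ν₁ := columnProg.run o (ν.setNat 4 0 n)
    have c4 : ν₁.nat 4 0 = n := by rw [hagc.nat 4 (by decide)]; simp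
    have c1 : ν₁.nat 1 0 = ν.nat 1 0 := by rw [hagc.nat 1 (by decide)]; simp
    have cr4 : ν₁.real 4 0 = u := by rw [hagc.real 4 (by decide)]; exact hu4
    have cr11 : ν₁.real 11 = ν.real 11 := hagc.real 11 (by decide)
    have cr0 : ν₁.real 0 0 = P.γ := by rw [hagc.real 0 (by decide)]; exact hr.state.gamma
    rw [treeNode_zero] at hcol
    simp only [setNat_nat, and_self, if_true] at hcol
    set ν₂ := (Prog.setReal 11 (.succ (.cell 4)) (.add (.get 11 (.cell 4))
      (.mul (.sub (.const 1) (.cell 0)) (.cell 10)))).run o ν₁ with hν₂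
    have d11 : ∀ i ≤ n + 1, ν₂.real 11 i = Q i := by
      intro i hi
      rcases Nat.le_succ_iff.1 hi with hi | rfl
      · rw [← i1 i hi]
        simp [hν₂, NatExpr.eval, c4, cr11, show i ≠ n + 1 by omega]
      · have : Q (n + 1) = Q n + (1 - P.γ) * nodeLaw P L x [] (n + 1) := by
          simp only [hQ]
          rw [Finset.sum_Icc_succ_top (by omega)]
          ring
        rw [this, ← i1 n le_rfl, ← hcol]
        simp [hν₂, NatExpr.eval, RealExpr.eval, c4, cr11, cr0]
    have d1 : ν₂.nat = ν₁.nat := rfl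
    have hut : RealExpr.eval o ν₂ (.cell 4) = u := by
      simp [hν₂, RealExpr.eval, NatExpr.eval, cr4]
    have hqt : RealExpr.eval o ν₂ (.get 11 (.succ (.cell 4))) = Q (n + 1) := by
      rw [← d11 (n + 1) le_rfl]
      simp only [RealExpr.eval, NatExpr.eval, d1, c4]
    by_cases hlt : u < Q (n + 1)
    · rw [run_ite_pos (by rw [Test.Holds, hut, hqt]; exact hlt), run_skip, d1, c1]
      refine ⟨d11, i2, by omega, i4, fun i h1 h2 => ?_⟩
      rcases Nat.le_succ_iff.1 h2 with h2 | rfl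
      · exact i5 i h1 h2
      · exact hlt
    · rw [run_ite_neg (by rw [Test.Holds, hut, hqt]; exact hlt)]
      simp only [run_setNat, setNat_nat, setNat_real, NatExpr.eval, d1, c4, and_self, if_true]
      -- The tentative action n + 2 is the successor of the rejected n + 1, so no index seen so far
      -- is at or above it.
      refine ⟨d11, by omega, by omega, Or.inr ?_, fun i h1 h2 => by omega⟩
      exact not_lt.1 hlt

lemma selectProg_spec {μ : Mem} (hs : StateMem P L μ) (h3 : ∀ j : Fin d, μ.real 3 j = x j) :
    DrawnMem P L x (μ.real 4 0) ((selectProg d).run o μ) := by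
  have h1 := levelsProg_spec (o := o) x μ h3
  rw [hs.depth] at h1
  have hag := agree_run (o := o) (levelsProg d) μ
  have hs1 := hs.agree hag (by simp [Prog.natOut, levelsProg, levelProg, bitProg])
    (by simp [Prog.realOut, levelsProg, levelProg, bitProg])
  have hu1 := hag.real 4 (by simp [Prog.realOut, levelsProg, levelProg, bitProg])
  rw [selectProg, run_seq, choiceProg, run_seq, run_seq]
  set μ₁ := (levelsProg d).run o μ
  have h2 := treeProg_spec (o := o) h1
  have hag2 := agree_run (o := o) (treeProg d) μ₁
  have hs2 := hs1.agree hag2 (by simp [Prog.natOut, treeProg, nodeProg])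
    (by simp [Prog.realOut, treeProg, nodeProg])
  have hl2 := h1.agree hag2 (by simp [Prog.natOut, treeProg, nodeProg])
    (by simp [Prog.realOut, treeProg, nodeProg])
  have hu2 := hag2.real 4 (by simp [Prog.realOut, treeProg, nodeProg])
  set μ₂ := (treeProg d).run o μ₁
  have h3 := drawProg_spec (o := o) (weightsProg_spec (o := o) hs2 hl2 h2)
  rwa [(agree_run (o := o) weightsProg μ₂).real 4 (by decide), hu2, hu1] at h3

end columns

/-! ### Largest supported actions, loss estimates and the update of the state -/

section feedback

variable {d : ℕ} {o : ℝ → ℝ} {P : Params} {L : State d} {x : Ctx d}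

lemma column_sum_pos_iff (n i : ℕ) :
    0 < nodeLaw P L x (treeNode x (3 * n + 1)) i + nodeLaw P L x (treeNode x (3 * n + 2)) i +
      nodeLaw P L x (treeNode x (3 * n + 3)) i ↔
    ∃ c, 0 < nodeLaw P L x (child (activeExp x (treeNode x n)) c) i := by
  have e0 := treeNode_child x n (c := 0) (by norm_num)
  have e1 := treeNode_child x n (c := 1) (by norm_num)
  have e2 := treeNode_child x n (c := 2) (by norm_num)
  rw [show 3 * n + 0 + 1 = 3 * n + 1 by ring] at e0
  rw [show 3 * n + 1 + 1 = 3 * n + 2 by ring] at e1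
  rw [show 3 * n + 2 + 1 = 3 * n + 3 by ring] at e2
  rw [e0, e1, e2]
  have hn := fun c => nodeLaw_nonneg P L x (child (activeExp x (treeNode x n)) c) i
  constructor
  · intro h
    by_contra! hc
    linarith [hc (coeff 0), hc (coeff 1), hc (coeff 2)]
  · rintro ⟨c, hc⟩
    have h0 := hn (coeff 0)
    have h1 := hn (coeff 1)
    have h2 := hn (coeff 2)
    have := coeffIndex_lt c
    rw [← coeff_coeffIndex c] at hc
    interval_cases coeffIndex c <;> linarith

/-- Actions are scanned in increasing order, so the last one recorded is the maximum. The initial 0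
agrees with the supremum of the empty set in ℕ. -/
lemma supportProg_spec {μ : Mem} (h : ReadyMem P L x μ) {n : ℕ} (hn : n < internalCount P.M) :
    (supportProg.run o μ).nat 12 n = (support P L x (activeExp x (treeNode x n))).sup id := by
  set S := internalCount P.M with hS
  set Q : ℕ → ℕ → Prop := fun n i =>
    ∃ c, 0 < nodeLaw P L x (child (activeExp x (treeNode x n)) c) i with hQ
  rw [supportProg, run_seq]
  have h3 : NatExpr.eval μ (.cell 3) = S := h.internal
  have hinit := loop_induct (o := o) (a := 4) (n := .cell 3) (p := .setNat 12 (.cell 4) (.const 0))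
    (μ := μ) (fun k ν => ∀ n < k, ν.nat 12 n = 0) (fun n hn => absurd hn (Nat.not_lt_zero _)) ?_
  · rw [h3] at hinit
    have hag := agree_run (o := o) (.loop 4 (.cell 3) (.setNat 12 (.cell 4) (.const 0))) μ
    set μ₁ := (Prog.loop 4 (.cell 3) (.setNat 12 (.cell 4) (.const 0))).run o μ
    have h' := h.agree hag (by decide) (by decide)
    have h2 : NatExpr.eval μ₁ (.cell 2) = 2 ^ P.M := h'.actions
    have hmain := loop_induct (o := o) (a := 4) (n := .cell 2)
      (p := .seq columnProg (.loop 5 (.cell 3) maxProg)) (μ := μ₁)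
      (fun i ν => ∀ n < S, (∀ i', 1 ≤ i' → i' ≤ i → Q n i' → i' ≤ ν.nat 12 n) ∧
        (ν.nat 12 n = 0 ∨ (1 ≤ ν.nat 12 n ∧ ν.nat 12 n ≤ i ∧ Q n (ν.nat 12 n)))) ?_ ?_
    · rw [h2] at hmain
      obtain ⟨m1, m2⟩ := hmain n hn
      refine le_antisymm ?_ (Finset.sup_le fun i hi => ?_)
      · rcases m2 with m2 | ⟨m2, m3, m4⟩
        · rw [m2]
          exact Nat.zero_le _
        · exact Finset.le_sup (f := id) ((mem_support_iff L).2 ⟨Finset.mem_Icc.2 ⟨m2, m3⟩, m4⟩)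
      · obtain ⟨hi1, hi2⟩ := (mem_support_iff L).1 hi
        rw [Finset.mem_Icc] at hi1
        exact m1 i hi1.1 hi1.2 hi2
    · exact fun n hn => ⟨fun i' h1 h2 => by omega, Or.inl (hinit n hn)⟩
    · intro i hi ν hag' hν
      have hr := (h'.agree hag' (by decide) (by decide)).setCounter (a := 4) (by decide) i
      have hcol := fun j hj => columnProg_spec (o := o) hr (j := j) hj
      have hagc := agree_run (o := o) columnProg (ν.setNat 4 0 i)
      rw [run_seq]
      set ν₁ := columnProg.run o (ν.setNat 4 0 i)
      have c12 : ν₁.nat 12 = ν.nat 12 := by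
        rw [hagc.nat 12 (by decide)]
        funext j
        simp
      have c4 : ν₁.nat 4 0 = i := by rw [hagc.nat 4 (by decide)]; simp
      have hr₁ := hr.agree hagc (by decide) (by decide)
      have c3 : NatExpr.eval ν₁ (.cell 3) = S := hr₁.internal
      simp only [setNat_nat, and_self, if_true] at hcol
      have hinner := loop_induct (o := o) (a := 5) (n := .cell 3) (p := maxProg) (μ := ν₁)
        (fun k ρ => ∀ n, (n < k → Q n (i + 1) → ρ.nat 12 n = i + 1) ∧
          (¬(n < k ∧ Q n (i + 1)) → ρ.nat 12 n = ν.nat 12 n)) ?_ ?_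
      · rw [c3] at hinner
        intro n hn
        obtain ⟨k1, k2⟩ := hinner n
        obtain ⟨m1, m2⟩ := hν n hn
        by_cases hq : Q n (i + 1)
        · rw [k1 hn hq]
          exact ⟨fun i' _ h2 _ => h2, Or.inr ⟨by omega, le_rfl, hq⟩⟩
        · rw [k2 fun h => hq h.2]
          refine ⟨fun i' h1 h2 h3 => ?_, ?_⟩
          · rcases Nat.le_succ_iff.1 h2 with h2 | rfl
            · exact m1 i' h1 h2 h3
            · exact absurd h3 hq
          · rcases m2 with m2 | ⟨m2, m3, m4⟩
            · exact Or.inl m2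
            · exact Or.inr ⟨m2, by omega, m4⟩
      · exact fun n => ⟨fun h => absurd h (Nat.not_lt_zero _), fun _ => by rw [c12]⟩
      · intro k hk ρ hagρ hρ n
        rw [c3] at hk
        have r10 : ρ.real 10 = ν₁.real 10 := hagρ.real 10 (by decide)
        have r4 : ρ.nat 4 0 = i := by rw [hagρ.nat 4 (by decide), c4]
        have htest : (Test.realLt (.const 0) (.add (.add (.get 10 (.triple (.cell 5) 1))
            (.get 10 (.triple (.cell 5) 2))) (.get 10 (.triple (.cell 5) 3)))).Holds o
            (ρ.setNat 5 0 k) ↔ Q k (i + 1) := by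
          have e : ∀ c, NatExpr.eval (ρ.setNat 5 0 k) (.triple (.cell 5) c) = 3 * k + c := by
            intro c
            simp only [NatExpr.eval, setNat_nat, and_self, if_true]
            ring
          simp only [Test.Holds, RealExpr.eval, e, setNat_real, r10]
          rw [hcol _ (by omega), hcol _ (by omega), hcol _ (by omega), Rat.cast_zero]
          exact column_sum_pos_iff k (i + 1)
        by_cases hq : Q k (i + 1)
        · rw [maxProg, run_ite_pos (htest.2 hq)]
          simp only [run_setNat, setNat_nat, NatExpr.eval, and_self, if_true, r4, true_and]
          by_cases hnk : n = k
          · subst hnk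
            refine ⟨fun _ _ => by simp, fun hc => absurd ⟨Nat.lt_succ_self _, hq⟩ hc⟩
          · have hiff : n < k + 1 ↔ n < k := by omega
            rw [hiff]
            simpa [hnk] using hρ n
        · rw [maxProg, run_ite_neg (fun hc => hq (htest.1 hc)), run_skip]
          obtain ⟨k1, k2⟩ := hρ n
          by_cases hnk : n = k
          · subst hnk
            refine ⟨fun _ hc => absurd hc hq, fun _ => ?_⟩
            simpa using k2 fun hc => hq hc.2
          · have hiff : n < k + 1 ↔ n < k := by omega
            rw [hiff]
            exact ⟨by simpa using k1, by simpa using k2⟩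
  · intro k _ ν _ hν n hn
    rcases Nat.lt_succ_iff_lt_or_eq.1 hn with hn | rfl
    · simp [NatExpr.eval, hn.ne, hν n hn]
    · simp [NatExpr.eval]

/-- The estimate computed by the machine, where `J` holds the largest supported actions. -/
noncomputable def machineEst (o : ℝ → ℝ) (P : Params) (L : State d) (x : Ctx d) (I : ℕ)
    (J : ℕ → ℕ) (k i : ℕ) : ℝ :=
  (if i < I then 0 else (o ((i : ℝ) / 2 ^ P.M) - o ((J (k / 3) : ℝ) / 2 ^ P.M) +
    2 * (1 / 2) ^ (treeNode x (k / 3)).length) / drawCdf P L x i) +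
  (P.α (treeNode x (k / 3)).length / P.γ - P.α (treeNode x (k / 3)).length / drawCdf P L x i)

lemma estimateProg_spec {μ : Mem} (h : ReadyMem P L x μ) {J : ℕ → ℕ} {i k : ℕ}
    (hJ : ∀ n < internalCount P.M, μ.nat 12 n = J n) (hk : k < 3 * internalCount P.M)
    (hcdf : μ.real 11 (i + 1) = drawCdf P L x (i + 1)) (h4 : μ.nat 4 0 = i) (h5 : μ.nat 5 0 = k)
    (hcol : μ.real 10 (k + 1) = nodeLaw P L x (treeNode x (k + 1)) (i + 1)) (j : ℕ) :
    (estimateProg.run o μ).real 12 j = μ.real 12 j + if j = k + 1 then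
      nodeLaw P L x (treeNode x (k + 1)) (i + 1) *
        machineEst o P L x (μ.nat 1 0) J k (i + 1) else 0 := by
  have hp := h.tree.parent k hk
  have hlen : (treeNode x (k / 3)).length < P.M := (length_treeNode_lt_iff x P.M _).2 (by omega)
  have hl := h.tree.level (k / 3) (by omega)
  have hα := h.state.alpha _ hlen.le
  have hγ := h.state.gamma
  have hw := h.width _ hlen.le
  have h2 := h.actions
  have hJ' := hJ (k / 3) (by omega)
  rw [estimateProg, run_seq, run_seq]
  set μ₁ := (Prog.setReal 13 (.const 0) _).run o μ with hμ₁
  have a13 : μ₁.real 13 0 = P.α (treeNode x (k / 3)).length / P.γ -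
      P.α (treeNode x (k / 3)).length / drawCdf P L x (i + 1) := by
    simp [hμ₁, NatExpr.eval, RealExpr.eval, h4, h5, hp, hl, hα, hγ, hcdf]
  have an : μ₁.nat = μ.nat := rfl
  have ar : ∀ b ≠ 13, μ₁.real b = μ.real b := by
    intro b hb
    funext j
    simp [hμ₁, hb]
  clear_value μ₁
  set μ₂ := (Prog.ite (.natLt (.succ (.cell 4)) (.cell 1)) .skip _).run o μ₁ with hμ₂
  have b : μ₂.nat = μ.nat ∧ (∀ b ≠ 13, μ₂.real b = μ.real b) ∧
      μ₂.real 13 0 = machineEst o P L x (μ.nat 1 0) J k (i + 1) := by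
    by_cases hlt : i + 1 < μ.nat 1 0
    · rw [hμ₂, run_ite_pos (by simpa [Test.Holds, NatExpr.eval, an, h4] using hlt)]
      refine ⟨an, ar, ?_⟩
      rw [run_skip, a13, machineEst, if_pos hlt, zero_add]
    · rw [hμ₂, run_ite_neg (by simpa [Test.Holds, NatExpr.eval, an, h4] using hlt)]
      refine ⟨an, fun b hb => ?_, ?_⟩
      · rw [← ar b hb]
        funext j
        simp [hb]
      · rw [machineEst, if_neg hlt, ← a13]
        simp [NatExpr.eval, RealExpr.eval, pointExpr, an, ar 6, ar 11, h4, h5, hp, hl, hcdf, h2,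
          hJ']
        rw [hw]
        simp
  clear_value μ₂
  obtain ⟨bn, br, b13⟩ := b
  by_cases hj : j = k + 1
  · simp [NatExpr.eval, RealExpr.eval, bn, h5, br 12, br 10, b13, hj, hcol]
  · simp [NatExpr.eval, bn, h5, br 12, hj]

lemma lossProg_spec {u : ℝ} {μ : Mem} (h : DrawnMem P L x u μ) {J : ℕ → ℕ}
    (hJ : ∀ n < internalCount P.M, μ.nat 12 n = J n) {k : ℕ} (hk : k < 3 * internalCount P.M) :
    (lossProg.run o μ).real 12 (k + 1) = ∑ i ∈ Finset.Icc 1 (2 ^ P.M),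
      nodeLaw P L x (treeNode x (k + 1)) i * machineEst o P L x (μ.nat 1 0) J k i := by
  set S := internalCount P.M with hS
  rw [lossProg, run_seq]
  set n₀ : NatExpr := .triple (.cell 3) 0 with hn₀
  have hn : ∀ ν : Mem, ν.nat 3 0 = S → n₀.eval ν = 3 * S := by
    intro ν h3
    simp only [hn₀, NatExpr.eval, h3]
    ring
  have hinit := loop_induct (o := o) (a := 4) (n := n₀)
    (p := .setReal 12 (.succ (.cell 4)) (.const 0))
    (μ := μ) (fun k ν => ∀ n < k, ν.real 12 (n + 1) = 0)
    (fun n hn => absurd hn (Nat.not_lt_zero _)) ?_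
  · rw [hn μ h.ready.internal] at hinit
    have hag := agree_run (o := o) (.loop 4 n₀ (.setReal 12 (.succ (.cell 4)) (.const 0))) μ
    set μ₁ := (Prog.loop 4 n₀ (.setReal 12 (.succ (.cell 4)) (.const 0))).run o μ
    have h' := h.ready.agree hag (by decide) (by decide)
    have h2 : NatExpr.eval μ₁ (.cell 2) = 2 ^ P.M := h'.actions
    have g12 : μ₁.nat 12 = μ.nat 12 := hag.nat 12 (by decide)
    have g1 : μ₁.nat 1 = μ.nat 1 := hag.nat 1 (by decide)
    have g11 : μ₁.real 11 = μ.real 11 := hag.real 11 (by decide)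
    have hmain := loop_induct (o := o) (a := 4) (n := .cell 2)
      (p := .seq columnProg (.loop 5 n₀ estimateProg)) (μ := μ₁)
      (fun i ν => ∀ k < 3 * S, ν.real 12 (k + 1) = ∑ i ∈ Finset.Icc 1 i,
        nodeLaw P L x (treeNode x (k + 1)) i * machineEst o P L x (μ.nat 1 0) J k i) ?_ ?_
    · rw [h2] at hmain
      exact hmain k hk
    · exact fun k hk => by rw [hinit k hk]; simp
    · intro i hi ν hag' hν
      rw [h2] at hi
      have hr := (h'.agree hag' (by decide) (by decide)).setCounter (a := 4) (by decide) i
      have hcol := fun j hj => columnProg_spec (o := o) hr (j := j) hj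
      have hagc := agree_run (o := o) columnProg (ν.setNat 4 0 i)
      rw [run_seq]
      set ν₁ := columnProg.run o (ν.setNat 4 0 i)
      have c12 : ν₁.nat 12 = μ.nat 12 := by
        rw [hagc.nat 12 (by decide), ← g12, ← hag'.nat 12 (by decide)]
        funext j
        simp
      have c1 : ν₁.nat 1 = μ.nat 1 := by
        rw [hagc.nat 1 (by decide), ← g1, ← hag'.nat 1 (by decide)]
        funext j
        simp
      have c11 : ν₁.real 11 = μ.real 11 := by
        rw [hagc.real 11 (by decide), ← g11, ← hag'.real 11 (by decide)]
        rfl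
      have cr12 : ν₁.real 12 = ν.real 12 := hagc.real 12 (by decide)
      have c4 : ν₁.nat 4 0 = i := by rw [hagc.nat 4 (by decide)]; simp
      have hr₁ := hr.agree hagc (by decide) (by decide)
      simp only [setNat_nat, and_self, if_true] at hcol
      have hinner := loop_induct (o := o) (a := 5) (n := n₀) (p := estimateProg) (μ := ν₁)
        (fun n ρ => ∀ k < 3 * S, ρ.real 12 (k + 1) = ν.real 12 (k + 1) + if k < n then
          nodeLaw P L x (treeNode x (k + 1)) (i + 1) *
            machineEst o P L x (μ.nat 1 0) J k (i + 1) else 0) ?_ ?_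
      · rw [hn ν₁ hr₁.internal] at hinner
        intro k hk
        rw [hinner k hk, if_pos hk, hν k hk, Finset.sum_Icc_succ_top (by omega)]
      · exact fun k _ => by simp [cr12]
      · intro n hn' ρ hagρ hρ k hk
        rw [hn ν₁ hr₁.internal] at hn'
        have hrρ := (hr₁.agree hagρ (by decide) (by decide)).setCounter (a := 5) (by decide) n
        have r1 : (ρ.setNat 5 0 n).nat 1 0 = μ.nat 1 0 := by
          rw [← c1, ← hagρ.nat 1 (by decide)]
          simp
        have hstep := estimateProg_spec (o := o) hrρ (J := J) (i := i) (k := n) (by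
            intro m hm
            rw [← hJ m hm, ← c12, ← hagρ.nat 12 (by decide)]
            simp) hn' (by
            rw [setNat_real, hagρ.real 11 (by decide), c11]
            exact h.cdf _ (by omega) (by omega)) (by
            rw [← c4, ← hagρ.nat 4 (by decide)]
            simp) (by simp) (by
            rw [setNat_real, hagρ.real 10 (by decide)]
            exact hcol _ (by omega)) (k + 1)
        rw [hstep, r1, setNat_real, hρ k hk]
        rcases lt_trichotomy k n with hkn | rfl | hkn
        · simp [hkn, hkn.ne, hkn.trans (Nat.lt_succ_self n)]
        · simp
        · simp [hkn.ne', show ¬ k < n by omega, show ¬ k < n + 1 by omega]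
  · intro k _ ν _ hν n hn
    rcases Nat.lt_succ_iff_lt_or_eq.1 hn with hn | rfl
    · simp [NatExpr.eval, hn.ne, hν n hn]
    · simp [NatExpr.eval, RealExpr.eval]

/-- Distinct nodes have distinct codes, so each active child is updated exactly once and all other
nodes keep their losses, although the same array serves the trees of all contexts. -/
lemma accumulateProg_spec {μ : Mem} (h3 : μ.nat 3 0 = internalCount P.M)
    (ht : TreeMem x (3 * internalCount P.M) μ) :
    (∀ k < 3 * internalCount P.M, (accumulateProg.run o μ).real 5 (code (treeNode x (k + 1))) =
      μ.real 5 (code (treeNode x (k + 1))) + μ.real 12 (k + 1)) ∧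
    ∀ v : BinNode d, (∀ k < 3 * internalCount P.M, v ≠ treeNode x (k + 1)) →
      (accumulateProg.run o μ).real 5 (code v) = μ.real 5 (code v) := by
  set S := internalCount P.M
  set n₀ : NatExpr := .triple (.cell 3) 0 with hn₀
  have hn : n₀.eval μ = 3 * S := by
    simp only [hn₀, NatExpr.eval, h3]
    ring
  have h := loop_induct (o := o) (a := 4) (n := n₀) (p := .setReal 5 (.get 9 (.succ (.cell 4)))
      (.add (.get 5 (.get 9 (.succ (.cell 4)))) (.get 12 (.succ (.cell 4))))) (μ := μ)
    (fun n ν => (∀ k < 3 * S, ν.real 5 (code (treeNode x (k + 1))) =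
      μ.real 5 (code (treeNode x (k + 1))) + if k < n then μ.real 12 (k + 1) else 0) ∧
      ∀ v : BinNode d, (∀ k < 3 * S, v ≠ treeNode x (k + 1)) →
        ν.real 5 (code v) = μ.real 5 (code v)) ⟨fun k _ => by simp, fun _ _ => rfl⟩ ?_
  · rw [hn] at h
    refine ⟨fun k hk => ?_, h.2⟩
    have := h.1 k hk
    rwa [if_pos hk] at this
  · intro n hn' ν hag ⟨i1, i2⟩
    rw [hn] at hn'
    have hc : ν.nat 9 (n + 1) = code (treeNode x (n + 1)) := by
      rw [hag.nat 9 (by decide)]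
      exact ht.code (n + 1) (by omega)
    have h12 : ν.real 12 = μ.real 12 := hag.real 12 (by decide)
    refine ⟨fun k hk => ?_, fun v hv => ?_⟩
    · by_cases hkn : k = n
      · subst hkn
        have := i1 k hk
        simp only [lt_irrefl, if_false, add_zero] at this
        simp [NatExpr.eval, RealExpr.eval, hc, h12, this]
      · have hne : code (treeNode x (k + 1)) ≠ code (treeNode x (n + 1)) := fun he =>
          hkn (by have := treeNode_injective x (code_injective he); omega)
        have hiff : k < n + 1 ↔ k < n := by omega
        simpa [NatExpr.eval, hc, hne, hiff] using i1 k hk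
    · have hne : code v ≠ code (treeNode x (n + 1)) := fun he => hv n hn' (code_injective he)
      simpa [NatExpr.eval, hc, hne] using i2 v hv

/-- One-sided feedback suffices: a loss enters only if I ≤ i, and the reference action is the
largest supported one, hence at least i and also observed. -/
lemma machineEst_eq (I : ℕ) (ℓ : unitInterval → unitInterval) {J : ℕ → ℕ} (hJ : ∀ n < internalCount P.M,
      J n = (support P L x (activeExp x (treeNode x n))).sup id) {k : ℕ}
    (hk : k < 3 * internalCount P.M) :
    ∑ i ∈ Finset.Icc 1 (2 ^ P.M), nodeLaw P L x (treeNode x (k + 1)) i *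
      machineEst (oneSided P.M I ℓ) P L x I J k i =
    expertLoss P L x ℓ I (activeExp x (treeNode x (k / 3))) (coeff (k % 3)) := by
  set w := activeExp x (treeNode x (k / 3)) with hw
  rw [expertLoss, sum_support L w (coeff (k % 3)) (lossEst P L x ℓ I w), treeNode_succ, ← hw]
  refine Finset.sum_congr rfl fun i hi => ?_
  -- For an action outside the support the reference action may be below the draw and its query
  -- blind; such terms carry probability 0.
  by_cases h0 : nodeLaw P L x (child w (coeff (k % 3))) i = 0
  · rw [h0, zero_mul, zero_mul]
  congr 1
  have hsupp : i ∈ support P L x w :=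
    (mem_support_iff L).2 ⟨hi, _, (nodeLaw_nonneg _ _ _ _ _).lt_of_ne' h0⟩
  obtain ⟨hj1, hj2⟩ := sup_support_mem L hsupp
  have hJk : J (k / 3) = (support P L x w).sup id := hJ _ (by omega)
  have hjN := (Finset.mem_Icc.1 ((mem_support_iff L).1 hj1).1).2
  have hpt : ∀ a, I ≤ a → a ≤ 2 ^ P.M →
      oneSided P.M I ℓ ((a : ℝ) / 2 ^ P.M) = ℓ (grid P.M a) := by
    intro a h1 h2
    have hp : (0 : ℝ) < 2 ^ P.M := by positivity
    rw [oneSided, if_pos]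
    · rfl
    · refine ⟨div_le_div_of_nonneg_right (by exact_mod_cast h1) hp.le, ?_⟩
      rw [div_le_one hp]
      exact_mod_cast h2
  rw [machineEst, lossEst_eq, shiftedLoss, hJk]
  have hwl : w.1.length = (treeNode x (k / 3)).length := rfl
  rw [hwl]
  by_cases hI : i < I
  · rw [if_pos hI, if_neg (by omega), mul_zero]
  · rw [if_neg hI, if_pos (by omega), mul_one, hpt i (by omega) (Finset.mem_Icc.1 hi).2,
      hpt _ (by omega) hjN]
    congr 3
    rw [zpow_sub₀ two_ne_zero, zpow_one, zpow_natCast, div_pow, one_pow]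
    ring

lemma updateProg_spec {u : ℝ} {μ : Mem} (h : DrawnMem P L x u μ)
    (ℓ : unitInterval → unitInterval) :
    StateMem P (updateState P L x ℓ (μ.nat 1 0))
      (updateProg.run (oneSided P.M (μ.nat 1 0) ℓ) μ) := by
  set I := μ.nat 1 0 with hI
  set o := oneSided P.M I ℓ with ho
  set S := internalCount P.M with hS
  rw [updateProg, run_seq, run_seq]
  have hs1 := fun n hn => supportProg_spec (o := o) h.ready (n := n) hn
  have hag1 := agree_run (o := o) supportProg μ
  set μ₁ := supportProg.run o μ
  have n1 : μ₁.nat 1 = μ.nat 1 := hag1.nat 1 (by decide)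
  have h1 : DrawnMem P L x u μ₁ :=
    ⟨h.ready.agree hag1 (by decide) (by decide),
      by rw [hag1.real 11 (by decide)]; exact h.cdf,
      by rw [n1]; exact h.one_le, by rw [n1]; exact h.below, by rw [n1]; exact h.above⟩
  have hl := fun k hk => lossProg_spec (o := o) h1 (J := μ₁.nat 12) (fun _ _ => rfl) (k := k) hk
  have hag2 := agree_run (o := o) lossProg μ₁
  set μ₂ := lossProg.run o μ₁
  have h2 := h1.ready.agree hag2 (by decide) (by decide)
  obtain ⟨a1, a2⟩ := accumulateProg_spec (o := o) (x := x) (P := P) h2.internal h2.tree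
  have hag3 := agree_run (o := o) accumulateProg μ₂
  set μ₃ := accumulateProg.run o μ₂
  have hI1 : μ₁.nat 1 0 = I := by rw [n1]
  refine ⟨?_, ?_, ?_, ?_, fun w hw c => ?_⟩
  · rw [hag3.nat 0 (by decide)]; exact h2.state.depth
  · rw [hag3.real 0 (by decide)]; exact h2.state.gamma
  · rw [hag3.real 1 (by decide)]; exact h2.state.eta
  · rw [hag3.real 2 (by decide)]; exact h2.state.alpha
  · rw [updateState]
    by_cases hx : x ∈ cubeOf w
    · rw [if_pos ⟨hw, hx⟩]
      obtain ⟨hact, hbit⟩ := (mem_cubeOf_iff x w).1 hx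
      obtain ⟨n, hn⟩ := exists_treeNode hact
      have hwe : activeExp x (treeNode x n) = w := by
        rw [hn]
        exact Prod.ext rfl hbit.symm
      have hnS : n < S := (length_treeNode_lt_iff x P.M n).1 (by rw [hn]; exact hw)
      have hc := coeffIndex_lt c
      set k := 3 * n + coeffIndex c with hk
      have hk3 : k / 3 = n := by omega
      have hkm : k % 3 = coeffIndex c := by omega
      have hchild : child w c = treeNode x (k + 1) := by
        rw [treeNode_succ, hk3, hkm, hwe, coeff_coeffIndex]
      have hkS : k < 3 * S := by omega
      rw [hchild, a1 k hkS, ← hchild, h2.state.loss w hw c, hl k hkS]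
      congr 1
      have he := machineEst_eq (L := L) I ℓ (J := μ₁.nat 12) hs1 hkS
      rw [hk3, hkm, hwe, coeff_coeffIndex] at he
      rw [hI1]
      exact he
    · rw [if_neg (fun hc => hx hc.2), add_zero, a2, h2.state.loss w hw c]
      -- The enumerated nodes are children of active nodes, so a child of an inactive `w` is never
      -- among the addresses written.
      intro k _ hc
      rw [treeNode_succ, child, child] at hc
      obtain ⟨e1, e2⟩ := List.append_inj' hc rfl
      apply hx
      have e3 : w.2 = (activeExp x (treeNode x (k / 3))).2 := by
        have := (List.cons.inj e2).1
        exact congrArg Prod.fst this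
      rw [show w = activeExp x (treeNode x (k / 3)) from Prod.ext e1 e3]
      exact mem_cubeOf_activeExp (active_treeNode x _)

end feedback

/-! ### The learner draws actions from the laws of the algorithm -/

section draws

variable {d : ℕ} {P : Params} (L : State d) (x : Ctx d)

lemma drawCdf_zero : drawCdf P L x 0 = 0 := by simp [drawCdf]

lemma drawCdf_of_le (hM : 1 ≤ P.M) {i : ℕ} (hi : 2 ^ P.M ≤ i) : drawCdf P L x i = 1 := by
  rw [← sum_drawLaw L x hM, drawCdf]
  symm
  exact Finset.sum_subset (Finset.Icc_subset_Icc le_rfl hi) fun k _ hk => drawLaw_eq_zero L x hk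

lemma drawCdf_le_one (hP : P.Admissible) (i : ℕ) : drawCdf P L x i ≤ 1 := by
  rw [← drawCdf_of_le L x hP.one_le_M (le_max_right i (2 ^ P.M))]
  exact drawCdf_mono L x hP (le_max_left _ _)

lemma drawCdf_nonneg (hP : P.Admissible) (i : ℕ) : 0 ≤ drawCdf P L x i :=
  Finset.sum_nonneg fun k _ => drawLaw_nonneg L x hP k

/-- With truncated subtraction this also holds at k = 0, where both sides vanish; sequences
containing impossible actions then need no separate treatment. -/
lemma drawCdf_sub (k : ℕ) : drawCdf P L x k - drawCdf P L x (k - 1) = drawLaw P L x k := by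
  rcases k with _ | k
  · rw [drawLaw_eq_zero L x (by simp), Nat.zero_sub, sub_self]
  · rw [drawCdf, Finset.sum_Icc_succ_top (by omega), Nat.add_sub_cancel, drawCdf,
      add_sub_cancel_left]

variable {L x}

/-- Inversion of the cumulative distribution function: the half-open intervals for different actions
are disjoint, and the chosen action is the one whose interval contains `u`. -/
lemma DrawnMem.action_eq_iff (hP : P.Admissible) {u : ℝ} {μ : Mem} (h : DrawnMem P L x u μ)
    (hu : u ∈ Set.Ico (0 : ℝ) 1) (k : ℕ) :
    μ.nat 1 0 = k ↔ u ∈ Set.Ico (drawCdf P L x (k - 1)) (drawCdf P L x k) := by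
  have hmono := drawCdf_mono L x hP
  obtain ⟨-, -, h1, hbelow, habove⟩ := h
  set n := μ.nat 1 0
  have hbelow' : drawCdf P L x (n - 1) ≤ u := by
    rcases hbelow with hn | hn
    · rw [hn, Nat.sub_self, drawCdf_zero]
      exact hu.1
    · exact hn
  -- The scan would end at 2^M + 1 only if `u` were at least the total mass 1.
  have hn : n ≤ 2 ^ P.M := by
    by_contra hlt
    rw [drawCdf_of_le L x hP.one_le_M (by omega)] at hbelow'
    exact absurd hu.2 hbelow'.not_gt
  have hun : u < drawCdf P L x n := habove n le_rfl hn
  constructor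
  · rintro rfl
    exact ⟨hbelow', hun⟩
  · rintro ⟨h2, h3⟩
    rcases lt_trichotomy n k with hlt | heq | hlt
    · exact absurd (hun.trans_le (hmono (show n ≤ k - 1 by omega))) h2.not_gt
    · exact heq
    · exact absurd (h3.trans_le (hmono (show k ≤ n - 1 by omega))) hbelow'.not_gt

end draws

section learner

variable {d : ℕ} {P : Params}

lemma stateMem_initMem : StateMem P (fun (_ : ExpNode d) _ => 0) (initMem P) where
  depth := by simp [initMem]
  gamma := by simp [initMem]
  eta m hm := by simp [initMem, hm]
  alpha m hm := by simp [initMem, hm]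
  loss w _ c := by simp [initMem]

lemma StateMem.receive {L : State d} {μ : Mem} (h : StateMem P L μ) (x : Ctx d) (u : ℝ) :
    StateMem P L (HierExp4Star.receive x u μ) :=
  ⟨h.depth, h.gamma, h.eta, h.alpha, h.loss⟩

lemma drawnMem_afterSelect {L : State d} {μ : Mem} (h : StateMem P L μ) (x : Ctx d) (u : ℝ) :
    DrawnMem P L x u ((treeLearner d).afterSelect x u μ).1 := by
  have := selectProg_spec (o := blind) (h.receive x u) (x := x) fun j => by
    simp [HierExp4Star.receive]
  have h4 : (HierExp4Star.receive x u μ).real 4 0 = u := by simp [HierExp4Star.receive]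
  rwa [h4] at this

variable (x : ℕ → Ctx d) (ℓ : ℕ → unitInterval → unitInterval)

lemma stateMem_memAt (u : ℕ → ℝ) (t : ℕ) :
    StateMem P (stateAt P x ℓ ((treeLearner d).playAt P x ℓ u) t)
      ((treeLearner d).memAt P x ℓ u t) := by
  induction t with
  | zero => exact stateMem_initMem
  | succ t ih => exact updateProg_spec (drawnMem_afterSelect ih (x t) (u t)) (ℓ t)

lemma playAt_eq_iff (hP : P.Admissible) {u : ℕ → ℝ} {t : ℕ} (hu : u t ∈ Set.Ico (0 : ℝ) 1)
    {h : ℕ → ℕ} (hh : ∀ s < t, (treeLearner d).playAt P x ℓ u s = h s) (k : ℕ) :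
    (treeLearner d).playAt P x ℓ u t = k ↔
      u t ∈ Set.Ico (drawCdf P (stateAt P x ℓ h t) (x t) (k - 1))
        (drawCdf P (stateAt P x ℓ h t) (x t) k) := by
  have h1 := stateMem_memAt (P := P) x ℓ u t
  rw [stateAt_congr P x ℓ hh] at h1
  exact (drawnMem_afterSelect h1 (x t) (u t)).action_eq_iff hP hu k

/-- Once the actions are prescribed, the states are deterministic, so every round constrains its own
random number to a fixed interval. The event is a box inside the unit cube and its volume is the
product of the conditional probabilities. -/
lemma treeLearner_implements (hP : P.Admissible) (T : ℕ) :
    (treeLearner d).Implements P T x ℓ := by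
  intro h
  set F : ℕ → ℕ → ℝ := fun t => drawCdf P (stateAt P x ℓ (pad h) t) (x t) with hF
  have hpad {β : Type} [Zero β] (g : Fin T → β) (t : Fin T) : pad g t = g t := by simp [pad]
  have hset : {u : Fin T → ℝ | (∀ t, u t ∈ Set.Ico (0 : ℝ) 1) ∧
      ∀ t : Fin T, (treeLearner d).playAt P x ℓ (pad u) t = h t} =
      Set.pi Set.univ fun t : Fin T => Set.Ico (F t (h t - 1)) (F t (h t)) := by
    ext u
    simp only [Set.mem_ofPred_eq, Set.mem_univ_pi]
    constructor
    · rintro ⟨hu, hplay⟩ t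
      have := (playAt_eq_iff x ℓ hP (u := pad u) (t := t) (h := pad h) (by rw [hpad]; exact hu t)
        (fun s hs => (hplay ⟨s, hs.trans t.2⟩).trans (hpad h _).symm) (h t)).1 (hplay t)
      rwa [hpad] at this
    · intro hu
      have hu' : ∀ t, u t ∈ Set.Ico (0 : ℝ) 1 := fun t =>
        ⟨(drawCdf_nonneg _ _ hP _).trans (hu t).1, (hu t).2.trans_le (drawCdf_le_one _ _ hP _)⟩
      refine ⟨hu', ?_⟩
      rintro ⟨t, ht⟩
      -- The interval for round t produces the prescribed action only if the earlier rounds produced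
      -- theirs, since the state depends on them.
      induction t using Nat.strong_induction_on with
      | _ t ih =>
        refine (playAt_eq_iff x ℓ hP (u := pad u) (t := t) (h := pad h)
          (by rw [hpad u ⟨t, ht⟩]; exact hu' _)
          (fun s hs => (ih s hs (hs.trans ht)).trans (hpad h ⟨s, hs.trans ht⟩).symm) _).2 ?_
        rw [hpad u ⟨t, ht⟩]
        exact hu ⟨t, ht⟩
  rw [hset, MeasureTheory.volume_pi_pi, pathProb,
    ENNReal.ofReal_prod_of_nonneg fun t _ => drawLaw_nonneg _ _ hP _]
  exact Finset.prod_congr rfl fun t _ => by rw [Real.volume_Ico, hF, drawCdf_sub]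

/-! ### Running time of the learner -/

lemma growth_levelsProg_le {μ : Mem} {M : ℕ} (hM : μ.nat 0 0 = M) :
    (levelsProg d).growth μ ≤ (d + 1) * (2 ^ M * (2 * 3 ^ M)) := by
  have h1 : max 1 M ≤ 2 ^ M := max_le Nat.one_le_two_pow M.lt_two_pow_self.le
  have h2 : max 1 d ≤ d + 1 := by omega
  have h3 : 1 ≤ 2 * 3 ^ M := by have := Nat.one_le_pow M 3 (by omega); omega
  have h4 : max 1 M * max 1 d ≤ (d + 1) * (2 ^ M * (2 * 3 ^ M)) := by
    rw [mul_comm]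
    exact Nat.mul_le_mul h2 (h1.trans (Nat.le_mul_of_pos_right _ h3))
  have h5 : 1 ≤ max 1 M * max 1 d := Nat.mul_pos (by omega) (by omega)
  simp [Prog.growth, levelsProg, levelProg, bitProg, NatExpr.eval, hM]
  omega

lemma max_le_of_internalCount {M : ℕ} {A : ℕ} (hA : A ≤ 2 * 3 ^ M) :
    A ≤ 2 ^ M * (2 * 3 ^ M) ∧ max 1 (2 ^ M) * A ≤ 2 ^ M * (2 * 3 ^ M) := by
  have h1 : 1 ≤ 2 ^ M := Nat.one_le_two_pow
  rw [max_eq_right h1]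
  exact ⟨hA.trans (Nat.le_mul_of_pos_left _ h1), Nat.mul_le_mul_left _ hA⟩

lemma growth_choiceProg_le {μ : Mem} {M : ℕ} (h2 : μ.nat 2 0 = 2 ^ M)
    (h3 : μ.nat 3 0 = internalCount M) :
    (choiceProg d).growth μ ≤ 2 ^ M * (2 * 3 ^ M) := by
  have h := two_mul_internalCount M
  set S := internalCount M
  have e1 := (max_le_of_internalCount (M := M) (A := S + S + S) (by omega)).1
  have e2 := (max_le_of_internalCount (M := M) (A := 1) (by omega)).1
  have e3 := (max_le_of_internalCount (M := M) (A := max (S + S + 1) (max 1 S)) (by omega)).2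
  simp [Prog.growth, choiceProg, treeProg, nodeProg, weightsProg, expProg, normProg, drawProg,
    cdfProg, columnProg, leafProg, mixProg, NatExpr.eval, h2, h3]
  exact ⟨e1, e2, e3⟩

lemma growth_updateProg_le {μ : Mem} {M : ℕ} (h2 : μ.nat 2 0 = 2 ^ M)
    (h3 : μ.nat 3 0 = internalCount M) :
    updateProg.growth μ ≤ 2 ^ M * (2 * 3 ^ M) := by
  have h := two_mul_internalCount M
  set S := internalCount M
  have e1 := (max_le_of_internalCount (M := M) (A := S + S + S) (by omega)).1
  have e2 := (max_le_of_internalCount (M := M) (A := 1) (by omega)).1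
  have e3 := (max_le_of_internalCount (M := M) (A := max (S + S + 1) (max 1 S)) (by omega)).2
  have e4 := (max_le_of_internalCount (M := M) (A := max (S + S + 1) (max 1 (S + S + S)))
    (by omega)).2
  simp [Prog.growth, updateProg, supportProg, lossProg, accumulateProg, estimateProg, maxProg,
    columnProg, leafProg, mixProg, NatExpr.eval, h2, h3]
  exact ⟨e3, e4, e2, e1⟩

/-- The deepest nesting runs through all nodes, at most 2·3^M, for each of the 2^M actions. The
selection is split in two because its first part computes the loop bounds of the second; each part
leaves its own bounds unchanged, as `Prog.time_le` requires. -/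
lemma timeAt_le (u : ℕ → ℝ) (t : ℕ) :
    (treeLearner d).timeAt P x ℓ u t ≤
      ((levelsProg d).size * (d + 1) + (choiceProg d).size + updateProg.size) *
        (2 ^ P.M * (2 * 3 ^ P.M)) := by
  have hs := (stateMem_memAt (P := P) x ℓ u t).receive (x t) (u t)
  have hd := drawnMem_afterSelect (stateMem_memAt (P := P) x ℓ u t) (x t) (u t)
  set μ := HierExp4Star.receive (x t) (u t) ((treeLearner d).memAt P x ℓ u t) with hμ
  have hl := levelsProg_spec (o := blind) (x t) μ fun j => by simp [hμ, HierExp4Star.receive]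
  rw [hs.depth] at hl
  set μ₁ := (levelsProg d).run blind μ with hμ₁
  set μ₂ := ((treeLearner d).afterSelect (x t) (u t) ((treeLearner d).memAt P x ℓ u t)).1 with hμ₂
  have t1 := (levelsProg d).time_le blind [0]
    (by simp [Prog.boundArrays, NatExpr.arrays, levelsProg, levelProg, bitProg])
    (by simp [Prog.natOut, levelsProg, levelProg, bitProg]) μ μ (fun _ _ => rfl)
  have t2 := (choiceProg d).time_le blind [2, 3]
    (by simp [Prog.boundArrays, NatExpr.arrays, choiceProg, treeProg, nodeProg, weightsProg,
      expProg, normProg, drawProg, cdfProg, columnProg, leafProg, mixProg])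
    (by simp [Prog.natOut, choiceProg, treeProg, nodeProg, weightsProg,
      expProg, normProg, drawProg, cdfProg, columnProg, leafProg, mixProg]) μ₁ μ₁ (fun _ _ => rfl)
  have t3 := updateProg.time_le (oneSided P.M ((treeLearner d).playAt P x ℓ u t) (ℓ t)) [2, 3]
    (by decide) (by decide) μ₂ μ₂ (fun _ _ => rfl)
  have g1 := t1.trans (Nat.mul_le_mul_left _ (growth_levelsProg_le (d := d) hs.depth))
  have g2 := t2.trans (Nat.mul_le_mul_left _ (growth_choiceProg_le (d := d) hl.actions hl.internal))
  have g3 := t3.trans (Nat.mul_le_mul_left _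
    (growth_updateProg_le hd.ready.actions hd.ready.internal))
  calc (treeLearner d).timeAt P x ℓ u t
      = ((levelsProg d).exec blind μ).2 + ((choiceProg d).exec blind μ₁).2 +
        (updateProg.exec (oneSided P.M ((treeLearner d).playAt P x ℓ u t) (ℓ t)) μ₂).2 := rfl
    _ ≤ _ := add_le_add (add_le_add g1 g2) g3
    _ = _ := by ring

end learner

/-! ### Running time under the tuning -/

lemma inv_tunedGamma_le {d : ℕ} (hd : 1 ≤ d) {T : ℕ} (hT : 3 ≤ T) :
    1 / tunedGamma d T ≤ 10 * (T : ℝ) ^ (1 / ((d : ℝ) + 2 / 3)) := by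
  have hT0 : (0 : ℝ) < T := by positivity
  rcases hd.eq_or_lt with rfl | hd
  -- For d = 1 the target exponent is 3/5 = 1/2 + 1/10, so the logarithm in 1/γ is absorbed by the
  -- spare power 1/10, at the price of the factor 10.
  · have h1 := Real.log_le_rpow_div hT0.le (show (0 : ℝ) < 1 / 10 by norm_num)
    have h2 : (0 : ℝ) ≤ (T : ℝ) ^ (1 / 2 : ℝ) := by positivity
    calc 1 / tunedGamma 1 T = (T : ℝ) ^ (1 / 2 : ℝ) * Real.log T := by
          rw [tunedGamma, if_pos rfl, Real.rpow_neg hT0.le, one_div, mul_inv, inv_inv, inv_inv]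
      _ ≤ (T : ℝ) ^ (1 / 2 : ℝ) * ((T : ℝ) ^ (1 / 10 : ℝ) / (1 / 10)) :=
        mul_le_mul_of_nonneg_left h1 h2
      _ = 10 * ((T : ℝ) ^ (1 / 2 : ℝ) * (T : ℝ) ^ (1 / 10 : ℝ)) := by ring
      _ = _ := by
        rw [← Real.rpow_add hT0]
        norm_num
  · rw [tunedGamma_eq hd, Real.rpow_neg hT0.le, one_div, inv_inv]
    have : (0 : ℝ) ≤ (T : ℝ) ^ (1 / ((d : ℝ) + 2 / 3)) := by positivity
    linarith

lemma two_pow_mul_three_pow (M : ℕ) :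
    (2 : ℝ) ^ M * 3 ^ M = ((2 : ℝ) ^ M) ^ (1 + Real.logb 2 3) := by
  rw [Real.rpow_add (by positivity), Real.rpow_one, ← Real.rpow_natCast 2 M, ← Real.rpow_mul
    (by norm_num), mul_comm (M : ℝ) (Real.logb 2 3), Real.rpow_mul (by norm_num),
    Real.rpow_logb (by norm_num) (by norm_num) (by norm_num), Real.rpow_natCast, Real.rpow_natCast]

lemma two_pow_mul_three_pow_tunedDepth_le {d : ℕ} (hd : 1 ≤ d) {T : ℕ} (hT : 3 ≤ T) :
    (2 : ℝ) ^ tunedDepth d T * 3 ^ tunedDepth d T ≤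
      20 ^ (1 + Real.logb 2 3) * (T : ℝ) ^ ((1 + Real.logb 2 3) / ((d : ℝ) + 2 / 3)) := by
  have ha : 0 ≤ 1 + Real.logb 2 3 := by
    have := Real.logb_nonneg (b := 2) (x := 3) (by norm_num) (by norm_num)
    linarith
  have h1 := two_pow_tunedDepth_le d hT
  have h2 := inv_tunedGamma_le hd hT
  calc (2 : ℝ) ^ tunedDepth d T * 3 ^ tunedDepth d T
      = ((2 : ℝ) ^ tunedDepth d T) ^ (1 + Real.logb 2 3) := two_pow_mul_three_pow _
    _ ≤ (20 * (T : ℝ) ^ (1 / ((d : ℝ) + 2 / 3))) ^ (1 + Real.logb 2 3) :=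
      Real.rpow_le_rpow (by positivity) (by linarith) ha
    _ = _ := by
      rw [Real.mul_rpow (by norm_num) (by positivity), ← Real.rpow_mul (by positivity),
        div_mul_eq_mul_div, one_mul]

lemma exists_timeAt_tuned_le {d : ℕ} (hd : 1 ≤ d) :
    ∃ C : ℝ, ∀ T, 3 ≤ T → ∀ (x : ℕ → Ctx d) (ℓ : ℕ → unitInterval → unitInterval) (u : ℕ → ℝ)
      (t : ℕ), ((treeLearner d).timeAt (tuned d T) x ℓ u t : ℝ) ≤
        C * (T : ℝ) ^ ((1 + Real.logb 2 3) / ((d : ℝ) + 2 / 3)) := by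
  obtain ⟨K, hK⟩ : ∃ K : ℕ, ∀ (P : Params) (x : ℕ → Ctx d) (ℓ : ℕ → unitInterval → unitInterval)
      (u : ℕ → ℝ) (t : ℕ),
      (treeLearner d).timeAt P x ℓ u t ≤ K * (2 ^ P.M * (2 * 3 ^ P.M)) :=
    ⟨_, fun _ => timeAt_le⟩
  refine ⟨K * 2 * 20 ^ (1 + Real.logb 2 3), fun T hT x ℓ u t => ?_⟩
  have h1 : ((treeLearner d).timeAt (tuned d T) x ℓ u t : ℝ) ≤
      ((K * (2 ^ tunedDepth d T * (2 * 3 ^ tunedDepth d T)) : ℕ) : ℝ) :=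
    Nat.cast_le.2 (hK (tuned d T) x ℓ u t)
  push_cast at h1
  calc _ ≤ _ := h1
    _ = K * 2 * ((2 : ℝ) ^ tunedDepth d T * 3 ^ tunedDepth d T) := by ring
    _ ≤ _ := mul_le_mul_of_nonneg_left (two_pow_mul_three_pow_tunedDepth_le hd hT) (by positivity)
    _ = _ := by ring

end HierExp4Star

theorem theorem4 (d : ℕ) (hd : 1 ≤ d) :
    (∃ C : ℝ, ∀ (T : ℕ), 3 ≤ T →
      ∀ (x : ℕ → HierExp4Star.Ctx d) (ℓ : ℕ → unitInterval → unitInterval),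
        (∀ t < T, LipschitzWith 1 (ℓ t)) →
        HierExp4Star.regret (HierExp4Star.tuned d T) T x ℓ ≤
          if d = 1 then C * Real.sqrt ((T : ℝ) * Real.log T)
          else C * ((T : ℝ) ^ (((d : ℝ) - 1 / 3) / ((d : ℝ) + 2 / 3)) *
            Real.log T ^ (3 / 2 : ℝ))) ∧
    (∃ (A : HierExp4Star.Learner) (C : ℝ), ∀ (T : ℕ), 3 ≤ T →
      ∀ (x : ℕ → HierExp4Star.Ctx d) (ℓ : ℕ → unitInterval → unitInterval),
        (∀ t < T, LipschitzWith 1 (ℓ t)) →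
        A.Implements (HierExp4Star.tuned d T) T x ℓ ∧
        ∀ u : ℕ → ℝ, (∀ t < T, u t ∈ Set.Ico (0 : ℝ) 1) → ∀ t < T,
          (A.timeAt (HierExp4Star.tuned d T) x ℓ u t : ℝ) ≤
            C * (T : ℝ) ^ ((1 + Real.logb 2 3) / ((d : ℝ) + 2 / 3))) := by
  refine ⟨HierExp4Star.exists_tuned_regret_le hd, ?_⟩
  obtain ⟨C, hC⟩ := HierExp4Star.exists_timeAt_tuned_le hd
  exact ⟨HierExp4Star.treeLearner d, C, fun T hT x ℓ _ =>
    ⟨HierExp4Star.treeLearner_implements x ℓ (HierExp4Star.tuned_admissible d hT) T,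
      fun u _ t _ => hC T hT x ℓ u t⟩⟩
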